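/- **Setting.** Let $\mathcal S,\mathcal A$ be measurable spaces, $m$ a $\sigma$-finite measure on $\mathcal S$, $\Theta$ a measurable parameter space, and let $p_\theta(s'\mid s,a)$, $\theta\in\Theta$, be transition densities with respect to $m$, jointly measurable in $(\theta,s,a,s')$; $\theta_0\in\Theta$ is the true parameter. Each episode starts from $S_0\sim\rho$, evolves under $p_\theta$ and a (randomized) policy $\pi$ that uses only the history of the current episode, and ends at the (possibly random) time $T$ at which a measurable set of terminal states is first reached; $T<\infty$ almost surely under $\theta_0,\pi$. Hence the episodes are i.i.d.; $P_{\theta,\pi}$, $\mathbb E_{\theta,\pi}$ refer to their law. Rewards are functions of state and action. For $t\in\mathbb N$, the history $H_t$ consists of $N=N_t\ge1$ (for all large $t$) completed episodes, followed possibly by the first $r_t\ge 0$ steps of the next episode (stopped if that episode ends earlier), where $N_t,r_t$ are deterministic. $P_t$ is a prior probability on $\Theta$ and $P_t(\cdot\mid H_t)$ the posterior. Let $\lambda$ be a finite measure on $\mathcal S\times\mathcal A$ such that for every $t$ the measure $P_{\theta_0,\pi}(S_t\in\cdot,A_t\in\cdot,\,t<T)$ has a density $p^t_{\theta_0,\pi}$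 with respect to $\lambda$. For $w\ge0$ on $\mathcal S\times\mathcal A$ put $$d_w^2(\theta,\theta')=\int\!\!\int\Big(\sqrt{p_\theta(s'|s,a)}-\sqrt{p_{\theta'}(s'|s,a)}\Big)^2dm(s')\,w(s,a)\,d\lambda(s,a),$$ let $N(r,B,d)$ be the minimal number of $d$-balls of radius $r$ needed to cover $B$, and, for a real $n>0$, let $$B^*(\theta_0,\epsilon;n)=\{\theta:\ \mathbb E_{\theta_0,\pi}Y_\theta\le\epsilon^2,\ \mathbb E_{\theta_0,\pi}|Y_\theta|^n\le\epsilon^n\},\qquad Y_\theta=\sum_{t=1}^{T}\log\frac{p_{\theta_0}(S_t|S_{t-1},A_{t-1})}{p_\theta(S_t|S_{t-1},A_{t-1})},$$ (with $Y_\theta$ required to be integrable). **Theorem.** Assume that there are $d>c>0$ with $c\,p_{\theta_0}(s'|s,a)\le p_\theta(s'|s,a)\le d\,p_{\theta_0}(s'|s,a)$ for all $s,s'\in\mathcal S$, $a\in\mathcal A$, $\theta\in\Theta$. Then there are constants $K>0$, $\xi\in(0,1)$ and $\delta_\mu\ne\delta_\nu$ in $(0,1)$, not depending on $\rho$, $\pi$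 and $\lambda$, such that with $\mu=\sum_{t\ge0}\delta_\mu^t\,p^t_{\theta_0,\pi}$ and $\nu=\sum_{t\ge0}\delta_\nu^t\,p^t_{\theta_0,\pi}$ the following two statements hold. (i) For all $N\ge0$ and $\theta_1\in\Theta$ there is a test $\phi\in[0,1]$ based on $N$ completed episodes such that $$\mathbb E_{\theta_0,\pi}\phi\le e^{-KNd_\mu^2(\theta_0,\theta_1)},\qquad \sup_{\theta:\,d_\nu(\theta,\theta_1)\le\xi d_\mu(\theta_0,\theta_1)}\mathbb E_{\theta,\pi}(1-\phi)\le e^{-KNd_\mu^2(\theta_0,\theta_1)}.$$ (ii) Let $\epsilon_t>0$, $\epsilon_t\to0$, $1/(N_t\epsilon_t^2)=O(1)$, and suppose that for all sufficiently large $t$ $$\sup_{\epsilon>\epsilon_t}\log N\big(\tfrac12\xi\epsilon,\{\theta:d_\mu(\theta,\theta_0)<\epsilon\},d_\nu\big)\le N_t\epsilon_t^2,$$ and that there is $j_0$ such that for all sufficiently large $t$ and all integers $j\ge j_0$ $$\frac{P_t(\theta:\ j\epsilon_t<d_\mu(\theta,\theta_0)\le(j+1)\epsilon_t)}{P_t(B^*(\theta_0,\epsilon_t;n))}\le\exp\{KN_t\epsilon_t^2j^2/2\}$$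 (where $0/0=0$ and $x/0=\infty$ for $x>0$). Then for every $M_t\to\infty$, $$P_t(\theta:\ d_\mu(\theta,\theta_0)\ge M_t\epsilon_t\mid H_t)\to0\quad\text{in }P_{\theta_0,\pi}\text{-probability}.$$ -/

import Mathlib

open MeasureTheory ProbabilityTheory Filter Topology
open scoped ENNReal

namespace EpisodicMDP

/-- A family `p θ s a s'` of transition densities, with respect to a measure `m` on the state
space `S`, indexed by a measurable parameter space `Θ`. -/
structure TransitionModel (Θ S A : Type*) [MeasurableSpace Θ] [MeasurableSpace S]
    [MeasurableSpace A] (m : Measure S) where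
  p : Θ → S → A → S → ℝ
  measurable_p : Measurable (fun x : Θ × S × A × S => p x.1 x.2.1 x.2.2.1 x.2.2.2)
  nonneg : ∀ θ s a s', 0 ≤ p θ s a s'
  lintegral_eq_one : ∀ θ s a, ∫⁻ s', ENNReal.ofReal (p θ s a s') ∂m = 1

/-- A (randomized, history dependent) policy within an episode: `rule n` gives the distribution of
the action `Aₙ` given `(S₀, A₀), …, (Sₙ₋₁, Aₙ₋₁)` and `Sₙ`.  Rewards are deterministic functions
of the state and the action, hence are redundant in the history. -/
structure Policy (S A : Type*) [MeasurableSpace S] [MeasurableSpace A] where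
  rule : (n : ℕ) → Kernel ((Fin n → S × A) × S) A
  isMarkov : ∀ n, IsMarkovKernel (rule n)

/-- A trajectory of states and actions `(S₀, A₀), (S₁, A₁), …`. -/
abbrev Path (S A : Type*) := ℕ → S × A

section Law

variable {Θ S A : Type*} [MeasurableSpace Θ] [MeasurableSpace S] [MeasurableSpace A]
  {m : Measure S}

theorem measurable_density (M : TransitionModel Θ S A m) (θ : Θ) :
    Measurable (Function.uncurry
      (fun (z : S × A) (s' : S) => ENNReal.ofReal (M.p θ z.1 z.2 s'))) := by
  have h : Measurable (fun y : (S × A) × S => (θ, y.1.1, y.1.2, y.2)) := by fun_prop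
  exact (M.measurable_p.comp h).ennreal_ofReal

variable [SigmaFinite m]

/-- The transition kernel `(s, a) ↦ p θ s a · dm`. -/
noncomputable def transition (M : TransitionModel Θ S A m) (θ : Θ) : Kernel (S × A) S :=
  (Kernel.const (S × A) m).withDensity (fun z s' => ENNReal.ofReal (M.p θ z.1 z.2 s'))

theorem transition_apply (M : TransitionModel Θ S A m) (θ : Θ) (z : S × A) :
    transition M θ z = m.withDensity (fun s' => ENNReal.ofReal (M.p θ z.1 z.2 s')) := by
  rw [transition, Kernel.withDensity_apply _ (measurable_density M θ), Kernel.const_apply]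

instance (M : TransitionModel Θ S A m) (θ : Θ) : IsMarkovKernel (transition M θ) where
  isProbabilityMeasure z := ⟨by
    rw [transition_apply, withDensity_apply _ MeasurableSet.univ, Measure.restrict_univ]
    exact M.lintegral_eq_one θ z.1 z.2⟩

instance (π : Policy S A) (n : ℕ) : IsMarkovKernel (π.rule n) := π.isMarkov n

/-- The last state-action pair of a history. -/
def lastPair (n : ℕ) (h : (i : Finset.Iic n) → S × A) : S × A :=
  h ⟨n, Finset.mem_Iic.2 le_rfl⟩

theorem measurable_lastPair (n : ℕ) : Measurable (lastPair (S := S) (A := A) n) :=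
  measurable_pi_apply _

/-- Repackaging of a history up to time `n` together with the next state. -/
def toHistory (n : ℕ) (x : ((i : Finset.Iic n) → S × A) × S) : (Fin (n + 1) → S × A) × S :=
  (fun i => x.1 ⟨i, Finset.mem_Iic.2 (Nat.lt_succ_iff.1 i.2)⟩, x.2)

theorem measurable_toHistory (n : ℕ) : Measurable (toHistory (S := S) (A := A) n) := by
  unfold toHistory
  fun_prop

/-- One step of the controlled process: from `(S₀, A₀), …, (Sₙ, Aₙ)`, draw `Sₙ₊₁` from the
transition density at `(Sₙ, Aₙ)` and then `Aₙ₊₁` from the policy. -/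
noncomputable def stepKernel (M : TransitionModel Θ S A m) (π : Policy S A) (θ : Θ) (n : ℕ) :
    Kernel ((i : Finset.Iic n) → S × A) (S × A) :=
  ((transition M θ).comap (lastPair n) (measurable_lastPair n)) ⊗ₖ
    ((π.rule (n + 1)).comap (toHistory n) (measurable_toHistory n))

instance (M : TransitionModel Θ S A m) (π : Policy S A) (θ : Θ) (n : ℕ) :
    IsMarkovKernel (stepKernel M π θ n) := by
  unfold stepKernel
  infer_instance

theorem measurable_emptyHistory :
    Measurable (fun s : S => ((Fin.elim0 : Fin 0 → S × A), s)) := by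
  fun_prop

/-- The law of `(S₀, A₀)` when `S₀` has distribution `ρ`. -/
noncomputable def initialLaw (ρ : Measure S) (π : Policy S A) : Measure (S × A) :=
  ρ ⊗ₘ ((π.rule 0).comap (fun s : S => ((Fin.elim0 : Fin 0 → S × A), s)) measurable_emptyHistory)

/-- The law of the trajectory of one episode under the dynamics `θ`, the policy `π` and the
initial distribution `ρ`.  The trajectory is formally continued after the terminal time; only its
part up to the terminal time is ever observed. -/
noncomputable def pathLaw (M : TransitionModel Θ S A m) (ρ : Measure S) (π : Policy S A) (θ : Θ) :
    Measure (Path S A) :=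
  Kernel.trajMeasure (X := fun _ => S × A) (initialLaw ρ π) (stepKernel M π θ)

/-- The law of the sequence of episodes: the policy only uses the history of the current episode,
so that the episodes are independent and identically distributed. -/
noncomputable def episodesLaw (M : TransitionModel Θ S A m) (ρ : Measure S) (π : Policy S A)
    (θ : Θ) : Measure (ℕ → Path S A) :=
  Measure.infinitePi (fun _ => pathLaw M ρ π θ)

end Law

section Episode

variable {S A : Type*}

/-- The episode reaches the set `D` of terminal states. -/
def Terminates (D : Set S) (x : Path S A) : Prop := ∃ t, (x t).1 ∈ D

/-- The terminal time `T` of an episode (with value `0` if the episode never terminates). -/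
noncomputable def terminalTime (D : Set S) (x : Path S A) : ℕ := sInf {t | (x t).1 ∈ D}

/-- The episode is still running at time `t`, that is `t < T`, so that an action is taken. -/
def Running (D : Set S) (x : Path S A) (t : ℕ) : Prop := ∀ i ≤ t, (x i).1 ∉ D

/-- Two trajectories give the same observed episode `(S₀, A₀, S₁, A₁, …, S_T)`. -/
def SameEpisode (D : Set S) (x y : Path S A) : Prop :=
  (∀ t, (∀ i < t, (x i).1 ∉ D) → (x t).1 = (y t).1) ∧
    ∀ t, Running D x t → (x t).2 = (y t).2

end Episode

section Distance

variable {Θ S A : Type*} [MeasurableSpace Θ] [MeasurableSpace S] [MeasurableSpace A]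
  {m : Measure S}

/-- The squared Hellinger distance `∫ (√f - √g)² dm`. -/
noncomputable def hellingerSq (m : Measure S) (f g : S → ℝ) : ℝ≥0∞ :=
  ∫⁻ x, ENNReal.ofReal ((√(f x) - √(g x)) ^ 2) ∂m

/-- The semi-distance `d_w` on `Θ`:
`d_w(θ, θ')² = ∫ h²(p θ s a, p θ' s a) w(s, a) dlam(s, a)`. -/
noncomputable def semiDist (M : TransitionModel Θ S A m) (lam : Measure (S × A))
    (w : S × A → ℝ≥0∞) (θ θ' : Θ) : ℝ :=
  √((∫⁻ z, hellingerSq m (M.p θ z.1 z.2) (M.p θ' z.1 z.2) * w z ∂lam).toReal)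

/-- The `r`-covering number of `B ⊆ Θ`: the minimal number of balls of radius `r` (for `d`)
that cover `B`. -/
noncomputable def coveringNumber (d : Θ → Θ → ℝ) (r : ℝ) (B : Set Θ) : ℕ∞ :=
  ⨅ (C : Finset Θ) (_ : ∀ θ ∈ B, ∃ c ∈ C, d θ c ≤ r), (C.card : ℕ∞)

/-- The transition densities are uniformly comparable to the true one. -/
def UniformlyComparable (M : TransitionModel Θ S A m) (θ₀ : Θ) : Prop :=
  ∃ c d : ℝ, 0 < c ∧ c < d ∧ ∀ θ s a s',
    c * M.p θ₀ s a s' ≤ M.p θ s a s' ∧ M.p θ s a s' ≤ d * M.p θ₀ s a s'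

variable [SigmaFinite m]

/-- The distribution of `(S_t, A_t)` on the event `t < T` that the episode is still running. -/
noncomputable def occupancy (M : TransitionModel Θ S A m) (D : Set S) (ρ : Measure S)
    (π : Policy S A) (θ : Θ) (t : ℕ) : Measure (S × A) :=
  ((pathLaw M ρ π θ).restrict {x | Running D x t}).map (fun x => x t)

/-- The function `∑ₜ δᵗ pᵗ`, where `pᵗ` is the density of `occupancy … t` with respect to
`lam`. -/
noncomputable def discountedDensity (M : TransitionModel Θ S A m) (D : Set S) (ρ : Measure S)
    (π : Policy S A) (θ : Θ) (lam : Measure (S × A)) (δ : ℝ) (z : S × A) : ℝ≥0∞ :=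
  ∑' t : ℕ, ENNReal.ofReal δ ^ t * (occupancy M D ρ π θ t).rnDeriv lam z

end Distance

section Posterior

variable {Θ S A : Type*} [MeasurableSpace Θ] [MeasurableSpace S] [MeasurableSpace A]
  {m : Measure S}

/-- The log likelihood ratio `∑_{t=1}^T log (p θ₀ (S_t | S_{t-1}, A_{t-1}) / p θ (S_t | …))` of
one episode. -/
noncomputable def logRatio (M : TransitionModel Θ S A m) (D : Set S) (θ₀ θ : Θ) (x : Path S A) :
    ℝ :=
  ∑ t ∈ Finset.range (terminalTime D x),
    Real.log (M.p θ₀ (x t).1 (x t).2 (x (t + 1)).1 / M.p θ (x t).1 (x t).2 (x (t + 1)).1)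

/-- The set `B*(θ₀, ε; n)`. -/
def starBall [SigmaFinite m] (M : TransitionModel Θ S A m) (D : Set S) (ρ : Measure S)
    (π : Policy S A) (θ₀ : Θ) (ε n : ℝ) : Set Θ :=
  {θ | Integrable (logRatio M D θ₀ θ) (pathLaw M ρ π θ₀) ∧
    ∫ x, logRatio M D θ₀ θ x ∂(pathLaw M ρ π θ₀) ≤ ε ^ 2 ∧
    ∫⁻ x, ENNReal.ofReal (|logRatio M D θ₀ θ x| ^ n) ∂(pathLaw M ρ π θ₀)
      ≤ ENNReal.ofReal (ε ^ n)}

/-- The product of the transition densities over the first `k` transitions of a trajectory. -/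
noncomputable def transitionProd (M : TransitionModel Θ S A m) (θ : Θ) (x : Path S A) (k : ℕ) :
    ℝ≥0∞ :=
  ∏ t ∈ Finset.range k, ENNReal.ofReal (M.p θ (x t).1 (x t).2 (x (t + 1)).1)

/-- The likelihood of `θ` for the history made of `N` completed episodes and of the first `r`
steps of the next one (fewer if that one ends before).  The factors coming from the initial
distribution and from the policy do not depend on `θ` and cancel in the posterior. -/
noncomputable def likelihood (M : TransitionModel Θ S A m) (D : Set S) (N r : ℕ) (θ : Θ)
    (ω : ℕ → Path S A) : ℝ≥0∞ :=
  (∏ i ∈ Finset.range N, transitionProd M θ (ω i) (terminalTime D (ω i))) *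
    transitionProd M θ (ω N) (min r (terminalTime D (ω N)))

/-- The posterior probability of `B` given that history, for the prior `P`, by Bayes' formula. -/
noncomputable def posteriorProb (M : TransitionModel Θ S A m) (D : Set S) (P : Measure Θ)
    (N r : ℕ) (ω : ℕ → Path S A) (B : Set Θ) : ℝ≥0∞ :=
  (∫⁻ θ in B, likelihood M D N r θ ω ∂P) / ∫⁻ θ, likelihood M D N r θ ω ∂P

end Posterior

end EpisodicMDP

/-! Tests. Everything rests on one bounded statistic per episode. Let g = (p_θ₁ - p_θ₀) / (p_θ₁ +
p_θ₀) be the score of a transition, let Z = ∑ δ^t g(S_t, A_t, S_{t+1}) over t < T, and reject θ₀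
when the sum of Z over the N episodes is nonnegative. Discounting keeps Z bounded however long the
episode lasts. A quadratic bound for exp(κ Z) (`exp_runSum_le`) reduces the Chernoff bound to the
conditional mean of g + 2κg² given (S_t, A_t). Pointwise algebra with square roots of densities
bounds this mean by a negative multiple of h²(p_θ₀, p_θ₁); for -g under an alternative θ there is an
extra error 4d h²(p_θ, p_θ₁). Independence of the episodes multiplies the exponent by N.

Two weights. These Hellinger terms are averaged over the occupancy measures of the parameter that
generates the data. Uniform comparability changes the law of the first t transitions by a factor
between c^t and d^t, and the discount absorbs it: the gain is at least the squared semi-distance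
with discount δc, the error at most the one with discount δd. Hence δ_μ = δc and δ_ν = δd, where δ =
1/(2d). All constants depend on c and d only, so not on ρ, π or λ.

Contraction. The posterior is a quotient of integrals of the likelihood ratio against θ₀. For θ in
B* the mean of minus its logarithm is at most (N + 1)ε²; an unfinished episode costs no more than a
finished one, because the remaining part has nonnegative Kullback-Leibler divergence. By Markov
(`measure_lt_exp_neg_le`) and Fubini (`measure_lintegral_lt_le`) the denominator is at least e^{-a}
P(B*)/2 outside an event of probability of order Nε²/a. The numerator is cut into shells jε < d_μ ≤
(j + 1)ε. The covering hypothesis gives one test per shell (`exists_shell_test`), with errors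
exp(Nε² - KNε²j²) and exp(-KNε²j²), while the prior mass of the shell relative to B* costs only
exp(KNε²j²/2). With shells j ≥ J and a = KJ²Nε²/4 there remain a geometric tail starting at J and a
term of order 1/J². Both vanish because J can be taken to infinity with M_t. -/

namespace EpisodicMDP

/-! ### Finite histories as paths. -/

section Splice

variable {S A : Type*}

/-- Extension of a finite history by its last value. -/
def extendPath (n : ℕ) (h : (i : Finset.Iic n) → S × A) : Path S A :=
  fun i => h ⟨min i n, Finset.mem_Iic.2 (min_le_right _ _)⟩

/-- The path that follows `h` up to time `n` and then takes the value `y`. -/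
def gluePath (n : ℕ) (h : (i : Finset.Iic n) → S × A) (y : S × A) : Path S A :=
  fun i => if i ≤ n then extendPath n h i else y

theorem extendPath_frestrictLe (n : ℕ) (x : Path S A) {i : ℕ} (hi : i ≤ n) :
    extendPath n (Preorder.frestrictLe n x) i = x i := by
  simp [extendPath, min_eq_left hi]

end Splice

/-! ### Likelihood ratios of transitions and their uniform bounds. -/

section Ratio

variable {Θ S A : Type*} [MeasurableSpace Θ] [MeasurableSpace S] [MeasurableSpace A]
  {m : Measure S}

/-- Uniform comparability with explicit constants, normalised so that `c ≤ 1 ≤ d`. -/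
structure ComparableWith (M : TransitionModel Θ S A m) (θ₀ : Θ) (c d : ℝ) : Prop where
  pos : 0 < c
  le_one : c ≤ 1
  one_le : 1 ≤ d
  lower : ∀ θ s a s', c * M.p θ₀ s a s' ≤ M.p θ s a s'
  upper : ∀ θ s a s', M.p θ s a s' ≤ d * M.p θ₀ s a s'

theorem UniformlyComparable.exists_comparableWith {M : TransitionModel Θ S A m} {θ₀ : Θ}
    (h : UniformlyComparable M θ₀) : ∃ c d : ℝ, ComparableWith M θ₀ c d ∧ c < d := by
  obtain ⟨c, d, hc, hcd, hp⟩ := h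
  refine ⟨min c 1, max d 2, ⟨lt_min hc one_pos, min_le_right _ _,
    (by norm_num : (1 : ℝ) ≤ 2).trans (le_max_right _ _), fun θ s a s' => ?_,
    fun θ s a s' => ?_⟩, ?_⟩
  · exact (mul_le_mul_of_nonneg_right (min_le_left _ _) (M.nonneg _ _ _ _)).trans (hp θ s a s').1
  · exact (hp θ s a s').2.trans
      (mul_le_mul_of_nonneg_right (le_max_left _ _) (M.nonneg _ _ _ _))
  · calc min c 1 ≤ 1 := min_le_right _ _
      _ < 2 := by norm_num
      _ ≤ max d 2 := le_max_right _ _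

/-- The likelihood ratio of one transition, set to `1` where the reference density vanishes. -/
noncomputable def lr (M : TransitionModel Θ S A m) (θ₀ θ : Θ) (z : S × A) (s' : S) : ℝ :=
  if M.p θ₀ z.1 z.2 s' = 0 then 1 else M.p θ z.1 z.2 s' / M.p θ₀ z.1 z.2 s'

theorem ComparableWith.zero_iff {M : TransitionModel Θ S A m} {θ₀ : Θ} {c d : ℝ}
    (h : ComparableWith M θ₀ c d) (θ : Θ) (s : S) (a : A) (s' : S) :
    M.p θ s a s' = 0 ↔ M.p θ₀ s a s' = 0 := by
  have h1 := h.lower θ s a s'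
  have h2 := h.upper θ s a s'
  have h3 := M.nonneg θ₀ s a s'
  have h4 := M.nonneg θ s a s'
  constructor
  · intro h0
    have := h.pos
    nlinarith
  · intro h0
    rw [h0, mul_zero] at h2
    exact le_antisymm h2 h4

theorem ComparableWith.le_lr {M : TransitionModel Θ S A m} {θ₀ : Θ} {c d : ℝ}
    (h : ComparableWith M θ₀ c d) (θ : Θ) (z : S × A) (s' : S) : c ≤ lr M θ₀ θ z s' := by
  unfold lr
  split_ifs with h0
  · exact h.le_one
  · have : 0 < M.p θ₀ z.1 z.2 s' := lt_of_le_of_ne (M.nonneg _ _ _ _) (Ne.symm h0)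
    rw [le_div_iff₀ this]
    exact h.lower _ _ _ _

theorem ComparableWith.lr_le {M : TransitionModel Θ S A m} {θ₀ : Θ} {c d : ℝ}
    (h : ComparableWith M θ₀ c d) (θ : Θ) (z : S × A) (s' : S) : lr M θ₀ θ z s' ≤ d := by
  unfold lr
  split_ifs with h0
  · exact h.one_le
  · have : 0 < M.p θ₀ z.1 z.2 s' := lt_of_le_of_ne (M.nonneg _ _ _ _) (Ne.symm h0)
    rw [div_le_iff₀ this]
    exact h.upper _ _ _ _

theorem ComparableWith.lr_pos {M : TransitionModel Θ S A m} {θ₀ : Θ} {c d : ℝ}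
    (h : ComparableWith M θ₀ c d) (θ : Θ) (z : S × A) (s' : S) : 0 < lr M θ₀ θ z s' :=
  h.pos.trans_le (h.le_lr θ z s')

theorem ComparableWith.mul_lr {M : TransitionModel Θ S A m} {θ₀ : Θ} {c d : ℝ}
    (h : ComparableWith M θ₀ c d) (θ : Θ) (z : S × A) (s' : S) :
    M.p θ₀ z.1 z.2 s' * lr M θ₀ θ z s' = M.p θ z.1 z.2 s' := by
  unfold lr
  split_ifs with h0
  · rw [h0, zero_mul, (h.zero_iff θ _ _ _).2 h0]
  · field_simp

theorem ComparableWith.mul_lr_swap {M : TransitionModel Θ S A m} {θ₀ : Θ} {c d : ℝ}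
    (h : ComparableWith M θ₀ c d) (θ : Θ) (z : S × A) (s' : S) :
    M.p θ z.1 z.2 s' * (lr M θ₀ θ z s')⁻¹ = M.p θ₀ z.1 z.2 s' := by
  rw [← h.mul_lr θ z s', mul_assoc, mul_inv_cancel₀ (h.lr_pos θ z s').ne', mul_one]

/-- Where p_θ₀ vanishes both sides are 0, by the conventions log 0 = 0 and `lr = 1`. The resulting
formula for `logRatio` therefore holds on every path, with no exceptional null set. -/
theorem ComparableWith.log_div {M : TransitionModel Θ S A m} {θ₀ : Θ} {c d : ℝ}
    (_ : ComparableWith M θ₀ c d) (θ : Θ) (z : S × A) (s' : S) :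
    Real.log (M.p θ₀ z.1 z.2 s' / M.p θ z.1 z.2 s') = -Real.log (lr M θ₀ θ z s') := by
  unfold lr
  split_ifs with h0
  · simp [h0]
  · rw [← Real.log_inv, inv_div]

theorem measurable_lr (M : TransitionModel Θ S A m) (θ₀ : Θ) :
    Measurable (fun x : Θ × (S × A) × S => lr M θ₀ x.1 x.2.1 x.2.2) := by
  have h0 : Measurable (fun x : Θ × (S × A) × S => M.p θ₀ x.2.1.1 x.2.1.2 x.2.2) :=
    M.measurable_p.comp (f := fun x : Θ × (S × A) × S => (θ₀, x.2.1.1, x.2.1.2, x.2.2))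
      (by fun_prop)
  have h1 : Measurable (fun x : Θ × (S × A) × S => M.p x.1 x.2.1.1 x.2.1.2 x.2.2) :=
    M.measurable_p.comp (f := fun x : Θ × (S × A) × S => (x.1, x.2.1.1, x.2.1.2, x.2.2))
      (by fun_prop)
  exact Measurable.ite (h0 (measurableSet_singleton 0)) measurable_const (h1.div h0)

theorem measurable_lr_comp (M : TransitionModel Θ S A m) (θ₀ : Θ) {X : Type*} [MeasurableSpace X]
    {f : X → Θ} {g : X → S × A} {h : X → S} (hf : Measurable f) (hg : Measurable g)
    (hh : Measurable h) : Measurable (fun x => lr M θ₀ (f x) (g x) (h x)) :=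
  (measurable_lr M θ₀).comp (hf.prodMk (hg.prodMk hh))

theorem measurable_p_comp (M : TransitionModel Θ S A m) {X : Type*} [MeasurableSpace X]
    {f : X → Θ} {g : X → S × A} {h : X → S} (hf : Measurable f) (hg : Measurable g)
    (hh : Measurable h) : Measurable (fun x => M.p (f x) (g x).1 (g x).2 (h x)) :=
  M.measurable_p.comp (hf.prodMk (hg.fst.prodMk (hg.snd.prodMk hh)))

theorem measurable_extendPath (n : ℕ) : Measurable (extendPath (S := S) (A := A) n) := by
  unfold extendPath
  fun_prop

theorem measurable_gluePath (n : ℕ) :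
    Measurable (fun p : ((i : Finset.Iic n) → S × A) × (S × A) => gluePath n p.1 p.2) := by
  refine measurable_pi_iff.2 fun i => ?_
  unfold gluePath
  by_cases hi : i ≤ n
  · simp only [hi, if_true]
    exact (measurable_pi_iff.1 (measurable_extendPath n) i).comp measurable_fst
  · simp only [hi, if_false]
    exact measurable_snd

/-- The likelihood ratio of the first `n` transitions. -/
noncomputable def pathLR (M : TransitionModel Θ S A m) (θ₀ θ : Θ) (n : ℕ) (x : Path S A) : ℝ :=
  ∏ t ∈ Finset.range n, lr M θ₀ θ (x t) (x (t + 1)).1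

theorem measurable_pathLR_comp (M : TransitionModel Θ S A m) (θ₀ : Θ) (n : ℕ) {X : Type*}
    [MeasurableSpace X] {f : X → Θ} {g : X → Path S A} (hf : Measurable f) (hg : Measurable g) :
    Measurable (fun x => pathLR M θ₀ (f x) n (g x)) :=
  Finset.measurable_prod _ fun t _ => measurable_lr_comp M θ₀ hf
    ((measurable_pi_apply t).comp hg) ((measurable_pi_apply (t + 1)).comp hg).fst

theorem ComparableWith.pathLR_pos {M : TransitionModel Θ S A m} {θ₀ : Θ} {c d : ℝ}
    (hM : ComparableWith M θ₀ c d) (θ : Θ) (n : ℕ) (x : Path S A) : 0 < pathLR M θ₀ θ n x :=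
  Finset.prod_pos fun _ _ => hM.lr_pos _ _ _

theorem ComparableWith.pathLR_le {M : TransitionModel Θ S A m} {θ₀ : Θ} {c d : ℝ}
    (hM : ComparableWith M θ₀ c d) (θ : Θ) (n : ℕ) (x : Path S A) :
    pathLR M θ₀ θ n x ≤ d ^ n := by
  have := Finset.prod_le_prod (s := Finset.range n)
    (f := fun t => lr M θ₀ θ (x t) (x (t + 1)).1) (g := fun _ => d)
    (fun _ _ => (hM.lr_pos _ _ _).le) (fun _ _ => hM.lr_le _ _ _)
  simpa [pathLR] using this

theorem ComparableWith.le_pathLR {M : TransitionModel Θ S A m} {θ₀ : Θ} {c d : ℝ}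
    (hM : ComparableWith M θ₀ c d) (θ : Θ) (n : ℕ) (x : Path S A) :
    c ^ n ≤ pathLR M θ₀ θ n x := by
  have := Finset.prod_le_prod (s := Finset.range n) (f := fun _ => c)
    (g := fun t => lr M θ₀ θ (x t) (x (t + 1)).1)
    (fun _ _ => hM.pos.le) (fun _ _ => hM.le_lr _ _ _)
  simpa [pathLR] using this

end Ratio

/-! ### Change of measure over finitely many steps. -/

section PathLaw

variable {Θ S A : Type*} [MeasurableSpace Θ] [MeasurableSpace S] [MeasurableSpace A]
  {m : Measure S} [SigmaFinite m]

instance (ρ : Measure S) [IsProbabilityMeasure ρ] (π : Policy S A) :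
    IsProbabilityMeasure (initialLaw ρ π) := by
  unfold initialLaw
  infer_instance

instance (M : TransitionModel Θ S A m) (ρ : Measure S) [IsProbabilityMeasure ρ] (π : Policy S A)
    (θ : Θ) : IsProbabilityMeasure (pathLaw M ρ π θ) := by
  unfold pathLaw
  infer_instance

theorem lintegral_stepKernel (M : TransitionModel Θ S A m) (π : Policy S A) (θ : Θ) (n : ℕ)
    (h : (i : Finset.Iic n) → S × A) {f : S × A → ℝ≥0∞} (hf : Measurable f) :
    ∫⁻ y, f y ∂(stepKernel M π θ n h) =
      ∫⁻ s', ENNReal.ofReal (M.p θ (lastPair n h).1 (lastPair n h).2 s') *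
        ∫⁻ a, f (s', a) ∂(π.rule (n + 1) (toHistory n (h, s'))) ∂m := by
  have hk : Measurable fun s' => ∫⁻ a, f (s', a) ∂(π.rule (n + 1) (toHistory n (h, s'))) := by
    have := Measurable.lintegral_kernel_prod_right'
      (κ := (π.rule (n + 1)).comap (fun s' : S => toHistory n (h, s'))
        ((measurable_toHistory n).comp measurable_prodMk_left)) hf
    simpa using this
  have hp : Measurable fun s' => ENNReal.ofReal (M.p θ (lastPair n h).1 (lastPair n h).2 s') :=
    (measurable_p_comp M (g := fun _ => lastPair n h) measurable_const measurable_const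
      measurable_id).ennreal_ofReal
  rw [stepKernel, Kernel.lintegral_compProd _ _ _ hf]
  simp only [Kernel.comap_apply, transition_apply]
  rw [lintegral_withDensity_eq_lintegral_mul _ hp hk]
  rfl

/-- The policy kernel is the same under θ and θ₀, so only the transition density contributes a
weight. -/
theorem ComparableWith.lintegral_stepKernel_eq {M : TransitionModel Θ S A m} {θ₀ : Θ} {c d : ℝ}
    (hM : ComparableWith M θ₀ c d) (π : Policy S A) (θ : Θ) (n : ℕ)
    (h : (i : Finset.Iic n) → S × A) {f : S × A → ℝ≥0∞} (hf : Measurable f) :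
    ∫⁻ y, f y ∂(stepKernel M π θ n h) =
      ∫⁻ y, ENNReal.ofReal (lr M θ₀ θ (lastPair n h) y.1) * f y ∂(stepKernel M π θ₀ n h) := by
  have hl : Measurable fun y : S × A => ENNReal.ofReal (lr M θ₀ θ (lastPair n h) y.1) :=
    (measurable_lr_comp M θ₀ measurable_const measurable_const measurable_fst).ennreal_ofReal
  rw [lintegral_stepKernel M π θ n h hf, lintegral_stepKernel M π θ₀ n h
    (f := fun y => ENNReal.ofReal (lr M θ₀ θ (lastPair n h) y.1) * f y) (hl.mul hf)]
  refine lintegral_congr fun s' => ?_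
  dsimp only
  rw [lintegral_const_mul _ (by fun_prop), ← mul_assoc, ← ENNReal.ofReal_mul (M.nonneg _ _ _ _),
    hM.mul_lr]

theorem lintegral_pathLaw_succ (M : TransitionModel Θ S A m) (ρ : Measure S)
    [IsProbabilityMeasure ρ] (π : Policy S A) (θ : Θ) (n : ℕ)
    {f : ((i : Finset.Iic n) → S × A) × (S × A) → ℝ≥0∞} (hf : Measurable f) :
    ∫⁻ x, f (Preorder.frestrictLe n x, x (n + 1)) ∂(pathLaw M ρ π θ) =
      ∫⁻ x, ∫⁻ y, f (Preorder.frestrictLe n x, y)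
        ∂(stepKernel M π θ n (Preorder.frestrictLe n x)) ∂(pathLaw M ρ π θ) := by
  have h := Kernel.map_frestrictLe_trajMeasure_compProd_eq_map_trajMeasure
    (X := fun _ => S × A) (μ₀ := initialLaw ρ π) (κ := stepKernel M π θ) (a := n)
  have h1 := congrArg (fun μ => ∫⁻ p, f p ∂μ) h
  rw [Measure.lintegral_compProd hf, lintegral_map hf (by fun_prop),
    lintegral_map hf.lintegral_kernel_prod_right' (by fun_prop)] at h1
  exact h1.symm

/-- At time 0 only ρ and the policy act. This starts the induction for the change of measure. -/
theorem map_frestrictLe_zero_pathLaw (M : TransitionModel Θ S A m) (ρ : Measure S)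
    [IsProbabilityMeasure ρ] (π : Policy S A) (θ θ' : Θ) :
    (pathLaw M ρ π θ).map (Preorder.frestrictLe 0) =
      (pathLaw M ρ π θ').map (Preorder.frestrictLe 0) := by
  have key : ∀ θ : Θ, (pathLaw M ρ π θ).map (Preorder.frestrictLe 0) =
      (initialLaw ρ π).map (MeasurableEquiv.piUnique (fun _ : Finset.Iic 0 => S × A)).symm := by
    intro θ
    rw [pathLaw, Kernel.trajMeasure, Measure.map_comp _ _ (by fun_prop),
      Kernel.traj_map_frestrictLe, Kernel.partialTraj_self]
    exact Measure.id_comp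
  rw [key, key]

/-- Change of measure for functions of the first `n` steps. -/
theorem ComparableWith.lintegral_pathLaw {M : TransitionModel Θ S A m} {θ₀ : Θ} {c d : ℝ}
    (hM : ComparableWith M θ₀ c d) (ρ : Measure S) [IsProbabilityMeasure ρ] (π : Policy S A)
    (θ : Θ) (n : ℕ) {F : Path S A → ℝ≥0∞} (hF : Measurable F) (hdep : DependsOn F (Set.Iic n)) :
    ∫⁻ x, F x ∂(pathLaw M ρ π θ) =
      ∫⁻ x, F x * ENNReal.ofReal (pathLR M θ₀ θ n x) ∂(pathLaw M ρ π θ₀) := by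
  induction n generalizing F with
  | zero =>
    have hF' : ∀ x, F x = F (extendPath 0 (Preorder.frestrictLe 0 x)) := fun x =>
      hdep fun i hi => (extendPath_frestrictLe 0 x hi).symm
    have hm : Measurable fun h => F (extendPath 0 h) := hF.comp (measurable_extendPath 0)
    simp only [pathLR, Finset.range_zero, Finset.prod_empty, ENNReal.ofReal_one, mul_one]
    rw [lintegral_congr hF', lintegral_congr (μ := pathLaw M ρ π θ₀) hF',
      ← lintegral_map (μ := pathLaw M ρ π θ) (g := Preorder.frestrictLe 0) hm (by fun_prop),
      ← lintegral_map (μ := pathLaw M ρ π θ₀) (g := Preorder.frestrictLe 0) hm (by fun_prop),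
      map_frestrictLe_zero_pathLaw M ρ π θ θ₀]
  | succ n ih =>
    set f : ((i : Finset.Iic n) → S × A) × (S × A) → ℝ≥0∞ := fun p => F (gluePath n p.1 p.2)
      with hf_def
    have hf : Measurable f := hF.comp (measurable_gluePath n)
    have hF' : ∀ x, F x = f (Preorder.frestrictLe n x, x (n + 1)) := by
      intro x
      refine hdep fun i hi => ?_
      simp only [gluePath]
      split_ifs with h
      · exact (extendPath_frestrictLe n x h).symm
      · have : i = n + 1 := le_antisymm hi (not_le.1 h)
        rw [this]
    set f1 : ((i : Finset.Iic n) → S × A) × (S × A) → ℝ≥0∞ := fun p =>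
      ENNReal.ofReal (lr M θ₀ θ (lastPair n p.1) p.2.1) * f p with hf1_def
    have hf1 : Measurable f1 :=
      (measurable_lr_comp M θ₀ measurable_const ((measurable_lastPair n).comp measurable_fst)
        measurable_snd.fst).ennreal_ofReal.mul hf
    -- The last step is integrated out under θ₀ with its weight. What is left depends on the first n
    -- steps, so the induction hypothesis applies to it.
    set G : Path S A → ℝ≥0∞ := fun x => ∫⁻ y, f1 (Preorder.frestrictLe n x, y)
      ∂(stepKernel M π θ₀ n (Preorder.frestrictLe n x)) with hG_def
    have hG : Measurable G :=
      (hf1.lintegral_kernel_prod_right' (κ := stepKernel M π θ₀ n)).comp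
        (Preorder.measurable_frestrictLe n)
    have hGdep : DependsOn G (Set.Iic n) := by
      intro x y hxy
      have : Preorder.frestrictLe (π := fun _ => S × A) n x = Preorder.frestrictLe n y := by
        ext1 i
        exact hxy i (Finset.mem_Iic.1 i.2)
      simp only [hG_def, this]
    have hlast : ∀ x : Path S A, lastPair n (Preorder.frestrictLe n x) = x n := fun x => rfl
    -- The weight of the first n steps is a function of the history, hence passes inside the
    -- one-step integral, and the step can be reattached under θ₀.
    set f2 : ((i : Finset.Iic n) → S × A) × (S × A) → ℝ≥0∞ := fun p =>
      f1 p * ENNReal.ofReal (pathLR M θ₀ θ n (extendPath n p.1)) with hf2_def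
    have hf2 : Measurable f2 := hf1.mul (measurable_pathLR_comp M θ₀ n measurable_const
      ((measurable_extendPath n).comp measurable_fst)).ennreal_ofReal
    have hLR : ∀ x : Path S A, pathLR M θ₀ θ n (extendPath n (Preorder.frestrictLe n x)) =
        pathLR M θ₀ θ n x := by
      intro x
      refine Finset.prod_congr rfl fun t ht => ?_
      have ht' := Finset.mem_range.1 ht
      rw [extendPath_frestrictLe n x ht'.le, extendPath_frestrictLe n x ht']
    calc ∫⁻ x, F x ∂(pathLaw M ρ π θ)
        = ∫⁻ x, f (Preorder.frestrictLe n x, x (n + 1)) ∂(pathLaw M ρ π θ) :=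
          lintegral_congr hF'
      _ = ∫⁻ x, G x ∂(pathLaw M ρ π θ) := by
          rw [lintegral_pathLaw_succ M ρ π θ n hf]
          refine lintegral_congr fun x => ?_
          exact hM.lintegral_stepKernel_eq π θ n _ (hf.comp measurable_prodMk_left)
      _ = ∫⁻ x, G x * ENNReal.ofReal (pathLR M θ₀ θ n x) ∂(pathLaw M ρ π θ₀) := ih hG hGdep
      _ = ∫⁻ x, ∫⁻ y, f2 (Preorder.frestrictLe n x, y)
            ∂(stepKernel M π θ₀ n (Preorder.frestrictLe n x)) ∂(pathLaw M ρ π θ₀) := by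
          refine lintegral_congr fun x => ?_
          simp only [hf2_def, hG_def, hLR]
          exact (lintegral_mul_const _ (hf1.comp measurable_prodMk_left)).symm
      _ = ∫⁻ x, f2 (Preorder.frestrictLe n x, x (n + 1)) ∂(pathLaw M ρ π θ₀) :=
          (lintegral_pathLaw_succ M ρ π θ₀ n hf2).symm
      _ = _ := by
          refine lintegral_congr fun x => ?_
          simp only [hf2_def, hf1_def, hLR, hlast]
          rw [← hF' x, pathLR, pathLR, Finset.prod_range_succ,
            ENNReal.ofReal_mul (Finset.prod_nonneg fun _ _ => (hM.lr_pos _ _ _).le)]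
          ring

/-- Integration of the next state against the transition density. -/
theorem lintegral_pathLaw_transition (M : TransitionModel Θ S A m) (ρ : Measure S)
    [IsProbabilityMeasure ρ] (π : Policy S A) (θ : Θ) (n : ℕ) {G : Path S A → ℝ≥0∞}
    (hG : Measurable G) (hdep : DependsOn G (Set.Iic n)) {u : (S × A) × S → ℝ≥0∞}
    (hu : Measurable u) :
    ∫⁻ x, G x * u (x n, (x (n + 1)).1) ∂(pathLaw M ρ π θ) =
      ∫⁻ x, G x * ∫⁻ s', u (x n, s') ∂(transition M θ (x n)) ∂(pathLaw M ρ π θ) := by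
  set f : ((i : Finset.Iic n) → S × A) × (S × A) → ℝ≥0∞ := fun p =>
    G (extendPath n p.1) * u (lastPair n p.1, p.2.1) with hf_def
  have hf : Measurable f := (hG.comp ((measurable_extendPath n).comp measurable_fst)).mul
    (hu.comp (((measurable_lastPair n).comp measurable_fst).prodMk measurable_snd.fst))
  have hG' : ∀ x, G (extendPath n (Preorder.frestrictLe n x)) = G x := fun x =>
    hdep fun i hi => extendPath_frestrictLe n x hi
  have h1 : ∀ x : Path S A, G x * u (x n, (x (n + 1)).1) =
      f (Preorder.frestrictLe n x, x (n + 1)) := by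
    intro x
    simp only [hf_def, hG']
    rfl
  rw [lintegral_congr h1, lintegral_pathLaw_succ M ρ π θ n hf]
  refine lintegral_congr fun x => ?_
  simp only [hf_def, hG']
  have hux : Measurable fun y : S × A =>
      u (lastPair n (Preorder.frestrictLe (π := fun _ => S × A) n x), y.1) := by fun_prop
  rw [lintegral_const_mul _ hux, lintegral_stepKernel M π θ n _ hux, transition_apply]
  have hp : Measurable fun s' => ENNReal.ofReal (M.p θ (x n).1 (x n).2 s') :=
    (measurable_p_comp M (g := fun _ => x n) measurable_const measurable_const
      measurable_id).ennreal_ofReal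
  rw [lintegral_withDensity_eq_lintegral_mul _ hp (by fun_prop)]
  simp only [lintegral_const, measure_univ, mul_one]
  rfl

end PathLaw

/-! ### Running episodes and occupancy measures. -/

section RunningTime

variable {S A : Type*}

theorem dependsOn_running (D : Set S) (t : ℕ) :
    DependsOn (fun x : Path S A => Running D x t) (Set.Iic t) := by
  intro x y hxy
  refine propext ⟨fun h i hi => ?_, fun h i hi => ?_⟩
  · rw [← hxy i hi]
    exact h i hi
  · rw [hxy i hi]
    exact h i hi

theorem measurableSet_running [MeasurableSpace S] [MeasurableSpace A] {D : Set S}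
    (hD : MeasurableSet D) (t : ℕ) : MeasurableSet {x : Path S A | Running D x t} := by
  have : {x : Path S A | Running D x t} = ⋂ i ∈ Set.Iic t, (fun x => (x i).1) ⁻¹' Dᶜ := by
    ext x
    simp [Running]
  rw [this]
  exact MeasurableSet.biInter (Set.to_countable _) fun i _ =>
    (measurable_fst.comp (measurable_pi_apply i)) hD.compl

theorem dependsOn_running_indicator (D : Set S) (t : ℕ) {β : Type*} [Zero β]
    {f : Path S A → β} (hf : DependsOn f (Set.Iic t)) :
    DependsOn ({x : Path S A | Running D x t}.indicator f) (Set.Iic t) := by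
  intro x y hxy
  have h1 : Running D x t = Running D y t := dependsOn_running (A := A) D t hxy
  have h2 := hf hxy
  by_cases h : Running D x t
  · have h' : Running D y t := h1 ▸ h
    rw [Set.indicator_of_mem (by exact h), Set.indicator_of_mem (by exact h'), h2]
  · have h' : ¬ Running D y t := h1 ▸ h
    rw [Set.indicator_of_notMem (by exact h), Set.indicator_of_notMem (by exact h')]

end RunningTime

section Occupancy

variable {Θ S A : Type*} [MeasurableSpace Θ] [MeasurableSpace S] [MeasurableSpace A]
  {m : Measure S} [SigmaFinite m]

instance (M : TransitionModel Θ S A m) (D : Set S) (ρ : Measure S) [IsProbabilityMeasure ρ]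
    (π : Policy S A) (θ : Θ) (t : ℕ) : IsFiniteMeasure (occupancy M D ρ π θ t) := by
  unfold occupancy
  infer_instance

theorem occupancy_univ_le (M : TransitionModel Θ S A m) (D : Set S) (ρ : Measure S)
    [IsProbabilityMeasure ρ] (π : Policy S A) (θ : Θ) (t : ℕ) :
    occupancy M D ρ π θ t Set.univ ≤ 1 := by
  rw [occupancy, Measure.map_apply (measurable_pi_apply t) MeasurableSet.univ]
  exact (Measure.restrict_apply_le _ _).trans prob_le_one

theorem lintegral_occupancy (M : TransitionModel Θ S A m) {D : Set S} (hD : MeasurableSet D)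
    (ρ : Measure S) (π : Policy S A) (θ : Θ) (t : ℕ) {f : S × A → ℝ≥0∞} (hf : Measurable f) :
    ∫⁻ z, f z ∂(occupancy M D ρ π θ t) =
      ∫⁻ x, {x | Running D x t}.indicator (fun x => f (x t)) x ∂(pathLaw M ρ π θ) := by
  rw [occupancy, lintegral_map hf (measurable_pi_apply t),
    lintegral_indicator (measurableSet_running hD t)]

theorem measurable_running_indicator {D : Set S} (hD : MeasurableSet D) (t : ℕ) {β : Type*}
    [MeasurableSpace β] [Zero β] {f : Path S A → β} (hf : Measurable f) :
    Measurable ({x : Path S A | Running D x t}.indicator f) :=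
  hf.indicator (measurableSet_running hD t)

theorem ComparableWith.lintegral_occupancy_eq {M : TransitionModel Θ S A m} {θ₀ : Θ} {c d : ℝ}
    (hM : ComparableWith M θ₀ c d) {D : Set S} (hD : MeasurableSet D) (ρ : Measure S)
    [IsProbabilityMeasure ρ] (π : Policy S A) (θ : Θ) (t : ℕ) {f : S × A → ℝ≥0∞}
    (hf : Measurable f) :
    ∫⁻ z, f z ∂(occupancy M D ρ π θ t) =
      ∫⁻ x, {x | Running D x t}.indicator (fun x => f (x t)) x *
        ENNReal.ofReal (pathLR M θ₀ θ t x) ∂(pathLaw M ρ π θ₀) := by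
  rw [lintegral_occupancy M hD ρ π θ t hf]
  refine hM.lintegral_pathLaw ρ π θ t
    (measurable_running_indicator hD t (hf.comp (measurable_pi_apply t)))
    (dependsOn_running_indicator D t fun x y hxy => ?_)
  simp only [hxy t (Set.mem_Iic.2 le_rfl)]

/-- Each of the t transitions before time t contributes a ratio between c and d. The geometric
factors here and in `le_lintegral_occupancy` are what turns the discount δ of the statistic into the
two discounts δd and δc. -/
theorem ComparableWith.lintegral_occupancy_le {M : TransitionModel Θ S A m} {θ₀ : Θ} {c d : ℝ}
    (hM : ComparableWith M θ₀ c d) {D : Set S} (hD : MeasurableSet D) (ρ : Measure S)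
    [IsProbabilityMeasure ρ] (π : Policy S A) (θ : Θ) (t : ℕ) {f : S × A → ℝ≥0∞}
    (hf : Measurable f) :
    ∫⁻ z, f z ∂(occupancy M D ρ π θ t) ≤
      ENNReal.ofReal (d ^ t) * ∫⁻ z, f z ∂(occupancy M D ρ π θ₀ t) := by
  rw [hM.lintegral_occupancy_eq hD ρ π θ t hf, lintegral_occupancy M hD ρ π θ₀ t hf, mul_comm,
    ← lintegral_mul_const _ (measurable_running_indicator hD t
      (f := fun x => f (x t)) (hf.comp (measurable_pi_apply t)))]
  exact lintegral_mono fun x => mul_le_mul_right (ENNReal.ofReal_le_ofReal (hM.pathLR_le _ _ _)) _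

theorem ComparableWith.le_lintegral_occupancy {M : TransitionModel Θ S A m} {θ₀ : Θ} {c d : ℝ}
    (hM : ComparableWith M θ₀ c d) {D : Set S} (hD : MeasurableSet D) (ρ : Measure S)
    [IsProbabilityMeasure ρ] (π : Policy S A) (θ : Θ) (t : ℕ) {f : S × A → ℝ≥0∞}
    (hf : Measurable f) :
    ENNReal.ofReal (c ^ t) * ∫⁻ z, f z ∂(occupancy M D ρ π θ₀ t) ≤
      ∫⁻ z, f z ∂(occupancy M D ρ π θ t) := by
  rw [hM.lintegral_occupancy_eq hD ρ π θ t hf, lintegral_occupancy M hD ρ π θ₀ t hf, mul_comm,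
    ← lintegral_mul_const _ (measurable_running_indicator hD t
      (f := fun x => f (x t)) (hf.comp (measurable_pi_apply t)))]
  exact lintegral_mono fun x => mul_le_mul_right (ENNReal.ofReal_le_ofReal (hM.le_pathLR _ _ _)) _

/-- The joint law of the current state, action and next state, while the episode is running. -/
theorem map_running_pathLaw (M : TransitionModel Θ S A m) {D : Set S} (hD : MeasurableSet D)
    (ρ : Measure S) [IsProbabilityMeasure ρ] (π : Policy S A) (θ : Θ) (t : ℕ) :
    ((pathLaw M ρ π θ).restrict {x | Running D x t}).map (fun x => (x t, (x (t + 1)).1)) =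
      occupancy M D ρ π θ t ⊗ₘ transition M θ := by
  have hmeas : Measurable fun x : Path S A => (x t, (x (t + 1)).1) := by fun_prop
  refine Measure.ext fun s hs => ?_
  have hu : Measurable (s.indicator (fun _ => (1 : ℝ≥0∞))) := measurable_const.indicator hs
  have hone : DependsOn (fun _ : Path S A => (1 : ℝ≥0∞)) (Set.Iic t) := fun _ _ _ => rfl
  have h := lintegral_pathLaw_transition M ρ π θ t
    (measurable_running_indicator hD t measurable_const)
    (dependsOn_running_indicator D t hone) hu
  have hind : ∀ (F : Path S A → ℝ≥0∞) x, {x | Running D x t}.indicator (fun _ => (1 : ℝ≥0∞)) x *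
      F x = {x | Running D x t}.indicator F x := by
    intro F x
    by_cases hx : Running D x t
    · rw [Set.indicator_of_mem (by exact hx), Set.indicator_of_mem (by exact hx), one_mul]
    · rw [Set.indicator_of_notMem (by exact hx), Set.indicator_of_notMem (by exact hx), zero_mul]
  rw [Measure.map_apply hmeas hs, Measure.compProd_apply hs,
    lintegral_occupancy M hD ρ π θ t (Kernel.measurable_kernel_prodMk_left hs),
    ← lintegral_indicator_one (hmeas hs), ← lintegral_indicator (measurableSet_running hD t)]
  refine Eq.trans (lintegral_congr fun x => (hind _ x).symm)
    (h.trans (lintegral_congr fun x =>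
      (hind (fun y => ∫⁻ s', s.indicator (fun _ => 1) (y t, s') ∂(transition M θ (y t))) x).trans
        ?_))
  refine congrFun (congrArg _ (funext fun y => ?_)) x
  rw [← lintegral_indicator_one (measurable_prodMk_left hs)]
  rfl

end Occupancy

/-! ### Hellinger distances and the discounted semi-distances. -/

section Hellinger

variable {Θ S A : Type*} [MeasurableSpace Θ] [MeasurableSpace S] [MeasurableSpace A]
  {m : Measure S}

theorem hellingerSq_comm (f g : S → ℝ) : hellingerSq m f g = hellingerSq m g f := by
  unfold hellingerSq
  refine lintegral_congr fun x => ?_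
  rw [← neg_sub, neg_sq]

theorem semiDist_comm (M : TransitionModel Θ S A m) (lam : Measure (S × A)) (w : S × A → ℝ≥0∞)
    (θ θ' : Θ) : semiDist M lam w θ θ' = semiDist M lam w θ' θ := by
  simp only [semiDist, hellingerSq_comm]

theorem semiDist_nonneg (M : TransitionModel Θ S A m) (lam : Measure (S × A)) (w : S × A → ℝ≥0∞)
    (θ θ' : Θ) : 0 ≤ semiDist M lam w θ θ' := Real.sqrt_nonneg _

theorem hellingerSq_le_two (M : TransitionModel Θ S A m) (θ θ' : Θ) (z : S × A) :
    hellingerSq m (M.p θ z.1 z.2) (M.p θ' z.1 z.2) ≤ 2 := by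
  have hp : ∀ θ : Θ, Measurable fun s' => ENNReal.ofReal (M.p θ z.1 z.2 s') := fun θ =>
    (measurable_p_comp M (g := fun _ => z) measurable_const measurable_const
      measurable_id).ennreal_ofReal
  calc hellingerSq m (M.p θ z.1 z.2) (M.p θ' z.1 z.2)
      ≤ ∫⁻ s', ENNReal.ofReal (M.p θ z.1 z.2 s') + ENNReal.ofReal (M.p θ' z.1 z.2 s') ∂m := by
        refine lintegral_mono fun s' => ?_
        rw [← ENNReal.ofReal_add (M.nonneg _ _ _ _) (M.nonneg _ _ _ _)]
        refine ENNReal.ofReal_le_ofReal ?_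
        have h1 := Real.sq_sqrt (M.nonneg θ z.1 z.2 s')
        have h2 := Real.sq_sqrt (M.nonneg θ' z.1 z.2 s')
        nlinarith [mul_nonneg (Real.sqrt_nonneg (M.p θ z.1 z.2 s'))
          (Real.sqrt_nonneg (M.p θ' z.1 z.2 s'))]
    _ = 2 := by
        rw [lintegral_add_left (hp θ), M.lintegral_eq_one, M.lintegral_eq_one, one_add_one_eq_two]

theorem hellingerSq_triangle (M : TransitionModel Θ S A m) (θ₁ θ₂ θ₃ : Θ) (z : S × A) :
    hellingerSq m (M.p θ₁ z.1 z.2) (M.p θ₃ z.1 z.2) ≤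
      2 * hellingerSq m (M.p θ₁ z.1 z.2) (M.p θ₂ z.1 z.2) +
        2 * hellingerSq m (M.p θ₂ z.1 z.2) (M.p θ₃ z.1 z.2) := by
  have hp : ∀ θ : Θ, Measurable fun s' => M.p θ z.1 z.2 s' := fun θ =>
    measurable_p_comp M (g := fun _ => z) measurable_const measurable_const measurable_id
  have hm : ∀ θ θ' : Θ, Measurable fun s' =>
      ENNReal.ofReal ((√(M.p θ z.1 z.2 s') - √(M.p θ' z.1 z.2 s')) ^ 2) := fun θ θ' =>
    (((hp θ).sqrt.sub (hp θ').sqrt).pow_const 2).ennreal_ofReal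
  unfold hellingerSq
  rw [← lintegral_const_mul _ (hm _ _), ← lintegral_const_mul _ (hm _ _),
    ← lintegral_add_left ((hm _ _).const_mul _)]
  refine lintegral_mono fun s' => ?_
  have h2 : (2 : ℝ≥0∞) = ENNReal.ofReal 2 := by simp
  simp only
  rw [h2, ← ENNReal.ofReal_mul zero_le_two, ← ENNReal.ofReal_mul zero_le_two,
    ← ENNReal.ofReal_add (by positivity) (by positivity)]
  refine ENNReal.ofReal_le_ofReal ?_
  -- This is 2u² + 2v² - (u + v)² = (u - v)² for the two successive differences of square roots.
  nlinarith [sq_nonneg (√(M.p θ₁ z.1 z.2 s') - 2 * √(M.p θ₂ z.1 z.2 s') + √(M.p θ₃ z.1 z.2 s'))]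

variable [SigmaFinite m]

theorem measurable_hellingerSq_comp (M : TransitionModel Θ S A m) {X : Type*} [MeasurableSpace X]
    {f f' : X → Θ} {g : X → S × A} (hf : Measurable f) (hf' : Measurable f') (hg : Measurable g) :
    Measurable fun x =>
      hellingerSq m (M.p (f x) (g x).1 (g x).2) (M.p (f' x) (g x).1 (g x).2) := by
  unfold hellingerSq
  have h1 : Measurable fun q : X × S => M.p (f q.1) (g q.1).1 (g q.1).2 q.2 :=
    measurable_p_comp M (hf.comp measurable_fst) (hg.comp measurable_fst) measurable_snd
  have h2 : Measurable fun q : X × S => M.p (f' q.1) (g q.1).1 (g q.1).2 q.2 :=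
    measurable_p_comp M (hf'.comp measurable_fst) (hg.comp measurable_fst) measurable_snd
  exact Measurable.lintegral_prod_right' (f := fun q : X × S =>
    ENNReal.ofReal ((√(M.p (f q.1) (g q.1).1 (g q.1).2 q.2) -
      √(M.p (f' q.1) (g q.1).1 (g q.1).2 q.2)) ^ 2))
    ((h1.sqrt.sub h2.sqrt).pow_const 2).ennreal_ofReal

/-- The mean Hellinger distance at time `t`, for the law of `θ`. -/
noncomputable def meanHellinger (M : TransitionModel Θ S A m) (D : Set S) (ρ : Measure S)
    (π : Policy S A) (θ θ₁ θ₂ : Θ) (t : ℕ) : ℝ≥0∞ :=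
  ∫⁻ z, hellingerSq m (M.p θ₁ z.1 z.2) (M.p θ₂ z.1 z.2) ∂(occupancy M D ρ π θ t)

theorem meanHellinger_le_two (M : TransitionModel Θ S A m) (D : Set S) (ρ : Measure S)
    [IsProbabilityMeasure ρ] (π : Policy S A) (θ θ₁ θ₂ : Θ) (t : ℕ) :
    meanHellinger M D ρ π θ θ₁ θ₂ t ≤ 2 := by
  calc meanHellinger M D ρ π θ θ₁ θ₂ t ≤ ∫⁻ _, 2 ∂(occupancy M D ρ π θ t) :=
        lintegral_mono fun z => hellingerSq_le_two M θ₁ θ₂ z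
    _ = 2 * occupancy M D ρ π θ t Set.univ := lintegral_const _
    _ ≤ 2 * 1 := by gcongr; exact occupancy_univ_le M D ρ π θ t
    _ = 2 := mul_one 2

theorem meanHellinger_ne_top (M : TransitionModel Θ S A m) (D : Set S) (ρ : Measure S)
    [IsProbabilityMeasure ρ] (π : Policy S A) (θ θ₁ θ₂ : Θ) (t : ℕ) :
    meanHellinger M D ρ π θ θ₁ θ₂ t ≠ ∞ :=
  ((meanHellinger_le_two M D ρ π θ θ₁ θ₂ t).trans_lt (by simp)).ne

theorem meanHellinger_toReal_le_two (M : TransitionModel Θ S A m) (D : Set S) (ρ : Measure S)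
    [IsProbabilityMeasure ρ] (π : Policy S A) (θ θ₁ θ₂ : Θ) (t : ℕ) :
    (meanHellinger M D ρ π θ θ₁ θ₂ t).toReal ≤ 2 := by
  have := ENNReal.toReal_mono (by simp) (meanHellinger_le_two M D ρ π θ θ₁ θ₂ t)
  simpa using this

theorem summable_meanHellinger (M : TransitionModel Θ S A m) (D : Set S) (ρ : Measure S)
    [IsProbabilityMeasure ρ] (π : Policy S A) (θ θ₁ θ₂ : Θ) {δ : ℝ} (h0 : 0 ≤ δ) (h1 : δ < 1) :
    Summable fun t => δ ^ t * (meanHellinger M D ρ π θ θ₁ θ₂ t).toReal :=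
  Summable.of_nonneg_of_le (fun t => by positivity)
    (fun t => mul_le_mul_of_nonneg_left
      (meanHellinger_toReal_le_two M D ρ π θ θ₁ θ₂ t) (by positivity))
    ((summable_geometric_of_lt_one h0 h1).mul_right 2)

/-- By absolute continuity the densities recombine with `lam` into the occupancy measures, so `lam`
disappears and only discounted sums need be handled afterwards. -/
theorem semiDist_sq (M : TransitionModel Θ S A m) (D : Set S) (ρ : Measure S)
    [IsProbabilityMeasure ρ] (π : Policy S A) (θ₀ : Θ) (lam : Measure (S × A)) [IsFiniteMeasure lam]
    (hlam : ∀ t, occupancy M D ρ π θ₀ t ≪ lam) {δ : ℝ} (h0 : 0 ≤ δ) (θ₁ θ₂ : Θ) :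
    semiDist M lam (discountedDensity M D ρ π θ₀ lam δ) θ₁ θ₂ ^ 2 =
      ∑' t, δ ^ t * (meanHellinger M D ρ π θ₀ θ₁ θ₂ t).toReal := by
  have hh : Measurable fun z : S × A => hellingerSq m (M.p θ₁ z.1 z.2) (M.p θ₂ z.1 z.2) :=
    measurable_hellingerSq_comp M measurable_const measurable_const measurable_id
  have hint : ∫⁻ z, hellingerSq m (M.p θ₁ z.1 z.2) (M.p θ₂ z.1 z.2) *
      discountedDensity M D ρ π θ₀ lam δ z ∂lam =
      ∑' t, ENNReal.ofReal δ ^ t * meanHellinger M D ρ π θ₀ θ₁ θ₂ t := by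
    simp only [discountedDensity, ← ENNReal.tsum_mul_left]
    have hm : ∀ t, AEMeasurable (fun z => hellingerSq m (M.p θ₁ z.1 z.2) (M.p θ₂ z.1 z.2) *
        (ENNReal.ofReal δ ^ t * (occupancy M D ρ π θ₀ t).rnDeriv lam z)) lam := fun t =>
      (hh.mul (measurable_const.mul (Measure.measurable_rnDeriv _ _))).aemeasurable
    rw [lintegral_tsum hm]
    refine tsum_congr fun t => ?_
    rw [meanHellinger, ← lintegral_rnDeriv_mul (hlam t) hh.aemeasurable,
      ← lintegral_const_mul' _ _ (by finiteness)]
    refine lintegral_congr fun z => ?_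
    ring
  rw [semiDist, Real.sq_sqrt ENNReal.toReal_nonneg, hint, ENNReal.tsum_toReal_eq]
  · refine tsum_congr fun t => ?_
    rw [ENNReal.toReal_mul, ENNReal.toReal_pow, ENNReal.toReal_ofReal h0]
  · intro t
    exact ENNReal.mul_ne_top (by finiteness) (meanHellinger_ne_top M D ρ π θ₀ θ₁ θ₂ t)

/-- This squared form replaces the triangle inequality. Nothing is lost for two legs with the same
bound, which is the only way in which it is used. -/
theorem semiDist_sq_triangle (M : TransitionModel Θ S A m) (D : Set S) (ρ : Measure S)
    [IsProbabilityMeasure ρ] (π : Policy S A) (θ₀ : Θ) (lam : Measure (S × A)) [IsFiniteMeasure lam]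
    (hlam : ∀ t, occupancy M D ρ π θ₀ t ≪ lam) {δ : ℝ} (h0 : 0 ≤ δ) (h1 : δ < 1)
    (θ₁ θ₂ θ₃ : Θ) :
    semiDist M lam (discountedDensity M D ρ π θ₀ lam δ) θ₁ θ₃ ^ 2 ≤
      2 * semiDist M lam (discountedDensity M D ρ π θ₀ lam δ) θ₁ θ₂ ^ 2 +
        2 * semiDist M lam (discountedDensity M D ρ π θ₀ lam δ) θ₂ θ₃ ^ 2 := by
  have hs := fun a b => summable_meanHellinger M D ρ π θ₀ a b h0 h1
  simp only [semiDist_sq M D ρ π θ₀ lam hlam h0]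
  rw [← tsum_mul_left, ← tsum_mul_left,
    ← ((hs _ _).mul_left 2).tsum_add ((hs _ _).mul_left 2)]
  refine (hs _ _).tsum_le_tsum (fun t => ?_) (((hs _ _).mul_left 2).add ((hs _ _).mul_left 2))
  have hh : Measurable fun z : S × A => hellingerSq m (M.p θ₁ z.1 z.2) (M.p θ₂ z.1 z.2) :=
    measurable_hellingerSq_comp M measurable_const measurable_const measurable_id
  have hh' : Measurable fun z : S × A => hellingerSq m (M.p θ₂ z.1 z.2) (M.p θ₃ z.1 z.2) :=
    measurable_hellingerSq_comp M measurable_const measurable_const measurable_id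
  have hle : meanHellinger M D ρ π θ₀ θ₁ θ₃ t ≤ 2 * meanHellinger M D ρ π θ₀ θ₁ θ₂ t +
      2 * meanHellinger M D ρ π θ₀ θ₂ θ₃ t := by
    unfold meanHellinger
    rw [← lintegral_const_mul _ hh, ← lintegral_const_mul _ hh',
      ← lintegral_add_left (hh.const_mul _)]
    exact lintegral_mono fun z => hellingerSq_triangle M θ₁ θ₂ θ₃ z
  have hf1 := meanHellinger_ne_top M D ρ π θ₀ θ₁ θ₂ t
  have hf2 := meanHellinger_ne_top M D ρ π θ₀ θ₂ θ₃ t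
  have := ENNReal.toReal_mono (by finiteness) hle
  rw [ENNReal.toReal_add (by finiteness) (by finiteness), ENNReal.toReal_mul,
    ENNReal.toReal_mul, ENNReal.toReal_ofNat] at this
  calc _ ≤ δ ^ t * (2 * (meanHellinger M D ρ π θ₀ θ₁ θ₂ t).toReal +
        2 * (meanHellinger M D ρ π θ₀ θ₂ θ₃ t).toReal) := by gcongr
    _ = _ := by ring

theorem measurable_semiDist_left (M : TransitionModel Θ S A m) (lam : Measure (S × A))
    [SFinite lam] {w : S × A → ℝ≥0∞} (hw : Measurable w) (θ' : Θ) :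
    Measurable fun θ => semiDist M lam w θ θ' := by
  unfold semiDist
  refine (Measurable.ennreal_toReal ?_).sqrt
  exact Measurable.lintegral_prod_right' (f := fun q : Θ × (S × A) =>
    hellingerSq m (M.p q.1 q.2.1 q.2.2) (M.p θ' q.2.1 q.2.2) * w q.2)
    ((measurable_hellingerSq_comp M measurable_fst measurable_const measurable_snd).mul
      (hw.comp measurable_snd))

theorem measurable_discountedDensity (M : TransitionModel Θ S A m) (D : Set S) (ρ : Measure S)
    (π : Policy S A) (θ : Θ) (lam : Measure (S × A)) (δ : ℝ) :
    Measurable (discountedDensity M D ρ π θ lam δ) := by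
  unfold discountedDensity
  exact Measurable.tsum fun t => (Measure.measurable_rnDeriv _ _).const_mul _

end Hellinger

/-! ### Discounted sums along an episode. -/

section RunSum

variable {S A : Type*}

theorem SameEpisode.running_iff {D : Set S} {x y : Path S A} (h : SameEpisode D x y) (t : ℕ) :
    Running D x t ↔ Running D y t := by
  constructor
  · intro hx i hi
    rw [← h.1 i fun j hj => hx j (hj.le.trans hi)]
    exact hx i hi
  -- `SameEpisode` puts its conditions on the first path only, so in this direction the equality of
  -- states has to be propagated up through time.
  · intro hy i
    induction i using Nat.strong_induction_on with
    | _ i ih =>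
      intro hi
      rw [h.1 i fun j hj => ih j hj (hj.le.trans hi)]
      exact hy i hi

/-- The value of `g` at the transition out of time `t`, if the episode is then running. -/
noncomputable def runTerm (D : Set S) (g : (S × A) × S → ℝ) (t : ℕ) : Path S A → ℝ :=
  {x : Path S A | Running D x t}.indicator fun x => g (x t, (x (t + 1)).1)

/-- The discounted sum of `g` over the transitions of an episode. -/
noncomputable def runSum (D : Set S) (δ : ℝ) (g : (S × A) × S → ℝ) (x : Path S A) : ℝ :=
  ∑' t, δ ^ t * runTerm D g t x

theorem runTerm_congr {D : Set S} {x y : Path S A} (h : SameEpisode D x y)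
    (g : (S × A) × S → ℝ) (t : ℕ) : runTerm D g t x = runTerm D g t y := by
  unfold runTerm
  by_cases hx : Running D x t
  · have hy := (h.running_iff t).1 hx
    rw [Set.indicator_of_mem (by exact hx), Set.indicator_of_mem (by exact hy),
      h.1 (t + 1) fun i hi => hx i (Nat.lt_succ_iff.1 hi),
      Prod.ext (h.1 t fun i hi => hx i hi.le) (h.2 t hx)]
  · have hy := fun hy => hx ((h.running_iff t).2 hy)
    rw [Set.indicator_of_notMem (by exact hx), Set.indicator_of_notMem (by exact hy)]

theorem runSum_congr {D : Set S} {x y : Path S A} (h : SameEpisode D x y) (δ : ℝ)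
    (g : (S × A) × S → ℝ) : runSum D δ g x = runSum D δ g y :=
  tsum_congr fun t => by rw [runTerm_congr h]

theorem abs_runTerm_le (D : Set S) {g : (S × A) × S → ℝ} {C : ℝ} (hg : ∀ q, |g q| ≤ C)
    (t : ℕ) (x : Path S A) : |runTerm D g t x| ≤ C := by
  unfold runTerm
  by_cases hx : Running D x t
  · rw [Set.indicator_of_mem (by exact hx)]
    exact hg _
  · rw [Set.indicator_of_notMem (by exact hx), abs_zero]
    exact (abs_nonneg _).trans (hg (x t, (x (t + 1)).1))

theorem runTerm_neg (D : Set S) (g : (S × A) × S → ℝ) (t : ℕ) (x : Path S A) :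
    runTerm D (fun q => -g q) t x = -runTerm D g t x := by
  unfold runTerm
  by_cases hx : Running D x t
  · rw [Set.indicator_of_mem (by exact hx), Set.indicator_of_mem (by exact hx)]
  · rw [Set.indicator_of_notMem (by exact hx), Set.indicator_of_notMem (by exact hx), neg_zero]

theorem runSum_neg (D : Set S) (δ : ℝ) (g : (S × A) × S → ℝ) (x : Path S A) :
    runSum D δ (fun q => -g q) x = -runSum D δ g x := by
  simp only [runSum, runTerm_neg, mul_neg, tsum_neg]

theorem summable_runTerm (D : Set S) {g : (S × A) × S → ℝ} {C : ℝ} (hg : ∀ q, |g q| ≤ C)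
    {δ : ℝ} (h0 : 0 ≤ δ) (h1 : δ < 1) (x : Path S A) :
    Summable fun t => δ ^ t * runTerm D g t x := by
  refine Summable.of_norm_bounded ((summable_geometric_of_lt_one h0 h1).mul_right C) fun t => ?_
  rw [norm_mul, norm_pow, Real.norm_of_nonneg h0]
  exact mul_le_mul_of_nonneg_left (abs_runTerm_le D hg t x) (by positivity)

theorem abs_runSum_le (D : Set S) {g : (S × A) × S → ℝ} {C : ℝ} (hg : ∀ q, |g q| ≤ C)
    {δ : ℝ} (h0 : 0 ≤ δ) (h1 : δ < 1) (x : Path S A) :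
    |runSum D δ g x| ≤ (1 - δ)⁻¹ * C := by
  refine tsum_of_norm_bounded (f := fun t => δ ^ t * runTerm D g t x)
    ((hasSum_geometric_of_lt_one h0 h1).mul_right C) fun t => ?_
  rw [norm_mul, norm_pow, Real.norm_of_nonneg h0]
  exact mul_le_mul_of_nonneg_left (abs_runTerm_le D hg t x) (by positivity)

/-- A quadratic remainder bound for the exponential of a discounted sum. -/
theorem exp_runSum_le (D : Set S) {g : (S × A) × S → ℝ} (hg : ∀ q, |g q| ≤ 1)
    {δ κ : ℝ} (h0 : 0 ≤ δ) (h1 : δ ≤ 1 / 2) (hκ : 0 ≤ κ) (hκ1 : κ ≤ 1 / 2) (x : Path S A) :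
    Real.exp (κ * runSum D δ g x) ≤
      1 + κ * runSum D δ (fun q => g q + 2 * κ * g q ^ 2) x := by
  have h1' : δ < 1 := by linarith
  set Z := runSum D δ g x with hZ
  have hinv : (1 - δ)⁻¹ ≤ 2 := by
    rw [inv_le_comm₀ (by linarith) two_pos]
    linarith
  have hZ2 : |Z| ≤ 2 := by
    have := abs_runSum_le D hg h0 h1' x
    linarith
  have hκZ : |κ * Z| ≤ 1 := by
    rw [abs_mul, abs_of_nonneg hκ]
    nlinarith [abs_nonneg Z]
  -- For |u| ≤ 1 one has exp u ≤ 1 + u + u², applied to u = κZ.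
  have hexp := (abs_le.1 (Real.abs_exp_sub_one_sub_id_le hκZ)).2
  have hg2 : ∀ q, |g q ^ 2| ≤ 1 := fun q => by
    rw [abs_pow]
    exact pow_le_one₀ (abs_nonneg _) (hg q)
  have hsq : ∀ t, runTerm D (fun q => g q ^ 2) t x = runTerm D g t x ^ 2 := fun t => by
    unfold runTerm
    by_cases hx : Running D x t
    · rw [Set.indicator_of_mem (by exact hx), Set.indicator_of_mem (by exact hx)]
    · rw [Set.indicator_of_notMem (by exact hx), Set.indicator_of_notMem (by exact hx)]
      norm_num
  have hlin : ∀ t, runTerm D (fun q => g q + 2 * κ * g q ^ 2) t x =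
      runTerm D g t x + 2 * κ * runTerm D (fun q => g q ^ 2) t x := fun t => by
    unfold runTerm
    by_cases hx : Running D x t
    · simp only [Set.indicator_of_mem (show x ∈ {x : Path S A | Running D x t} from hx)]
    · simp only [Set.indicator_of_notMem (show x ∉ {x : Path S A | Running D x t} from hx)]
      norm_num
  have hs := summable_runTerm D hg h0 h1' x
  have hs2 := summable_runTerm D hg2 h0 h1' x
  set Q := runSum D δ (fun q => g q ^ 2) x with hQ
  have hsplit : runSum D δ (fun q => g q + 2 * κ * g q ^ 2) x = Z + 2 * κ * Q := by
    rw [hZ, hQ, runSum, runSum, runSum, ← tsum_mul_left, ← hs.tsum_add (hs2.mul_left _)]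
    refine tsum_congr fun t => ?_
    rw [hlin]
    ring
  -- Cauchy-Schwarz for the weights δ^t, whose total mass is at most 2: expand the nonnegative
  -- weighted sum of squares of the terms centred at Z/2.
  have hCS : Z ^ 2 ≤ 2 * Q := by
    have hgeo := hasSum_geometric_of_lt_one h0 h1'
    have hsum : HasSum (fun t => δ ^ t * (runTerm D g t x - Z / 2) ^ 2)
        (Q - Z * Z + Z ^ 2 / 4 * (1 - δ)⁻¹) := by
      have := (hs2.hasSum.sub (hs.hasSum.mul_left Z)).add (hgeo.mul_left (Z ^ 2 / 4))
      have hfun : (fun t => δ ^ t * (runTerm D g t x - Z / 2) ^ 2) = fun t =>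
          δ ^ t * runTerm D (fun q => g q ^ 2) t x - Z * (δ ^ t * runTerm D g t x) +
            Z ^ 2 / 4 * δ ^ t := funext fun t => by
        rw [hsq]
        ring
      rw [hfun]
      exact this
    have hpos := hsum.nonneg fun t => by positivity
    nlinarith [sq_nonneg Z]
  rw [hsplit]
  nlinarith [sq_nonneg κ]

end RunSum

/-! ### Pointwise inequalities for the score. -/

section TestFunction

/-- Here a² and b² stand for p_θ₀ and p_θ₁. With r = (b + a)²/(b² + a²) in [1, 2], the score times
a² equals (b² - a²)/2 - (b - a)² r/2; the first term will integrate to zero. The quadratic term is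
at most (b - a)²/8 and is absorbed. -/
theorem hellinger_algebra_null {a b κ : ℝ} (ha : 0 ≤ a) (hb : 0 ≤ b)
    (hκ1 : κ ≤ 1 / 32) :
    ((b ^ 2 - a ^ 2) / (b ^ 2 + a ^ 2) + 2 * κ * ((b ^ 2 - a ^ 2) / (b ^ 2 + a ^ 2)) ^ 2) * a ^ 2 ≤
      1 / 2 * (b ^ 2 - a ^ 2) - 1 / 4 * (b - a) ^ 2 := by
  rcases (add_nonneg (sq_nonneg b) (sq_nonneg a)).eq_or_lt with hq | hq
  · have ha0 : a = 0 := by nlinarith [sq_nonneg b, sq_nonneg a]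
    have hb0 : b = 0 := by nlinarith [sq_nonneg b, sq_nonneg a]
    simp [ha0, hb0]
  · set q := b ^ 2 + a ^ 2 with hq_def
    set r := (b + a) ^ 2 / q with hr_def
    have hr1 : 1 ≤ r := by
      rw [hr_def, le_div_iff₀ hq]
      nlinarith [mul_nonneg ha hb]
    have hr2 : r ≤ 2 := by
      rw [hr_def, div_le_iff₀ hq]
      nlinarith [sq_nonneg (a - b)]
    have e1 : (b ^ 2 - a ^ 2) / q * a ^ 2 =
        1 / 2 * (b ^ 2 - a ^ 2) - 1 / 2 * ((b - a) ^ 2 * r) := by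
      rw [hr_def]
      field_simp
      rw [hq_def]
      ring
    have e2 : ((b ^ 2 - a ^ 2) / q) ^ 2 * a ^ 2 = (b - a) ^ 2 * r * (a ^ 2 / q) := by
      rw [hr_def]
      field_simp
      ring
    have h3 : a ^ 2 / q ≤ 1 := by
      rw [div_le_one hq]
      nlinarith [sq_nonneg b]
    have h4 : 0 ≤ a ^ 2 / q := by positivity
    have h5 : (b - a) ^ 2 * r * (a ^ 2 / q) ≤ 2 * (b - a) ^ 2 := by
      calc (b - a) ^ 2 * r * (a ^ 2 / q) ≤ (b - a) ^ 2 * r * 1 := by gcongr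
        _ ≤ (b - a) ^ 2 * 2 * 1 := by gcongr
        _ = _ := by ring
    have h6 : (b - a) ^ 2 * 1 ≤ (b - a) ^ 2 * r := by gcongr
    have h7 : κ * ((b - a) ^ 2 * r * (a ^ 2 / q)) ≤ 1 / 32 * (2 * (b - a) ^ 2) :=
      mul_le_mul hκ1 h5 (by positivity) (by norm_num)
    calc _ = (b ^ 2 - a ^ 2) / q * a ^ 2 + 2 * (κ * (((b ^ 2 - a ^ 2) / q) ^ 2 * a ^ 2)) := by ring
      _ ≤ _ := by
        rw [e1, e2]
        linarith [sq_nonneg (b - a)]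

/-- With w² for p_θ, replacing w² by b² in the linear term creates the cross term (w - b)(b - a)v
with v = (w + b)(b + a)/(b² + a²). The bound w² ≤ da² gives v² ≤ 4d, and Young's inequality splits
the cross term. The coefficient of (b - a)² is then -1/2 + 1/4 + 1/8 = -1/8. -/
theorem hellinger_algebra_alternative {a b w κ d : ℝ} (ha : 0 ≤ a) (hb : 0 ≤ b) (hw : 0 ≤ w)
    (hd : 1 ≤ d) (hwa : w ^ 2 ≤ d * a ^ 2) (hκ : 0 ≤ κ) (hκ1 : κ * d ≤ 1 / 32) :
    (-((b ^ 2 - a ^ 2) / (b ^ 2 + a ^ 2)) +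
        2 * κ * (-((b ^ 2 - a ^ 2) / (b ^ 2 + a ^ 2))) ^ 2) * w ^ 2 ≤
      -(1 / 2) * (b ^ 2 - a ^ 2) - 1 / 8 * (b - a) ^ 2 + 4 * d * (w - b) ^ 2 := by
  rcases (add_nonneg (sq_nonneg b) (sq_nonneg a)).eq_or_lt with hq | hq
  · have ha0 : a = 0 := by nlinarith [sq_nonneg b, sq_nonneg a]
    have hb0 : b = 0 := by nlinarith [sq_nonneg b, sq_nonneg a]
    have hw0 : w = 0 := by
      rw [ha0] at hwa
      nlinarith
    simp [ha0, hb0, hw0]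
  · set q := b ^ 2 + a ^ 2 with hq_def
    set r := (b + a) ^ 2 / q with hr_def
    set v := (w + b) * (b + a) / q with hv_def
    have hr1 : 1 ≤ r := by
      rw [hr_def, le_div_iff₀ hq]
      nlinarith [mul_nonneg ha hb]
    have hr2 : r ≤ 2 := by
      rw [hr_def, div_le_iff₀ hq]
      nlinarith [sq_nonneg (a - b)]
    have hwb : (w + b) ^ 2 / q ≤ 2 * d := by
      rw [div_le_iff₀ hq]
      nlinarith [sq_nonneg (w - b), sq_nonneg b]
    have hv2 : v ^ 2 ≤ 4 * d := by
      have : v ^ 2 = (w + b) ^ 2 / q * r := by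
        rw [hv_def, hr_def]
        field_simp
      rw [this]
      calc (w + b) ^ 2 / q * r ≤ (2 * d) * 2 := by gcongr
        _ = 4 * d := by ring
    have e1 : (b ^ 2 - a ^ 2) / q * w ^ 2 = 1 / 2 * (b ^ 2 - a ^ 2) + 1 / 2 * ((b - a) ^ 2 * r) +
        (w - b) * (b - a) * v := by
      rw [hr_def, hv_def]
      field_simp
      rw [hq_def]
      ring
    have e2 : ((b ^ 2 - a ^ 2) / q) ^ 2 * w ^ 2 = (b - a) ^ 2 * r * (w ^ 2 / q) := by
      rw [hr_def]
      field_simp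
      ring
    have h3 : w ^ 2 / q ≤ d := by
      rw [div_le_iff₀ hq]
      nlinarith [mul_nonneg (by linarith : (0 : ℝ) ≤ d) (sq_nonneg b)]
    have h5 : (b - a) ^ 2 * r * (w ^ 2 / q) ≤ (b - a) ^ 2 * 2 * d := by
      gcongr
    have h6 : (b - a) ^ 2 * 1 ≤ (b - a) ^ 2 * r := by gcongr
    have h7 : κ * ((b - a) ^ 2 * r * (w ^ 2 / q)) ≤ 1 / 16 * (b - a) ^ 2 := by
      calc κ * ((b - a) ^ 2 * r * (w ^ 2 / q)) ≤ κ * ((b - a) ^ 2 * 2 * d) := by gcongr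
        _ = (κ * d) * (2 * (b - a) ^ 2) := by ring
        _ ≤ 1 / 32 * (2 * (b - a) ^ 2) := by gcongr
        _ = _ := by ring
    have h8 : -((w - b) * (b - a) * v) ≤ 1 / 4 * (b - a) ^ 2 + 4 * d * (w - b) ^ 2 := by
      have h9 : (w - b) ^ 2 * v ^ 2 ≤ (w - b) ^ 2 * (4 * d) := by gcongr
      nlinarith [sq_nonneg (1 / 2 * (b - a) + (w - b) * v)]
    calc _ = -((b ^ 2 - a ^ 2) / q * w ^ 2) + 2 * (κ * (((b ^ 2 - a ^ 2) / q) ^ 2 * w ^ 2)) := by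
          ring
      _ ≤ _ := by
        rw [e1, e2]
        linarith [sq_nonneg (b - a)]

variable {Θ S A : Type*} [MeasurableSpace Θ] [MeasurableSpace S] [MeasurableSpace A]
  {m : Measure S}

/-- The bounded score `(p₁ - p₀) / (p₁ + p₀)` of a transition. -/
noncomputable def score (M : TransitionModel Θ S A m) (θ₀ θ₁ : Θ) (q : (S × A) × S) : ℝ :=
  (M.p θ₁ q.1.1 q.1.2 q.2 - M.p θ₀ q.1.1 q.1.2 q.2) /
    (M.p θ₁ q.1.1 q.1.2 q.2 + M.p θ₀ q.1.1 q.1.2 q.2)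

theorem measurable_score (M : TransitionModel Θ S A m) (θ₀ θ₁ : Θ) :
    Measurable (score M θ₀ θ₁) := by
  have hp : ∀ θ : Θ, Measurable fun q : (S × A) × S => M.p θ q.1.1 q.1.2 q.2 := fun θ =>
    measurable_p_comp M measurable_const measurable_fst measurable_snd
  exact ((hp θ₁).sub (hp θ₀)).div ((hp θ₁).add (hp θ₀))

theorem abs_score_le (M : TransitionModel Θ S A m) (θ₀ θ₁ : Θ) (q : (S × A) × S) :
    |score M θ₀ θ₁ q| ≤ 1 := by
  have h0 := M.nonneg θ₀ q.1.1 q.1.2 q.2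
  have h1 := M.nonneg θ₁ q.1.1 q.1.2 q.2
  rw [score, abs_div, abs_of_nonneg (add_nonneg h1 h0)]
  refine div_le_one_of_le₀ ?_ (add_nonneg h1 h0)
  rw [abs_le]
  constructor <;> linarith

theorem measurable_p_section (M : TransitionModel Θ S A m) (θ : Θ) (z : S × A) :
    Measurable fun s' => M.p θ z.1 z.2 s' :=
  measurable_p_comp M (g := fun _ => z) measurable_const measurable_const measurable_id

theorem integrable_p (M : TransitionModel Θ S A m) (θ : Θ) (z : S × A) :
    Integrable (fun s' => M.p θ z.1 z.2 s') m := by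
  refine ⟨(measurable_p_section M θ z).aestronglyMeasurable, ?_⟩
  rw [hasFiniteIntegral_iff_ofReal (ae_of_all _ fun s' => M.nonneg _ _ _ _),
    M.lintegral_eq_one]
  exact ENNReal.one_lt_top

theorem integral_p (M : TransitionModel Θ S A m) (θ : Θ) (z : S × A) :
    ∫ s', M.p θ z.1 z.2 s' ∂m = 1 := by
  rw [integral_eq_lintegral_of_nonneg_ae (ae_of_all _ fun s' => M.nonneg _ _ _ _)
    (measurable_p_section M θ z).aestronglyMeasurable, M.lintegral_eq_one, ENNReal.toReal_one]

theorem measurable_sqrt_sub_sq (M : TransitionModel Θ S A m) (θ θ' : Θ) (z : S × A) :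
    Measurable fun s' => (√(M.p θ z.1 z.2 s') - √(M.p θ' z.1 z.2 s')) ^ 2 :=
  ((measurable_p_section M θ z).sqrt.sub (measurable_p_section M θ' z).sqrt).pow_const 2

theorem integrable_sqrt_sub_sq (M : TransitionModel Θ S A m) (θ θ' : Θ) (z : S × A) :
    Integrable (fun s' => (√(M.p θ z.1 z.2 s') - √(M.p θ' z.1 z.2 s')) ^ 2) m := by
  refine ⟨(measurable_sqrt_sub_sq M θ θ' z).aestronglyMeasurable, ?_⟩
  rw [hasFiniteIntegral_iff_ofReal (ae_of_all _ fun s' => sq_nonneg _)]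
  exact (hellingerSq_le_two M θ θ' z).trans_lt (by simp)

theorem integral_sqrt_sub_sq (M : TransitionModel Θ S A m) (θ θ' : Θ) (z : S × A) :
    ∫ s', (√(M.p θ z.1 z.2 s') - √(M.p θ' z.1 z.2 s')) ^ 2 ∂m =
      (hellingerSq m (M.p θ z.1 z.2) (M.p θ' z.1 z.2)).toReal := by
  rw [integral_eq_lintegral_of_nonneg_ae (ae_of_all _ fun s' => sq_nonneg _)
    (measurable_sqrt_sub_sq M θ θ' z).aestronglyMeasurable]
  rfl

variable [SigmaFinite m]

theorem integral_transition (M : TransitionModel Θ S A m) (θ : Θ) (z : S × A) (f : S → ℝ) :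
    ∫ s', f s' ∂(transition M θ z) = ∫ s', f s' * M.p θ z.1 z.2 s' ∂m := by
  rw [transition_apply, integral_withDensity_eq_integral_toReal_smul
    (measurable_p_section M θ z).ennreal_ofReal (ae_of_all _ fun _ => ENNReal.ofReal_lt_top)]
  refine integral_congr_ae (ae_of_all _ fun s' => ?_)
  simp only [ENNReal.toReal_ofReal (M.nonneg _ _ _ _), smul_eq_mul]
  ring

/-- The γ term integrates to zero because p_θ₀ and p_θ₁ both have mass one; the two squares
integrate to Hellinger distances. -/
theorem integral_transition_le (M : TransitionModel Θ S A m) (θ θ₀ θ₁ : Θ) (z : S × A)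
    {f : S → ℝ} (hf : Measurable f) {C α β γ : ℝ} (hC : ∀ s', |f s'| ≤ C)
    (h : ∀ s', f s' * M.p θ z.1 z.2 s' ≤ γ * (M.p θ₁ z.1 z.2 s' - M.p θ₀ z.1 z.2 s') -
      α * (√(M.p θ₁ z.1 z.2 s') - √(M.p θ₀ z.1 z.2 s')) ^ 2 +
      β * (√(M.p θ z.1 z.2 s') - √(M.p θ₁ z.1 z.2 s')) ^ 2) :
    ∫ s', f s' ∂(transition M θ z) ≤
      -(α * (hellingerSq m (M.p θ₀ z.1 z.2) (M.p θ₁ z.1 z.2)).toReal) +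
        β * (hellingerSq m (M.p θ z.1 z.2) (M.p θ₁ z.1 z.2)).toReal := by
  have i1 : Integrable (fun s' => γ * (M.p θ₁ z.1 z.2 s' - M.p θ₀ z.1 z.2 s')) m :=
    ((integrable_p M θ₁ z).sub (integrable_p M θ₀ z)).const_mul γ
  have i2 := (integrable_sqrt_sub_sq M θ₁ θ₀ z).const_mul α
  have i3 := (integrable_sqrt_sub_sq M θ θ₁ z).const_mul β
  rw [integral_transition]
  refine (integral_mono ((integrable_p M θ z).bdd_mul hf.aestronglyMeasurable
    (ae_of_all _ hC)) ((i1.sub i2).add i3) h).trans_eq ?_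
  rw [integral_add' (i1.sub i2) i3, integral_sub' i1 i2, integral_const_mul, integral_const_mul,
    integral_const_mul, integral_sqrt_sub_sq, integral_sqrt_sub_sq,
    integral_sub (integrable_p M θ₁ z) (integrable_p M θ₀ z), integral_p, integral_p,
    hellingerSq_comm (M.p θ₁ z.1 z.2) (M.p θ₀ z.1 z.2)]
  ring

theorem integral_score_null_le (M : TransitionModel Θ S A m) (θ₀ θ₁ : Θ) (z : S × A) {κ : ℝ}
    (hκ : 0 ≤ κ) (hκ1 : κ ≤ 1 / 32) :
    ∫ s', (score M θ₀ θ₁ (z, s') + 2 * κ * score M θ₀ θ₁ (z, s') ^ 2) ∂(transition M θ₀ z) ≤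
      -(1 / 4 * (hellingerSq m (M.p θ₀ z.1 z.2) (M.p θ₁ z.1 z.2)).toReal) := by
  have hs : Measurable fun s' => score M θ₀ θ₁ (z, s') :=
    (measurable_score M θ₀ θ₁).comp measurable_prodMk_left
  have := integral_transition_le M θ₀ θ₀ θ₁ z (C := 1 + 2 * κ) (α := 1 / 4) (β := 0) (γ := 1 / 2)
    (hs.add ((hs.pow_const 2).const_mul (2 * κ))) (fun s' => ?_) fun s' => ?_
  · simpa using this
  · have h := abs_score_le M θ₀ θ₁ (z, s')
    have h2 : |score M θ₀ θ₁ (z, s') ^ 2| ≤ 1 := by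
      rw [abs_pow]
      exact pow_le_one₀ (abs_nonneg _) h
    refine (abs_add_le _ _).trans (add_le_add h ?_)
    rw [abs_mul, abs_of_nonneg (by positivity : 0 ≤ 2 * κ)]
    nlinarith
  · have := hellinger_algebra_null (Real.sqrt_nonneg (M.p θ₀ z.1 z.2 s'))
      (Real.sqrt_nonneg (M.p θ₁ z.1 z.2 s')) hκ1
    simp only [Real.sq_sqrt (M.nonneg _ _ _ _)] at this
    simpa [score] using this

theorem ComparableWith.integral_score_alternative_le {M : TransitionModel Θ S A m} {θ₀ : Θ}
    {c d : ℝ} (hM : ComparableWith M θ₀ c d) (θ θ₁ : Θ) (z : S × A) {κ : ℝ}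
    (hκ : 0 ≤ κ) (hκ1 : κ * d ≤ 1 / 32) :
    ∫ s', (-score M θ₀ θ₁ (z, s') + 2 * κ * (-score M θ₀ θ₁ (z, s')) ^ 2) ∂(transition M θ z) ≤
      -(1 / 8 * (hellingerSq m (M.p θ₀ z.1 z.2) (M.p θ₁ z.1 z.2)).toReal) +
        4 * d * (hellingerSq m (M.p θ z.1 z.2) (M.p θ₁ z.1 z.2)).toReal := by
  have hs : Measurable fun s' => -score M θ₀ θ₁ (z, s') :=
    ((measurable_score M θ₀ θ₁).comp measurable_prodMk_left).neg
  refine integral_transition_le M θ θ₀ θ₁ z (C := 1 + 2 * κ) (γ := -(1 / 2))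
    (hs.add ((hs.pow_const 2).const_mul (2 * κ))) (fun s' => ?_) fun s' => ?_
  · have h : |-score M θ₀ θ₁ (z, s')| ≤ 1 := by
      rw [abs_neg]
      exact abs_score_le M θ₀ θ₁ (z, s')
    have h2 : |(-score M θ₀ θ₁ (z, s')) ^ 2| ≤ 1 := by
      rw [abs_pow]
      exact pow_le_one₀ (abs_nonneg _) h
    refine (abs_add_le _ _).trans (add_le_add h ?_)
    rw [abs_mul, abs_of_nonneg (by positivity : 0 ≤ 2 * κ)]
    nlinarith
  · have := hellinger_algebra_alternative (Real.sqrt_nonneg (M.p θ₀ z.1 z.2 s'))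
      (Real.sqrt_nonneg (M.p θ₁ z.1 z.2 s')) (Real.sqrt_nonneg (M.p θ z.1 z.2 s')) hM.one_le
      (by simpa only [Real.sq_sqrt (M.nonneg _ _ _ _)] using hM.upper θ z.1 z.2 s') hκ hκ1
    simp only [Real.sq_sqrt (M.nonneg _ _ _ _)] at this
    exact this

end TestFunction

/-! ### Exponential moments of discounted sums. -/

section ExponentialMoment

variable {Θ S A : Type*} [MeasurableSpace Θ] [MeasurableSpace S] [MeasurableSpace A]
  {m : Measure S}

theorem measurable_runTerm {D : Set S} (hD : MeasurableSet D) {g : (S × A) × S → ℝ}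
    (hg : Measurable g) (t : ℕ) : Measurable (runTerm D g t) :=
  measurable_running_indicator hD t
    (hg.comp ((measurable_pi_apply t).prodMk (measurable_pi_apply (t + 1)).fst))

theorem measurable_runSum {D : Set S} (hD : MeasurableSet D) (δ : ℝ) {g : (S × A) × S → ℝ}
    (hg : Measurable g) : Measurable (runSum D δ g) := by
  unfold runSum
  exact Measurable.tsum fun t => (measurable_runTerm hD hg t).const_mul _

variable [SigmaFinite m]

theorem integral_runTerm (M : TransitionModel Θ S A m) {D : Set S} (hD : MeasurableSet D)
    (ρ : Measure S) [IsProbabilityMeasure ρ] (π : Policy S A) (θ : Θ) (t : ℕ)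
    {g : (S × A) × S → ℝ} (hg : Measurable g) {C : ℝ} (hC : ∀ q, |g q| ≤ C) :
    ∫ x, runTerm D g t x ∂(pathLaw M ρ π θ) =
      ∫ z, ∫ s', g (z, s') ∂(transition M θ z) ∂(occupancy M D ρ π θ t) := by
  have hmeas : Measurable fun x : Path S A => (x t, (x (t + 1)).1) := by fun_prop
  have hint : Integrable g (occupancy M D ρ π θ t ⊗ₘ transition M θ) :=
    Integrable.of_bound hg.aestronglyMeasurable C (ae_of_all _ hC)
  rw [← Measure.integral_compProd hint, ← map_running_pathLaw M hD ρ π θ t,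
    integral_map hmeas.aemeasurable hg.aestronglyMeasurable,
    ← integral_indicator (measurableSet_running hD t)]
  rfl

theorem integral_runTerm_le (M : TransitionModel Θ S A m) {D : Set S} (hD : MeasurableSet D)
    (ρ : Measure S) [IsProbabilityMeasure ρ] (π : Policy S A) (θ θ₀ θ₁ : Θ) (t : ℕ)
    {g : (S × A) × S → ℝ} (hg : Measurable g) {C α β : ℝ} (hC : ∀ q, |g q| ≤ C)
    (h : ∀ z, ∫ s', g (z, s') ∂(transition M θ z) ≤
      -(α * (hellingerSq m (M.p θ₀ z.1 z.2) (M.p θ₁ z.1 z.2)).toReal) +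
        β * (hellingerSq m (M.p θ z.1 z.2) (M.p θ₁ z.1 z.2)).toReal) :
    ∫ x, runTerm D g t x ∂(pathLaw M ρ π θ) ≤
      -(α * (meanHellinger M D ρ π θ θ₀ θ₁ t).toReal) +
        β * (meanHellinger M D ρ π θ θ θ₁ t).toReal := by
  have hm : ∀ θ θ' : Θ, Measurable fun z : S × A =>
      hellingerSq m (M.p θ z.1 z.2) (M.p θ' z.1 z.2) := fun θ θ' =>
    measurable_hellingerSq_comp M measurable_const measurable_const measurable_id
  have hlt : ∀ (θ θ' : Θ) (z : S × A), hellingerSq m (M.p θ z.1 z.2) (M.p θ' z.1 z.2) < ∞ :=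
    fun θ θ' z => (hellingerSq_le_two M θ θ' z).trans_lt (by simp)
  have hi : ∀ θ₁ θ₂ : Θ, Integrable (fun z : S × A =>
      (hellingerSq m (M.p θ₁ z.1 z.2) (M.p θ₂ z.1 z.2)).toReal) (occupancy M D ρ π θ t) := by
    intro θ₁ θ₂
    refine Integrable.of_bound (hm _ _).ennreal_toReal.aestronglyMeasurable 2
      (ae_of_all _ fun z => ?_)
    rw [Real.norm_of_nonneg ENNReal.toReal_nonneg]
    simpa using ENNReal.toReal_mono (by simp) (hellingerSq_le_two M θ₁ θ₂ z)
  have he : ∀ θ₁ θ₂ : Θ, ∫ z : S × A, (hellingerSq m (M.p θ₁ z.1 z.2) (M.p θ₂ z.1 z.2)).toReal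
      ∂(occupancy M D ρ π θ t) = (meanHellinger M D ρ π θ θ₁ θ₂ t).toReal := fun θ₁ θ₂ =>
    integral_toReal (hm _ _).aemeasurable (ae_of_all _ (hlt _ _))
  have hint' : Integrable (fun z => ∫ s', g (z, s') ∂(transition M θ z))
      (occupancy M D ρ π θ t) := by
    refine Integrable.of_bound
      (hg.stronglyMeasurable.integral_kernel_prod_right' (κ := transition M θ)).aestronglyMeasurable
      C (ae_of_all _ fun z => ?_)
    refine (norm_integral_le_of_norm_le_const (ae_of_all _ fun s' => hC (z, s'))).trans_eq ?_
    rw [probReal_univ, mul_one]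
  have i1 := ((hi θ₀ θ₁).const_mul α).neg
  have i2 := (hi θ θ₁).const_mul β
  rw [integral_runTerm M hD ρ π θ t hg hC]
  refine (integral_mono hint' (i1.add i2) h).trans_eq ?_
  rw [integral_add' i1 i2, integral_neg', integral_const_mul, integral_const_mul, he, he]

/-- After the quadratic bound `exp_runSum_le` the mean is linear in the terms, so each transition
can be conditioned on its own state and action. The inequality 1 + x ≤ exp x restores an exponential
that multiplies over independent episodes. -/
theorem lintegral_exp_runSum_le (M : TransitionModel Θ S A m) {D : Set S} (hD : MeasurableSet D)
    (ρ : Measure S) [IsProbabilityMeasure ρ] (π : Policy S A) (θ θ₀ θ₁ : Θ)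
    {g : (S × A) × S → ℝ} (hg : Measurable g) (hg1 : ∀ q, |g q| ≤ 1) {δ κ α β : ℝ}
    (h0 : 0 ≤ δ) (h1 : δ ≤ 1 / 2) (hκ : 0 ≤ κ) (hκ1 : κ ≤ 1 / 2)
    (h : ∀ z, ∫ s', (g (z, s') + 2 * κ * g (z, s') ^ 2) ∂(transition M θ z) ≤
      -(α * (hellingerSq m (M.p θ₀ z.1 z.2) (M.p θ₁ z.1 z.2)).toReal) +
        β * (hellingerSq m (M.p θ z.1 z.2) (M.p θ₁ z.1 z.2)).toReal) :
    ∫⁻ x, ENNReal.ofReal (Real.exp (κ * runSum D δ g x)) ∂(pathLaw M ρ π θ) ≤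
      ENNReal.ofReal (Real.exp (κ *
        (-(α * ∑' t, δ ^ t * (meanHellinger M D ρ π θ θ₀ θ₁ t).toReal) +
          β * ∑' t, δ ^ t * (meanHellinger M D ρ π θ θ θ₁ t).toReal))) := by
  have h1' : δ < 1 := by linarith
  set P := pathLaw M ρ π θ with hP
  set W : (S × A) × S → ℝ := fun q => g q + 2 * κ * g q ^ 2 with hW
  have hWm : Measurable W := hg.add ((hg.pow_const 2).const_mul _)
  have hW2 : ∀ q, |W q| ≤ 2 := fun q => by
    have h3 := abs_le.1 (hg1 q)
    have h4 : g q ^ 2 ≤ 1 := by nlinarith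
    rw [abs_le]
    constructor <;> nlinarith [sq_nonneg (g q), mul_nonneg hκ (sq_nonneg (g q))]
  have hWi : ∀ t, Integrable (runTerm D W t) P := fun t =>
    Integrable.of_bound (measurable_runTerm hD hWm t).aestronglyMeasurable 2
      (ae_of_all _ (abs_runTerm_le D hW2 t))
  have hsum_norm : Summable fun t => ∫ x, ‖δ ^ t * runTerm D W t x‖ ∂P := by
    refine Summable.of_nonneg_of_le (fun t => integral_nonneg fun x => norm_nonneg _)
      (fun t => ?_) ((summable_geometric_of_lt_one h0 h1').mul_right 2)
    have : ∀ x, ‖δ ^ t * runTerm D W t x‖ ≤ δ ^ t * 2 := fun x => by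
      rw [norm_mul, norm_pow, Real.norm_of_nonneg h0]
      exact mul_le_mul_of_nonneg_left (abs_runTerm_le D hW2 t x) (by positivity)
    calc ∫ x, ‖δ ^ t * runTerm D W t x‖ ∂P ≤ ∫ _, δ ^ t * 2 ∂P :=
          integral_mono ((hWi t).const_mul _).norm (integrable_const _) this
      _ = δ ^ t * 2 := by simp
  have hint : HasSum (fun t => δ ^ t * ∫ x, runTerm D W t x ∂P) (∫ x, runSum D δ W x ∂P) := by
    have := hasSum_integral_of_summable_integral_norm
      (fun t => (hWi t).const_mul (δ ^ t)) hsum_norm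
    simp only [integral_const_mul] at this
    exact this
  have hle : ∫ x, runSum D δ W x ∂P ≤
      -(α * ∑' t, δ ^ t * (meanHellinger M D ρ π θ θ₀ θ₁ t).toReal) +
          β * ∑' t, δ ^ t * (meanHellinger M D ρ π θ θ θ₁ t).toReal := by
    have hs := ((summable_meanHellinger M D ρ π θ θ₀ θ₁ h0 h1').hasSum.mul_left α).neg.add
      ((summable_meanHellinger M D ρ π θ θ θ₁ h0 h1').hasSum.mul_left β)
    refine hasSum_le (fun t => ?_) hint hs
    have := integral_runTerm_le M hD ρ π θ θ₀ θ₁ t hWm hW2 h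
    calc _ ≤ δ ^ t * (-(α * (meanHellinger M D ρ π θ θ₀ θ₁ t).toReal) +
          β * (meanHellinger M D ρ π θ θ θ₁ t).toReal) := by gcongr
      _ = _ := by ring
  have hRm := measurable_runSum hD δ hWm
  have hRi : Integrable (runSum D δ W) P :=
    Integrable.of_bound hRm.aestronglyMeasurable _ (ae_of_all _ (abs_runSum_le D hW2 h0 h1'))
  have hei : Integrable (fun x => Real.exp (κ * runSum D δ g x)) P := by
    refine Integrable.of_bound
      ((measurable_runSum hD δ hg).const_mul κ).exp.aestronglyMeasurable
      (Real.exp (κ * ((1 - δ)⁻¹ * 1))) (ae_of_all _ fun x => ?_)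
    rw [Real.norm_of_nonneg (Real.exp_nonneg _)]
    have := le_of_abs_le (abs_runSum_le D hg1 h0 h1' x)
    gcongr
  rw [← ofReal_integral_eq_lintegral_ofReal hei (ae_of_all _ fun x => Real.exp_nonneg _)]
  refine ENNReal.ofReal_le_ofReal ?_
  calc ∫ x, Real.exp (κ * runSum D δ g x) ∂P ≤ ∫ x, (1 + κ * runSum D δ W x) ∂P :=
        integral_mono hei ((integrable_const _).add (hRi.const_mul κ))
          (exp_runSum_le D hg1 h0 h1 hκ hκ1)
    _ = 1 + κ * ∫ x, runSum D δ W x ∂P := by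
        rw [integral_add (integrable_const _) (hRi.const_mul κ), integral_const_mul]
        simp
    _ ≤ Real.exp (κ * ∫ x, runSum D δ W x ∂P) := by
        rw [add_comm]
        exact Real.add_one_le_exp _
    _ ≤ _ := by gcongr

end ExponentialMoment

/-! ### The test and its constants. -/

section TestStatistic

variable {Θ S A : Type*} [MeasurableSpace Θ] [MeasurableSpace S] [MeasurableSpace A]
  {m : Measure S} {M : TransitionModel Θ S A m} {θ₀ : Θ} {d : ℝ}

/-- The discount factor of the test statistic. -/
noncomputable def testDiscount (d : ℝ) : ℝ := 1 / (2 * d)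

/-- The exponent at which the moment generating function of the test statistic is bounded. -/
noncomputable def testScale (d : ℝ) : ℝ := 1 / (32 * d)

/-- The exponential rate `K` of the errors of the tests. -/
noncomputable def testRate (d : ℝ) : ℝ := 1 / (512 * d)

/-- The relative radius `ξ` of the alternatives. -/
noncomputable def testRadius (d : ℝ) : ℝ := 1 / (16 * d)

/-- The test statistic of one episode. -/
noncomputable def testStat (M : TransitionModel Θ S A m) (D : Set S) (θ₀ θ₁ : Θ) (d : ℝ) :
    Path S A → ℝ :=
  runSum D (testDiscount d) (score M θ₀ θ₁)

theorem testDiscount_nonneg (hd : 1 ≤ d) : 0 ≤ testDiscount d := by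
  unfold testDiscount
  positivity

theorem testDiscount_le (hd : 1 ≤ d) : testDiscount d ≤ 1 / 2 := by
  unfold testDiscount
  rw [div_le_div_iff₀ (by positivity) two_pos]
  linarith

theorem testDiscount_mul_self (hd : 1 ≤ d) : testDiscount d * d = 1 / 2 := by
  unfold testDiscount
  field_simp

theorem testScale_nonneg (hd : 1 ≤ d) : 0 ≤ testScale d := by
  unfold testScale
  positivity

theorem testScale_mul_self (hd : 1 ≤ d) : testScale d * d = 1 / 32 := by
  unfold testScale
  field_simp

theorem testScale_le (hd : 1 ≤ d) : testScale d ≤ 1 / 32 := by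
  have h1 := testScale_mul_self hd
  have h2 := testScale_nonneg hd
  nlinarith

theorem testRate_eq (d : ℝ) : testRate d = testScale d / 16 := by
  unfold testRate testScale
  rw [div_div]
  ring_nf

/-- The rejection region of the test of `θ₀` against `θ₁` based on `N` episodes. -/
def rejection (M : TransitionModel Θ S A m) (D : Set S) (θ₀ θ₁ : Θ) (d : ℝ) (N : ℕ) :
    Set (ℕ → Path S A) :=
  {ω | 0 ≤ ∑ i ∈ Finset.range N, testStat M D θ₀ θ₁ d (ω i)}

theorem measurable_testStat (M : TransitionModel Θ S A m) {D : Set S} (hD : MeasurableSet D)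
    (θ₀ θ₁ : Θ) (d : ℝ) : Measurable (testStat M D θ₀ θ₁ d) :=
  measurable_runSum hD _ (measurable_score M θ₀ θ₁)

theorem measurableSet_rejection (M : TransitionModel Θ S A m) {D : Set S} (hD : MeasurableSet D)
    (θ₀ θ₁ : Θ) (d : ℝ) (N : ℕ) : MeasurableSet (rejection M D θ₀ θ₁ d N) :=
  measurableSet_le measurable_const (Finset.measurable_sum _ fun i _ =>
    (measurable_testStat M hD θ₀ θ₁ d).comp (measurable_pi_apply i))

theorem rejection_indicator_le (hd : 1 ≤ d) (D : Set S) (θ₁ : Θ) (N : ℕ) (ω : ℕ → Path S A) :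
    (rejection M D θ₀ θ₁ d N).indicator (fun _ => (1 : ℝ≥0∞)) ω ≤
      ∏ i ∈ Finset.range N,
        ENNReal.ofReal (Real.exp (testScale d * testStat M D θ₀ θ₁ d (ω i))) := by
  rw [← ENNReal.ofReal_prod_of_nonneg fun _ _ => Real.exp_nonneg _, ← Real.exp_sum,
    ← Finset.mul_sum]
  refine Set.indicator_apply_le' (fun h => ?_) fun _ => zero_le
  rw [← ENNReal.ofReal_one]
  exact ENNReal.ofReal_le_ofReal (Real.one_le_exp (mul_nonneg (testScale_nonneg hd) h))

theorem rejection_compl_indicator_le (hd : 1 ≤ d) (D : Set S) (θ₁ : Θ) (N : ℕ)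
    (ω : ℕ → Path S A) :
    (rejection M D θ₀ θ₁ d N)ᶜ.indicator (fun _ => (1 : ℝ≥0∞)) ω ≤
      ∏ i ∈ Finset.range N,
        ENNReal.ofReal (Real.exp (-(testScale d * testStat M D θ₀ θ₁ d (ω i)))) := by
  rw [← ENNReal.ofReal_prod_of_nonneg fun _ _ => Real.exp_nonneg _, ← Real.exp_sum,
    Finset.sum_neg_distrib, ← Finset.mul_sum]
  refine Set.indicator_apply_le' (fun h => ?_) fun _ => zero_le
  rw [← ENNReal.ofReal_one]
  refine ENNReal.ofReal_le_ofReal (Real.one_le_exp ?_)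
  have h' : ∑ i ∈ Finset.range N, testStat M D θ₀ θ₁ d (ω i) < 0 := not_le.1 h
  nlinarith [testScale_nonneg hd]

theorem ofReal_exp_neg_pow (K x : ℝ) (N : ℕ) :
    ENNReal.ofReal (Real.exp (-(K * x))) ^ N = ENNReal.ofReal (Real.exp (-(K * N * x))) := by
  rw [← ENNReal.ofReal_pow (Real.exp_nonneg _), ← Real.exp_nat_mul]
  ring_nf

theorem rejection_congr (D : Set S) (θ₁ : Θ) {N : ℕ} {ω ω' : ℕ → Path S A}
    (h : ∀ i < N, SameEpisode D (ω i) (ω' i)) :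
    ω ∈ rejection M D θ₀ θ₁ d N ↔ ω' ∈ rejection M D θ₀ θ₁ d N := by
  have hsum : ∑ i ∈ Finset.range N, testStat M D θ₀ θ₁ d (ω i) =
      ∑ i ∈ Finset.range N, testStat M D θ₀ θ₁ d (ω' i) :=
    Finset.sum_congr rfl fun i hi => runSum_congr (h i (Finset.mem_range.1 hi)) _ _
  simp only [rejection, Set.mem_ofPred_eq, hsum]

end TestStatistic

/-! ### Error probabilities over independent episodes. -/

section Testing

variable {Θ S A : Type*} [MeasurableSpace Θ] [MeasurableSpace S] [MeasurableSpace A]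
  {m : Measure S} [SigmaFinite m]

instance (M : TransitionModel Θ S A m) (ρ : Measure S) [IsProbabilityMeasure ρ] (π : Policy S A)
    (θ : Θ) : IsProbabilityMeasure (episodesLaw M ρ π θ) := by
  unfold episodesLaw
  infer_instance

theorem lintegral_episodesLaw_prod (M : TransitionModel Θ S A m) (ρ : Measure S)
    [IsProbabilityMeasure ρ] (π : Policy S A) (θ : Θ) (s : Finset ℕ)
    {f : ℕ → Path S A → ℝ≥0∞} (hf : ∀ i, Measurable (f i)) :
    ∫⁻ ω, ∏ i ∈ s, f i (ω i) ∂(episodesLaw M ρ π θ) =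
      ∏ i ∈ s, ∫⁻ x, f i x ∂(pathLaw M ρ π θ) := by
  have hind : iIndepFun (fun (i : ℕ) (ω : ℕ → Path S A) => f i (ω i)) (episodesLaw M ρ π θ) :=
    iIndepFun_infinitePi hf
  rw [lintegral_prod_eq_prod_lintegral_of_indepFun s _ hind
    fun i => (hf i).comp (measurable_pi_apply i)]
  refine Finset.prod_congr rfl fun i _ => ?_
  have h := Measure.infinitePi_map_eval (fun _ : ℕ => pathLaw M ρ π θ) i
  rw [← h, lintegral_map (hf i) (measurable_pi_apply i)]
  rfl

/-- The semi-distance with discount factor `δ`. -/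
noncomputable abbrev discountedDist (M : TransitionModel Θ S A m) (D : Set S) (ρ : Measure S)
    (π : Policy S A) (θ₀ : Θ) (lam : Measure (S × A)) (δ : ℝ) : Θ → Θ → ℝ :=
  semiDist M lam (discountedDensity M D ρ π θ₀ lam δ)

variable {M : TransitionModel Θ S A m} {θ₀ : Θ} {c d : ℝ}

/-- Under θ₀ the bound holds with discount δ. Passing to δc ≤ δ weakens it, so that both errors are
governed by the same semi-distance. -/
theorem ComparableWith.lintegral_exp_testStat_null_le (hM : ComparableWith M θ₀ c d) {D : Set S}
    (hD : MeasurableSet D) (ρ : Measure S) [IsProbabilityMeasure ρ] (π : Policy S A)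
    (lam : Measure (S × A)) [IsFiniteMeasure lam] (hlam : ∀ t, occupancy M D ρ π θ₀ t ≪ lam)
    (θ₁ : Θ) :
    ∫⁻ x, ENNReal.ofReal (Real.exp (testScale d * testStat M D θ₀ θ₁ d x)) ∂(pathLaw M ρ π θ₀) ≤
      ENNReal.ofReal (Real.exp (-(testRate d *
        discountedDist M D ρ π θ₀ lam (testDiscount d * c) θ₀ θ₁ ^ 2))) := by
  have hd := hM.one_le
  have hδ0 := testDiscount_nonneg hd
  have hδ1 := testDiscount_le hd
  have hκ0 := testScale_nonneg hd
  have hκ1 := testScale_le hd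
  have hδc : 0 ≤ testDiscount d * c := mul_nonneg hδ0 hM.pos.le
  refine (lintegral_exp_runSum_le M hD ρ π θ₀ θ₀ θ₁ (measurable_score M θ₀ θ₁)
    (abs_score_le M θ₀ θ₁) (α := 1 / 4) (β := 0) hδ0 hδ1 hκ0 (by linarith) fun z => ?_).trans ?_
  · simpa using integral_score_null_le M θ₀ θ₁ z hκ0 hκ1
  · refine ENNReal.ofReal_le_ofReal (Real.exp_le_exp.2 ?_)
    rw [semiDist_sq M D ρ π θ₀ lam hlam hδc, testRate_eq]
    have hle : ∑' t, (testDiscount d * c) ^ t * (meanHellinger M D ρ π θ₀ θ₀ θ₁ t).toReal ≤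
        ∑' t, testDiscount d ^ t * (meanHellinger M D ρ π θ₀ θ₀ θ₁ t).toReal := by
      have hcd : testDiscount d * c ≤ testDiscount d := mul_le_of_le_one_right hδ0 hM.le_one
      refine Summable.tsum_le_tsum (fun t => ?_)
        (summable_meanHellinger M D ρ π θ₀ θ₀ θ₁ hδc (by linarith))
        (summable_meanHellinger M D ρ π θ₀ θ₀ θ₁ hδ0 (by linarith))
      gcongr
    have hnn : 0 ≤ ∑' t, testDiscount d ^ t * (meanHellinger M D ρ π θ₀ θ₀ θ₁ t).toReal :=
      tsum_nonneg fun t => by positivity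
    nlinarith [mul_le_mul_of_nonneg_left hle hκ0, mul_nonneg hκ0 hnn]

/-- The means are taken under θ while the semi-distances use θ₀; the factors c^t and d^t of the
occupancies bridge the gap. The radius is 2ξ instead of ξ to leave room for recentring covering
balls in `exists_shell_test`. -/
theorem ComparableWith.lintegral_exp_testStat_alternative_le (hM : ComparableWith M θ₀ c d)
    {D : Set S} (hD : MeasurableSet D) (ρ : Measure S) [IsProbabilityMeasure ρ] (π : Policy S A)
    (lam : Measure (S × A)) [IsFiniteMeasure lam] (hlam : ∀ t, occupancy M D ρ π θ₀ t ≪ lam)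
    (θ θ₁ : Θ) (hθ : discountedDist M D ρ π θ₀ lam (testDiscount d * d) θ θ₁ ≤
      2 * testRadius d * discountedDist M D ρ π θ₀ lam (testDiscount d * c) θ₀ θ₁) :
    ∫⁻ x, ENNReal.ofReal (Real.exp (-(testScale d * testStat M D θ₀ θ₁ d x)))
        ∂(pathLaw M ρ π θ) ≤
      ENNReal.ofReal (Real.exp (-(testRate d *
        discountedDist M D ρ π θ₀ lam (testDiscount d * c) θ₀ θ₁ ^ 2))) := by
  have hd := hM.one_le
  have hδ0 := testDiscount_nonneg hd
  have hδ1 := testDiscount_le hd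
  have hκ0 := testScale_nonneg hd
  have hκ1 := testScale_le hd
  have hδc : 0 ≤ testDiscount d * c := mul_nonneg hδ0 hM.pos.le
  have hδd := testDiscount_mul_self hd
  have hneg : ∀ x, -(testScale d * testStat M D θ₀ θ₁ d x) =
      testScale d * runSum D (testDiscount d) (fun q => -score M θ₀ θ₁ q) x := fun x => by
    rw [runSum_neg, testStat]
    ring
  simp only [hneg]
  refine (lintegral_exp_runSum_le M hD ρ π θ θ₀ θ₁ (measurable_score M θ₀ θ₁).neg
    (fun q => (abs_neg _).trans_le (abs_score_le M θ₀ θ₁ q)) (α := 1 / 8) (β := 4 * d)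
    hδ0 hδ1 hκ0 (by linarith)
    fun z => hM.integral_score_alternative_le θ θ₁ z hκ0 (testScale_mul_self hd).le).trans ?_
  refine ENNReal.ofReal_le_ofReal (Real.exp_le_exp.2 ?_)
  have hh : ∀ θ θ' : Θ, Measurable fun z : S × A =>
      hellingerSq m (M.p θ z.1 z.2) (M.p θ' z.1 z.2) := fun θ θ' =>
    measurable_hellingerSq_comp M measurable_const measurable_const measurable_id
  set x := discountedDist M D ρ π θ₀ lam (testDiscount d * c) θ₀ θ₁ with hx
  set y := discountedDist M D ρ π θ₀ lam (testDiscount d * d) θ θ₁ with hy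
  have h1 : x ^ 2 ≤ ∑' t, testDiscount d ^ t * (meanHellinger M D ρ π θ θ₀ θ₁ t).toReal := by
    rw [hx, semiDist_sq M D ρ π θ₀ lam hlam hδc]
    refine Summable.tsum_le_tsum (fun t => ?_)
      (summable_meanHellinger M D ρ π θ₀ θ₀ θ₁ hδc ?_)
      (summable_meanHellinger M D ρ π θ θ₀ θ₁ hδ0 (by linarith))
    · have h := ENNReal.toReal_mono (meanHellinger_ne_top M D ρ π θ θ₀ θ₁ t)
        (hM.le_lintegral_occupancy hD ρ π θ t (hh θ₀ θ₁))
      rw [ENNReal.toReal_mul, ENNReal.toReal_ofReal (pow_nonneg hM.pos.le t)] at h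
      rw [mul_pow, mul_assoc]
      exact mul_le_mul_of_nonneg_left h (by positivity)
    · nlinarith [hM.le_one, hM.pos]
  have h2 : ∑' t, testDiscount d ^ t * (meanHellinger M D ρ π θ θ θ₁ t).toReal ≤ y ^ 2 := by
    rw [hy, semiDist_sq M D ρ π θ₀ lam hlam (by rw [hδd]; norm_num)]
    refine Summable.tsum_le_tsum (fun t => ?_)
      (summable_meanHellinger M D ρ π θ θ θ₁ hδ0 (by linarith))
      (summable_meanHellinger M D ρ π θ₀ θ θ₁ (by rw [hδd]; norm_num) (by rw [hδd]; norm_num))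
    · have h := ENNReal.toReal_mono
        (ENNReal.mul_ne_top ENNReal.ofReal_ne_top (meanHellinger_ne_top M D ρ π θ₀ θ θ₁ t))
        (hM.lintegral_occupancy_le hD ρ π θ t (hh θ θ₁))
      rw [ENNReal.toReal_mul, ENNReal.toReal_ofReal (by positivity)] at h
      rw [mul_pow, mul_assoc]
      exact mul_le_mul_of_nonneg_left h (by positivity)
  have hy0 : 0 ≤ y := semiDist_nonneg _ _ _ _ _
  have hx0 : 0 ≤ x := semiDist_nonneg _ _ _ _ _
  -- Since 4d(2ξ)² = 1/(16d) ≤ 1/16, the error uses at most half of the gain 1/8. The remaining 1/16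
  -- times κ is the rate K.
  have h3 : 4 * d * y ^ 2 ≤ 1 / 16 * x ^ 2 := by
    have h4 : y ^ 2 ≤ (2 * testRadius d * x) ^ 2 := pow_le_pow_left₀ hy0 hθ 2
    have h5 : 4 * d * (2 * testRadius d * x) ^ 2 = 1 / (16 * d) * x ^ 2 := by
      unfold testRadius
      field_simp
      norm_num
    have h6 : 1 / (16 * d) ≤ 1 / 16 := by
      rw [div_le_div_iff₀ (by positivity) (by norm_num)]
      linarith
    calc 4 * d * y ^ 2 ≤ 4 * d * (2 * testRadius d * x) ^ 2 := by gcongr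
      _ ≤ _ := by
        rw [h5]
        gcongr
  rw [testRate_eq]
  have h7 : -(1 / 8 * ∑' t, testDiscount d ^ t * (meanHellinger M D ρ π θ θ₀ θ₁ t).toReal) +
      4 * d * ∑' t, testDiscount d ^ t * (meanHellinger M D ρ π θ θ θ₁ t).toReal ≤
      -(1 / 16 * x ^ 2) := by
    have := mul_le_mul_of_nonneg_left h2 (by positivity : 0 ≤ 4 * d)
    linarith
  calc _ ≤ testScale d * -(1 / 16 * x ^ 2) := mul_le_mul_of_nonneg_left h7 hκ0
    _ = _ := by ring

theorem ComparableWith.rejection_null_le (hM : ComparableWith M θ₀ c d) {D : Set S}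
    (hD : MeasurableSet D) (ρ : Measure S) [IsProbabilityMeasure ρ] (π : Policy S A)
    (lam : Measure (S × A)) [IsFiniteMeasure lam] (hlam : ∀ t, occupancy M D ρ π θ₀ t ≪ lam)
    (θ₁ : Θ) (N : ℕ) :
    episodesLaw M ρ π θ₀ (rejection M D θ₀ θ₁ d N) ≤
      ENNReal.ofReal (Real.exp (-(testRate d * N *
        discountedDist M D ρ π θ₀ lam (testDiscount d * c) θ₀ θ₁ ^ 2))) := by
  rw [← lintegral_indicator_one (measurableSet_rejection M hD θ₀ θ₁ d N)]
  refine (lintegral_mono (rejection_indicator_le hM.one_le D θ₁ N)).trans ?_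
  rw [lintegral_episodesLaw_prod M ρ π θ₀ _ (f := fun _ x =>
    ENNReal.ofReal (Real.exp (testScale d * testStat M D θ₀ θ₁ d x))) fun _ =>
    ((measurable_testStat M hD θ₀ θ₁ d).const_mul _).exp.ennreal_ofReal, Finset.prod_const,
    Finset.card_range, ← ofReal_exp_neg_pow]
  exact pow_le_pow_left' (hM.lintegral_exp_testStat_null_le hD ρ π lam hlam θ₁) N

theorem ComparableWith.rejection_compl_le (hM : ComparableWith M θ₀ c d) {D : Set S}
    (hD : MeasurableSet D) (ρ : Measure S) [IsProbabilityMeasure ρ] (π : Policy S A)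
    (lam : Measure (S × A)) [IsFiniteMeasure lam] (hlam : ∀ t, occupancy M D ρ π θ₀ t ≪ lam)
    (θ θ₁ : Θ) (hθ : discountedDist M D ρ π θ₀ lam (testDiscount d * d) θ θ₁ ≤
      2 * testRadius d * discountedDist M D ρ π θ₀ lam (testDiscount d * c) θ₀ θ₁) (N : ℕ) :
    episodesLaw M ρ π θ (rejection M D θ₀ θ₁ d N)ᶜ ≤
      ENNReal.ofReal (Real.exp (-(testRate d * N *
        discountedDist M D ρ π θ₀ lam (testDiscount d * c) θ₀ θ₁ ^ 2))) := by
  rw [← lintegral_indicator_one (measurableSet_rejection M hD θ₀ θ₁ d N).compl]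
  refine (lintegral_mono (rejection_compl_indicator_le hM.one_le D θ₁ N)).trans ?_
  rw [lintegral_episodesLaw_prod M ρ π θ _ (f := fun _ x =>
    ENNReal.ofReal (Real.exp (-(testScale d * testStat M D θ₀ θ₁ d x)))) fun _ =>
    ((measurable_testStat M hD θ₀ θ₁ d).const_mul _).neg.exp.ennreal_ofReal, Finset.prod_const,
    Finset.card_range, ← ofReal_exp_neg_pow]
  exact pow_le_pow_left' (hM.lintegral_exp_testStat_alternative_le hD ρ π lam hlam θ θ₁ hθ) N

/-- Existence of exponentially powerful tests. -/
theorem ComparableWith.exists_test (hM : ComparableWith M θ₀ c d) {D : Set S}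
    (hD : MeasurableSet D) (ρ : Measure S) [IsProbabilityMeasure ρ] (π : Policy S A)
    (lam : Measure (S × A)) [IsFiniteMeasure lam] (hlam : ∀ t, occupancy M D ρ π θ₀ t ≪ lam)
    (N : ℕ) (θ₁ : Θ) : ∃ φ : (ℕ → Path S A) → ℝ,
      Measurable φ ∧ (∀ ω, 0 ≤ φ ω ∧ φ ω ≤ 1) ∧
      (∀ ω ω', (∀ i < N, SameEpisode D (ω i) (ω' i)) → φ ω = φ ω') ∧
      ∫ ω, φ ω ∂(episodesLaw M ρ π θ₀) ≤ Real.exp (-(testRate d * N *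
        discountedDist M D ρ π θ₀ lam (testDiscount d * c) θ₀ θ₁ ^ 2)) ∧
      ∀ θ, discountedDist M D ρ π θ₀ lam (testDiscount d * d) θ θ₁ ≤
          testRadius d * discountedDist M D ρ π θ₀ lam (testDiscount d * c) θ₀ θ₁ →
        ∫ ω, (1 - φ ω) ∂(episodesLaw M ρ π θ) ≤ Real.exp (-(testRate d * N *
          discountedDist M D ρ π θ₀ lam (testDiscount d * c) θ₀ θ₁ ^ 2)) := by
  have hmeas := measurableSet_rejection M hD θ₀ θ₁ d N
  refine ⟨(rejection M D θ₀ θ₁ d N).indicator fun _ => 1, measurable_const.indicator hmeas,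
    fun ω => ⟨Set.indicator_nonneg (fun _ _ => zero_le_one) ω,
      Set.indicator_le_self' (fun _ _ => zero_le_one) ω⟩, fun ω ω' h => ?_, ?_, fun θ hθ => ?_⟩
  · have := rejection_congr (M := M) (θ₀ := θ₀) (d := d) D θ₁ h
    by_cases hω : ω ∈ rejection M D θ₀ θ₁ d N
    · rw [Set.indicator_of_mem hω, Set.indicator_of_mem (this.1 hω)]
    · rw [Set.indicator_of_notMem hω, Set.indicator_of_notMem fun h' => hω (this.2 h')]
  · rw [integral_indicator_const _ hmeas, smul_eq_mul, mul_one]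
    exact ENNReal.toReal_le_of_le_ofReal (Real.exp_nonneg _)
      (hM.rejection_null_le hD ρ π lam hlam θ₁ N)
  · have hc : ∀ ω, 1 - (rejection M D θ₀ θ₁ d N).indicator (fun _ => (1 : ℝ)) ω =
        (rejection M D θ₀ θ₁ d N)ᶜ.indicator (fun _ => (1 : ℝ)) ω := fun ω => by
      by_cases hω : ω ∈ rejection M D θ₀ θ₁ d N <;> simp [hω]
    simp only [hc]
    rw [integral_indicator_const _ hmeas.compl, smul_eq_mul, mul_one]
    refine ENNReal.toReal_le_of_le_ofReal (Real.exp_nonneg _)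
      (hM.rejection_compl_le hD ρ π lam hlam θ θ₁ (hθ.trans ?_) N)
    have hr : 0 ≤ testRadius d := by
      have := hM.one_le
      unfold testRadius
      positivity
    nlinarith [mul_nonneg hr (semiDist_nonneg M lam
      (discountedDensity M D ρ π θ₀ lam (testDiscount d * c)) θ₀ θ₁)]

end Testing

/-! ### The terminal time and functions of the observed episode. -/

section TerminalTime

variable {S A : Type*}

/-- The set of trajectories whose episode ends at time `j`. -/
def endsAt (D : Set S) (j : ℕ) : Set (Path S A) := {x | (x j).1 ∈ D ∧ ∀ i < j, (x i).1 ∉ D}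

theorem terminalTime_eq_of_mem_endsAt {D : Set S} {j : ℕ} {x : Path S A} (h : x ∈ endsAt D j) :
    terminalTime D x = j := by
  refine le_antisymm (Nat.sInf_le h.1) ?_
  by_contra hlt
  exact h.2 _ (not_le.1 hlt) (Nat.sInf_mem (s := {t | (x t).1 ∈ D}) ⟨j, h.1⟩)

theorem Terminates.mem_endsAt {D : Set S} {x : Path S A} (h : Terminates D x) :
    x ∈ endsAt D (terminalTime D x) :=
  ⟨Nat.sInf_mem (s := {t | (x t).1 ∈ D}) h, fun _ hi => Nat.notMem_of_lt_sInf hi⟩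

theorem Terminates.running_iff {D : Set S} {x : Path S A} (h : Terminates D x) (t : ℕ) :
    Running D x t ↔ t < terminalTime D x := by
  have hm := h.mem_endsAt
  refine ⟨fun hr => ?_, fun ht i hi => hm.2 i (hi.trans_lt ht)⟩
  by_contra hle
  exact hr _ (not_lt.1 hle) hm.1

theorem mem_endsAt_congr {D : Set S} {j : ℕ} {x y : Path S A} (hxy : ∀ i ≤ j, x i = y i) :
    x ∈ endsAt D j ↔ y ∈ endsAt D j := by
  simp only [endsAt, Set.mem_ofPred_eq]
  rw [hxy j le_rfl]
  refine and_congr_right fun _ => forall₂_congr fun i hi => ?_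
  rw [hxy i hi.le]

theorem sameEpisode_of_mem_endsAt {D : Set S} {j : ℕ} {x y : Path S A} (h : x ∈ endsAt D j)
    (hxy : ∀ i ≤ j, x i = y i) : SameEpisode D x y := by
  constructor
  · intro t ht
    rw [hxy t]
    by_contra hlt
    exact ht j (not_le.1 hlt) h.1
  · intro t ht
    rw [hxy t]
    by_contra hlt
    exact ht j (not_le.1 hlt).le h.1

/-- A product over the transitions of the first `r` steps of an episode. -/
noncomputable def runProd (D : Set S) (u : (S × A) × S → ℝ≥0∞) (r : ℕ) (x : Path S A) : ℝ≥0∞ :=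
  by
    classical
    exact ∏ t ∈ Finset.range r, if Running D x t then u (x t, (x (t + 1)).1) else 1

theorem runProd_congr {D : Set S} {x y : Path S A} (h : SameEpisode D x y)
    (u : (S × A) × S → ℝ≥0∞) (r : ℕ) : runProd D u r x = runProd D u r y := by
  classical
  refine Finset.prod_congr rfl fun t _ => ?_
  by_cases hx : Running D x t
  · have hy := (h.running_iff t).1 hx
    rw [if_pos hx, if_pos hy, h.1 (t + 1) fun i hi => hx i (Nat.lt_succ_iff.1 hi),
      Prod.ext (h.1 t fun i hi => hx i hi.le) (h.2 t hx)]
  · have hy := fun hy => hx ((h.running_iff t).2 hy)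
    rw [if_neg hx, if_neg hy]

theorem dependsOn_runProd (D : Set S) (u : (S × A) × S → ℝ≥0∞) (r : ℕ) :
    DependsOn (runProd D u r) (Set.Iic r) := by
  classical
  intro x y hxy
  refine Finset.prod_congr rfl fun t ht => ?_
  have ht' := Finset.mem_range.1 ht
  have h1 : Running D x t = Running D y t :=
    dependsOn_running (A := A) D t fun i hi => hxy i (le_trans hi ht'.le)
  simp only [h1, hxy t ht'.le, hxy (t + 1) ht']

/-- `runProd` checks step by step whether the episode is running and never consults `terminalTime`,
so it depends on finitely many coordinates even on paths that never terminate. On the others it is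
the product up to the stopped time. -/
theorem Terminates.runProd_eq {D : Set S} {x : Path S A} (h : Terminates D x)
    (u : (S × A) × S → ℝ≥0∞) (r : ℕ) :
    runProd D u r x =
      ∏ t ∈ Finset.range (min r (terminalTime D x)), u (x t, (x (t + 1)).1) := by
  classical
  unfold runProd
  rw [← Finset.prod_filter]
  refine Finset.prod_congr ?_ fun _ _ => rfl
  ext t
  simp [h.running_iff]

variable [MeasurableSpace S] [MeasurableSpace A]

theorem measurableSet_endsAt {D : Set S} (hD : MeasurableSet D) (j : ℕ) :
    MeasurableSet (endsAt (A := A) D j) := by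
  have : endsAt (A := A) D j = (fun x => (x j).1) ⁻¹' D ∩
      ⋂ i ∈ Set.Iio j, (fun x => (x i).1) ⁻¹' Dᶜ := by
    ext x
    simp [endsAt]
  rw [this]
  exact ((measurable_pi_apply j).fst hD).inter (MeasurableSet.biInter (Set.to_countable _)
    fun i _ => (measurable_pi_apply i).fst hD.compl)

theorem measurable_terminalTime {D : Set S} (hD : MeasurableSet D) :
    Measurable (terminalTime (A := A) D) := by
  refine measurable_to_countable' fun j => ?_
  have hnt : MeasurableSet {x : Path S A | ¬ Terminates D x} := by
    have : {x : Path S A | ¬ Terminates D x} = ⋂ i : ℕ, (fun x => (x i).1) ⁻¹' Dᶜ := by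
      ext x
      simp [Terminates]
    rw [this]
    exact MeasurableSet.iInter fun i => (measurable_pi_apply i).fst hD.compl
  -- Paths that never terminate have terminal time 0, as the infimum of the empty set, and hence all
  -- lie over j = 0.
  have : terminalTime (A := A) D ⁻¹' {j} =
      endsAt D j ∪ ({x : Path S A | ¬ Terminates D x} ∩ {_x | j = 0}) := by
    ext x
    by_cases hx : Terminates D x
    · simp only [Set.mem_preimage, Set.mem_singleton_iff, Set.mem_union, Set.mem_inter_iff,
        Set.mem_ofPred_eq, hx, not_true_eq_false, false_and, or_false]
      exact ⟨fun h => h ▸ hx.mem_endsAt, terminalTime_eq_of_mem_endsAt⟩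
    · have h1 : x ∉ endsAt D j := fun h => hx ⟨j, h.1⟩
      have h2 : terminalTime D x = 0 := by
        have : {t | (x t).1 ∈ D} = ∅ := Set.eq_empty_of_forall_notMem fun t ht => hx ⟨t, ht⟩
        rw [terminalTime, this, Nat.sInf_empty]
      simp only [Set.mem_preimage, Set.mem_singleton_iff, Set.mem_union, Set.mem_inter_iff,
        Set.mem_ofPred_eq, hx, not_false_eq_true, true_and, h1, false_or, h2]
      exact eq_comm
  rw [this]
  exact (measurableSet_endsAt hD j).union (hnt.inter (MeasurableSet.const _))

end TerminalTime

/-! ### Likelihood ratios of stopped and complete episodes. -/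

section StoppedRatio

variable {Θ S A : Type*} [MeasurableSpace Θ] [MeasurableSpace S] [MeasurableSpace A]
  {m : Measure S}

theorem measurable_runProd {D : Set S} (hD : MeasurableSet D) {u : (S × A) × S → ℝ≥0∞}
    (hu : Measurable u) (r : ℕ) : Measurable (runProd D u r) := by
  classical
  refine Finset.measurable_prod _ fun t _ => Measurable.ite (measurableSet_running hD t)
    (hu.comp ((measurable_pi_apply t).prodMk (measurable_pi_apply (t + 1)).fst)) measurable_const

/-- The likelihood ratio of the first `r` steps of an episode. -/
noncomputable def stoppedLR (M : TransitionModel Θ S A m) (D : Set S) (θ₀ θ : Θ) (r : ℕ)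
    (x : Path S A) : ℝ :=
  pathLR M θ₀ θ (min r (terminalTime D x)) x

/-- The likelihood ratio of an episode. -/
noncomputable def episodeLR (M : TransitionModel Θ S A m) (D : Set S) (θ₀ θ : Θ)
    (x : Path S A) : ℝ :=
  pathLR M θ₀ θ (terminalTime D x) x

theorem measurable_pathLR_time (M : TransitionModel Θ S A m) (θ₀ : Θ) {X : Type*}
    [MeasurableSpace X] {f : X → Θ} {g : X → Path S A} {τ : X → ℕ} (hf : Measurable f)
    (hg : Measurable g) (hτ : Measurable τ) :
    Measurable (fun x => pathLR M θ₀ (f x) (τ x) (g x)) := by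
  have h : Measurable fun p : X × ℕ => pathLR M θ₀ (f p.1) p.2 (g p.1) :=
    measurable_from_prod_countable_left fun n => measurable_pathLR_comp M θ₀ n hf hg
  exact h.comp (measurable_id.prodMk hτ)

theorem measurable_stoppedLR_comp (M : TransitionModel Θ S A m) {D : Set S} (hD : MeasurableSet D)
    (θ₀ : Θ) (r : ℕ) {X : Type*} [MeasurableSpace X] {f : X → Θ} {g : X → Path S A}
    (hf : Measurable f) (hg : Measurable g) :
    Measurable (fun x => stoppedLR M D θ₀ (f x) r (g x)) :=
  measurable_pathLR_time M θ₀ hf hg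
    (measurable_const.min ((measurable_terminalTime hD).comp hg))

theorem measurable_episodeLR_comp (M : TransitionModel Θ S A m) {D : Set S} (hD : MeasurableSet D)
    (θ₀ : Θ) {X : Type*} [MeasurableSpace X] {f : X → Θ} {g : X → Path S A}
    (hf : Measurable f) (hg : Measurable g) :
    Measurable (fun x => episodeLR M D θ₀ (f x) (g x)) :=
  measurable_pathLR_time M θ₀ hf hg ((measurable_terminalTime hD).comp hg)

variable {M : TransitionModel Θ S A m} {θ₀ : Θ} {c d : ℝ}

theorem ComparableWith.stoppedLR_pos (hM : ComparableWith M θ₀ c d) (D : Set S) (θ : Θ) (r : ℕ)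
    (x : Path S A) : 0 < stoppedLR M D θ₀ θ r x := hM.pathLR_pos _ _ _

theorem ComparableWith.episodeLR_pos (hM : ComparableWith M θ₀ c d) (D : Set S) (θ : Θ)
    (x : Path S A) : 0 < episodeLR M D θ₀ θ x := hM.pathLR_pos _ _ _

theorem ComparableWith.runProd_lr_eq (hM : ComparableWith M θ₀ c d) (θ : Θ) {D : Set S}
    {x : Path S A} (h : Terminates D x) (r : ℕ) :
    runProd D (fun q => ENNReal.ofReal (lr M θ₀ θ q.1 q.2)) r x =
      ENNReal.ofReal (stoppedLR M D θ₀ θ r x) := by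
  rw [h.runProd_eq, stoppedLR, pathLR,
    ENNReal.ofReal_prod_of_nonneg fun _ _ => (hM.lr_pos _ _ _).le]

theorem ComparableWith.runProd_lr_inv_eq (hM : ComparableWith M θ₀ c d) (θ : Θ) {D : Set S}
    {x : Path S A} (h : Terminates D x) (r : ℕ) :
    runProd D (fun q => (ENNReal.ofReal (lr M θ₀ θ q.1 q.2))⁻¹) r x =
      ENNReal.ofReal (stoppedLR M D θ₀ θ r x)⁻¹ := by
  rw [h.runProd_eq, stoppedLR, pathLR, ← Finset.prod_inv_distrib,
    ENNReal.ofReal_prod_of_nonneg fun _ _ => (inv_pos.2 (hM.lr_pos _ _ _)).le]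
  exact Finset.prod_congr rfl fun t _ => (ENNReal.ofReal_inv_of_pos (hM.lr_pos _ _ _)).symm

theorem ComparableWith.logRatio_eq (hM : ComparableWith M θ₀ c d) (D : Set S) (θ : Θ)
    (x : Path S A) : logRatio M D θ₀ θ x = -Real.log (episodeLR M D θ₀ θ x) := by
  rw [logRatio, episodeLR, pathLR, Real.log_prod fun _ _ => (hM.lr_pos _ _ _).ne',
    ← Finset.sum_neg_distrib]
  exact Finset.sum_congr rfl fun t _ => hM.log_div θ _ _

end StoppedRatio

section StoppedRatioMean

variable {Θ S A : Type*} [MeasurableSpace Θ] [MeasurableSpace S] [MeasurableSpace A]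
  {m : Measure S}

variable [SigmaFinite m]

/-- A product of conditionally normalised factors has mean one. -/
theorem lintegral_runProd (M : TransitionModel Θ S A m) {D : Set S} (hD : MeasurableSet D)
    (ρ : Measure S) [IsProbabilityMeasure ρ] (π : Policy S A) (θ : Θ)
    {u : (S × A) × S → ℝ≥0∞} (hu : Measurable u)
    (h1 : ∀ z, ∫⁻ s', u (z, s') ∂(transition M θ z) = 1) (r : ℕ) :
    ∫⁻ x, runProd D u r x ∂(pathLaw M ρ π θ) = 1 := by
  classical
  induction r with
  | zero => simp [runProd]
  | succ r ih =>
    have hR := measurableSet_running (A := A) hD r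
    have hm := measurable_runProd hD hu r
    set G := {x : Path S A | Running D x r}.indicator (runProd D u r) with hG
    set G' := {x : Path S A | Running D x r}ᶜ.indicator (runProd D u r) with hG'
    -- Martingale step: on the running event the new factor has conditional mean one, and off it the
    -- product is frozen.
    have hsplit : ∀ x, runProd D u (r + 1) x = G x * u (x r, (x (r + 1)).1) + G' x := by
      intro x
      have : runProd D u (r + 1) x =
          runProd D u r x * if Running D x r then u (x r, (x (r + 1)).1) else 1 :=
        Finset.prod_range_succ _ _
      by_cases hx : Running D x r
      · rw [this, hG, hG', Set.indicator_of_mem (by exact hx), if_pos hx,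
          Set.indicator_of_notMem (by simpa using hx), add_zero]
      · rw [this, hG, hG', Set.indicator_of_notMem (by exact hx), if_neg hx,
          Set.indicator_of_mem (by exact hx), zero_mul, zero_add, mul_one]
    have hGG : ∀ x, G x + G' x = runProd D u r x := fun x =>
      Set.indicator_self_add_compl_apply _ _ _
    have hGm : Measurable G := measurable_running_indicator hD r hm
    have hG'm : Measurable G' := hm.indicator hR.compl
    simp only [hsplit]
    rw [lintegral_add_right _ hG'm, lintegral_pathLaw_transition M ρ π θ r hGm
      (dependsOn_running_indicator D r (dependsOn_runProd D u r)) hu]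
    simp only [h1, mul_one]
    rw [← lintegral_add_right _ hG'm, lintegral_congr hGG, ih]

theorem lintegral_transition (M : TransitionModel Θ S A m) (θ : Θ) (z : S × A) {f : S → ℝ≥0∞}
    (hf : Measurable f) :
    ∫⁻ s', f s' ∂(transition M θ z) = ∫⁻ s', ENNReal.ofReal (M.p θ z.1 z.2 s') * f s' ∂m := by
  rw [transition_apply, lintegral_withDensity_eq_lintegral_mul _
    (measurable_p_section M θ z).ennreal_ofReal hf]
  rfl

variable {M : TransitionModel Θ S A m} {θ₀ : Θ} {c d : ℝ}

theorem ComparableWith.lintegral_lr (hM : ComparableWith M θ₀ c d) (θ : Θ) (z : S × A) :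
    ∫⁻ s', ENNReal.ofReal (lr M θ₀ θ z s') ∂(transition M θ₀ z) = 1 := by
  have hm : Measurable fun s' => lr M θ₀ θ z s' :=
    measurable_lr_comp M θ₀ measurable_const measurable_const measurable_id
  rw [lintegral_transition M θ₀ z hm.ennreal_ofReal, ← M.lintegral_eq_one θ z.1 z.2]
  refine lintegral_congr fun s' => ?_
  rw [← ENNReal.ofReal_mul (M.nonneg _ _ _ _)]
  exact congrArg _ (hM.mul_lr θ z s')

theorem ComparableWith.lintegral_lr_inv (hM : ComparableWith M θ₀ c d) (θ : Θ) (z : S × A) :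
    ∫⁻ s', (ENNReal.ofReal (lr M θ₀ θ z s'))⁻¹ ∂(transition M θ z) = 1 := by
  have hm : Measurable fun s' => lr M θ₀ θ z s' :=
    measurable_lr_comp M θ₀ measurable_const measurable_const measurable_id
  have hm' : Measurable fun s' => (ENNReal.ofReal (lr M θ₀ θ z s'))⁻¹ := hm.ennreal_ofReal.inv
  rw [lintegral_transition M θ z hm', ← M.lintegral_eq_one θ₀ z.1 z.2]
  refine lintegral_congr fun s' => ?_
  rw [← ENNReal.ofReal_inv_of_pos (hM.lr_pos θ z s'), ← ENNReal.ofReal_mul (M.nonneg _ _ _ _)]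
  exact congrArg _ (hM.mul_lr_swap θ z s')

theorem ComparableWith.lintegral_stoppedLR (hM : ComparableWith M θ₀ c d) {D : Set S}
    (hD : MeasurableSet D) (ρ : Measure S) [IsProbabilityMeasure ρ] (π : Policy S A)
    (hT : ∀ᵐ x ∂(pathLaw M ρ π θ₀), Terminates D x) (θ : Θ) (r : ℕ) :
    ∫⁻ x, ENNReal.ofReal (stoppedLR M D θ₀ θ r x) ∂(pathLaw M ρ π θ₀) = 1 := by
  rw [← lintegral_runProd M hD ρ π θ₀ (measurable_lr_comp M θ₀ measurable_const measurable_fst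
    measurable_snd).ennreal_ofReal (hM.lintegral_lr θ) r]
  refine lintegral_congr_ae ?_
  filter_upwards [hT] with x hx
  exact (hM.runProd_lr_eq θ hx r).symm

/-- Change of measure for functions of a complete episode. -/
theorem ComparableWith.lintegral_mul_episodeLR_le (hM : ComparableWith M θ₀ c d) {D : Set S}
    (hD : MeasurableSet D) (ρ : Measure S) [IsProbabilityMeasure ρ] (π : Policy S A)
    (hT : ∀ᵐ x ∂(pathLaw M ρ π θ₀), Terminates D x) (θ : Θ) {F : Path S A → ℝ≥0∞}
    (hF : Measurable F) (hinv : ∀ x y, SameEpisode D x y → F x = F y) :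
    ∫⁻ x, F x * ENNReal.ofReal (episodeLR M D θ₀ θ x) ∂(pathLaw M ρ π θ₀) ≤
      ∫⁻ x, F x ∂(pathLaw M ρ π θ) := by
  -- Splitting by the value j of the terminal time makes each piece a function of the coordinates up
  -- to j, where the finite change of measure applies.
  set G : ℕ → Path S A → ℝ≥0∞ := fun j => (endsAt D j).indicator F with hG
  have hGm : ∀ j, Measurable (G j) := fun j => hF.indicator (measurableSet_endsAt hD j)
  have hdep : ∀ j, DependsOn (G j) (Set.Iic j) := by
    intro j x y hxy
    have h := mem_endsAt_congr (D := D) hxy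
    by_cases hx : x ∈ endsAt D j
    · simp only [hG]
      rw [Set.indicator_of_mem hx, Set.indicator_of_mem (h.1 hx)]
      exact hinv x y (sameEpisode_of_mem_endsAt hx hxy)
    · simp only [hG]
      rw [Set.indicator_of_notMem hx, Set.indicator_of_notMem fun hy => hx (h.2 hy)]
  have hLm : ∀ j, Measurable fun x => ENNReal.ofReal (pathLR M θ₀ θ j x) := fun j =>
    (measurable_pathLR_comp M θ₀ j measurable_const measurable_id).ennreal_ofReal
  calc ∫⁻ x, F x * ENNReal.ofReal (episodeLR M D θ₀ θ x) ∂(pathLaw M ρ π θ₀)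
      = ∫⁻ x, ∑' j, G j x * ENNReal.ofReal (pathLR M θ₀ θ j x) ∂(pathLaw M ρ π θ₀) := by
        refine lintegral_congr_ae ?_
        filter_upwards [hT] with x hx
        rw [tsum_eq_single (terminalTime D x) fun j hj => ?_]
        · simp only [hG]
          rw [Set.indicator_of_mem hx.mem_endsAt, episodeLR]
        · simp only [hG]
          rw [Set.indicator_of_notMem fun h => hj (terminalTime_eq_of_mem_endsAt h).symm, zero_mul]
    _ = ∑' j, ∫⁻ x, G j x ∂(pathLaw M ρ π θ) := by
        have hGL : ∀ j, AEMeasurable (fun x => G j x * ENNReal.ofReal (pathLR M θ₀ θ j x))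
            (pathLaw M ρ π θ₀) := fun j => ((hGm j).mul (hLm j)).aemeasurable
        rw [lintegral_tsum hGL]
        exact tsum_congr fun j => (hM.lintegral_pathLaw ρ π θ j (hGm j) (hdep j)).symm
    _ = ∫⁻ x, ∑' j, G j x ∂(pathLaw M ρ π θ) :=
        (lintegral_tsum fun j => (hGm j).aemeasurable).symm
    -- Only an inequality, since episodes may fail to terminate under θ: termination is assumed
    -- almost surely under θ₀ alone.
    _ ≤ ∫⁻ x, F x ∂(pathLaw M ρ π θ) := by
        refine lintegral_mono fun x => ?_
        by_cases hx : Terminates D x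
        · rw [tsum_eq_single (terminalTime D x) fun j hj => ?_]
          · exact Set.indicator_le_self _ _ _
          · exact Set.indicator_of_notMem
              (fun h => hj (terminalTime_eq_of_mem_endsAt h).symm) _
        · have : ∀ j, G j x = 0 := fun j => Set.indicator_of_notMem (fun h => hx ⟨j, h.1⟩) _
          simp [this]

/-- The likelihood ratio of the part of an episode after time `r` has mean at most one. -/
theorem ComparableWith.lintegral_episodeLR_div_le (hM : ComparableWith M θ₀ c d) {D : Set S}
    (hD : MeasurableSet D) (ρ : Measure S) [IsProbabilityMeasure ρ] (π : Policy S A)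
    (hT : ∀ᵐ x ∂(pathLaw M ρ π θ₀), Terminates D x) (θ : Θ) (r : ℕ) :
    ∫⁻ x, ENNReal.ofReal ((stoppedLR M D θ₀ θ r x)⁻¹ * episodeLR M D θ₀ θ x)
      ∂(pathLaw M ρ π θ₀) ≤ 1 := by
  have hu : Measurable fun q : (S × A) × S => (ENNReal.ofReal (lr M θ₀ θ q.1 q.2))⁻¹ :=
    (measurable_lr_comp M θ₀ measurable_const measurable_fst measurable_snd).ennreal_ofReal.inv
  -- The inverse ratio of the first r steps has mean one under θ. It is written with `runProd`
  -- because under θ the path may never terminate.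
  rw [← lintegral_runProd M hD ρ π θ hu (hM.lintegral_lr_inv θ) r]
  refine le_trans (le_of_eq ?_) (hM.lintegral_mul_episodeLR_le hD ρ π hT θ
    (measurable_runProd hD hu r) fun x y h => runProd_congr h _ r)
  refine lintegral_congr_ae ?_
  filter_upwards [hT] with x hx
  rw [hM.runProd_lr_inv_eq θ hx r, ← ENNReal.ofReal_mul (inv_pos.2 (hM.stoppedLR_pos D θ r x)).le]

theorem ComparableWith.integrable_log_stoppedLR (hM : ComparableWith M θ₀ c d) {D : Set S}
    (hD : MeasurableSet D) (ρ : Measure S) [IsProbabilityMeasure ρ] (π : Policy S A) (θ : Θ)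
    (r : ℕ) : Integrable (fun x => -Real.log (stoppedLR M D θ₀ θ r x)) (pathLaw M ρ π θ₀) := by
  refine Integrable.of_bound (measurable_stoppedLR_comp M hD θ₀ r measurable_const
    measurable_id).log.neg.aestronglyMeasurable (r * (Real.log d - Real.log c))
    (ae_of_all _ fun x => ?_)
  have hpos := hM.pathLR_pos θ (min r (terminalTime D x)) x
  have h1 := Real.log_le_log hpos (hM.pathLR_le θ (min r (terminalTime D x)) x)
  have h2 := Real.log_le_log (pow_pos hM.pos _) (hM.le_pathLR θ (min r (terminalTime D x)) x)
  rw [Real.log_pow] at h1 h2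
  have hn : ((min r (terminalTime D x) : ℕ) : ℝ) ≤ r := by exact_mod_cast min_le_left _ _
  have hn0 : (0 : ℝ) ≤ (min r (terminalTime D x) : ℕ) := Nat.cast_nonneg _
  have hd : 0 ≤ Real.log d := Real.log_nonneg hM.one_le
  have hc : Real.log c ≤ 0 := Real.log_nonpos hM.pos.le hM.le_one
  rw [norm_neg, Real.norm_eq_abs, stoppedLR, abs_le]
  constructor <;> nlinarith

/-- Stopping early loses information. The ratio W of the rest of the episode has mean at most one,
so 1 - W ≤ -log W shows that its -log has nonnegative mean. -/
theorem ComparableWith.integral_log_stoppedLR_le (hM : ComparableWith M θ₀ c d) {D : Set S}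
    (hD : MeasurableSet D) (ρ : Measure S) [IsProbabilityMeasure ρ] (π : Policy S A)
    (hT : ∀ᵐ x ∂(pathLaw M ρ π θ₀), Terminates D x) (θ : Θ) (r : ℕ)
    (hint : Integrable (logRatio M D θ₀ θ) (pathLaw M ρ π θ₀)) :
    ∫ x, -Real.log (stoppedLR M D θ₀ θ r x) ∂(pathLaw M ρ π θ₀) ≤
      ∫ x, logRatio M D θ₀ θ x ∂(pathLaw M ρ π θ₀) := by
  set P := pathLaw M ρ π θ₀ with hP
  set W : Path S A → ℝ := fun x => (stoppedLR M D θ₀ θ r x)⁻¹ * episodeLR M D θ₀ θ x with hW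
  have hWpos : ∀ x, 0 < W x := fun x =>
    mul_pos (inv_pos.2 (hM.pathLR_pos _ _ _)) (hM.pathLR_pos _ _ _)
  have hWm : Measurable W := (measurable_stoppedLR_comp M hD θ₀ r measurable_const
    measurable_id).inv.mul (measurable_episodeLR_comp M hD θ₀ measurable_const measurable_id)
  have hle := hM.lintegral_episodeLR_div_le hD ρ π hT θ r
  have hWi : Integrable W P := by
    refine ⟨hWm.aestronglyMeasurable, ?_⟩
    rw [hasFiniteIntegral_iff_ofReal (ae_of_all _ fun x => (hWpos x).le)]
    exact hle.trans_lt ENNReal.one_lt_top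
  have hWle : ∫ x, W x ∂P ≤ 1 := by
    rw [integral_eq_lintegral_of_nonneg_ae (ae_of_all _ fun x => (hWpos x).le)
      hWm.aestronglyMeasurable]
    exact ENNReal.toReal_le_of_le_ofReal zero_le_one (by simpa using hle)
  have hs := hM.integrable_log_stoppedLR hD ρ π θ r
  have key : ∀ x, 1 - W x ≤ logRatio M D θ₀ θ x - -Real.log (stoppedLR M D θ₀ θ r x) := by
    intro x
    have h1 := Real.log_le_sub_one_of_pos (hWpos x)
    simp only [hW] at h1 ⊢
    rw [Real.log_mul (inv_pos.2 (hM.stoppedLR_pos D θ r x)).ne' (hM.episodeLR_pos D θ x).ne',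
      Real.log_inv] at h1
    rw [hM.logRatio_eq]
    linarith
  have h2 : ∫ x, (1 - W x) ∂P ≤
      ∫ x, (logRatio M D θ₀ θ x - -Real.log (stoppedLR M D θ₀ θ r x)) ∂P :=
    integral_mono ((integrable_const _).sub hWi) (hint.sub hs) key
  rw [integral_sub (integrable_const _) hWi, integral_sub hint hs] at h2
  simp only [integral_const, probReal_univ, smul_eq_mul, mul_one] at h2
  linarith

end StoppedRatioMean

/-! ### Finite covers from covering numbers. -/

section Covering

/-- A finite infimum in ℕ∞ is attained: some cover has fewer elements than the infimum plus one. -/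
theorem exists_finset_of_log_coveringNumber_le {Θ : Type*} {δ : Θ → Θ → ℝ} {r : ℝ} {B : Set Θ}
    {x : ℝ} (h : ENNReal.log ((coveringNumber δ r B : ℕ∞) : ℝ≥0∞) ≤ (x : EReal)) :
    ∃ C : Finset Θ, (C.card : ℝ≥0∞) ≤ ENNReal.ofReal (Real.exp x) ∧
      ∀ θ ∈ B, ∃ c ∈ C, δ θ c ≤ r := by
  have h1 : ((coveringNumber δ r B : ℕ∞) : ℝ≥0∞) ≤ ENNReal.ofReal (Real.exp x) := by
    rwa [← EReal.log_exp (x : EReal), ENNReal.log_le_log_iff, EReal.exp_coe] at h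
  have hne : coveringNumber δ r B ≠ ⊤ := by
    intro htop
    rw [htop] at h1
    simp at h1
  have hlt : coveringNumber δ r B < coveringNumber δ r B + 1 := by
    exact ENat.lt_add_one_iff hne |>.2 le_rfl
  conv_lhs at hlt => rw [coveringNumber]
  obtain ⟨C, hC⟩ := iInf_lt_iff.1 hlt
  obtain ⟨hcov, hcard⟩ := iInf_lt_iff.1 hC
  refine ⟨C, le_trans ?_ h1, hcov⟩
  have := (ENat.lt_add_one_iff hne).1 hcard
  exact_mod_cast ENat.toENNReal_mono this

end Covering

/-! ### Lower bound for the evidence. -/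

section Evidence

/-- If the likelihood ratio is unlikely to be below `e` at every parameter of `B`, then the
evidence is unlikely to be below `e * P B / 2`. -/
theorem measure_lintegral_lt_le {Ω Θ : Type*} [MeasurableSpace Ω] [MeasurableSpace Θ]
    (Q : Measure Ω) [SFinite Q] (P : Measure Θ) [IsFiniteMeasure P] {l : Θ → Ω → ℝ≥0∞}
    (hl : Measurable (Function.uncurry l)) {B : Set Θ} (hB : MeasurableSet B) {e η : ℝ≥0∞}
    (hη : ∀ θ ∈ B, Q {ω | l θ ω < e} ≤ η) :
    Q {ω | ∫⁻ θ, l θ ω ∂P < e * (P B / 2)} ≤ 2 * η := by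
  rcases eq_or_ne (P B) 0 with hPB | hPB
  · simp [hPB]
  have hPB' : P B / 2 ≠ 0 := (ENNReal.half_pos hPB).ne'
  have hPBt : P B / 2 ≠ ∞ := (ENNReal.div_lt_top (measure_ne_top P B) two_ne_zero).ne
  have hlo : MeasurableSet {p : Θ × Ω | l p.1 p.2 < e} := measurableSet_lt hl measurable_const
  -- V is the prior mass of the part of B where the ratio is low, and its mean is at most ηP(B) by
  -- Fubini. When V < P(B)/2, at least half of B has ratio at least e; Markov at level P(B)/2
  -- produces the factor 2.
  set V : Ω → ℝ≥0∞ := fun ω => P.restrict B {θ | l θ ω < e} with hV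
  have hVm : Measurable V := measurable_measure_prodMk_right hlo
  have hVint : ∫⁻ ω, V ω ∂Q ≤ η * P B := by
    have h1 : ∫⁻ ω, V ω ∂Q = ((P.restrict B).prod Q) {p : Θ × Ω | l p.1 p.2 < e} :=
      (Measure.prod_apply_symm hlo).symm
    rw [h1, Measure.prod_apply hlo, ← setLIntegral_const]
    exact setLIntegral_mono' hB fun θ hθ => hη θ hθ
  have hsub : {ω | ∫⁻ θ, l θ ω ∂P < e * (P B / 2)} ⊆ {ω | P B / 2 ≤ V ω} := by
    intro ω hω
    have hω' : ∫⁻ θ, l θ ω ∂P < e * (P B / 2) := hω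
    by_contra hlt
    have hlt' : V ω < P B / 2 := not_le.1 hlt
    have hloω : MeasurableSet {θ | l θ ω < e} := measurable_prodMk_right hlo
    have hhi : P B / 2 ≤ P.restrict B {θ | l θ ω < e}ᶜ := by
      by_contra hlt2
      have hsum := measure_add_measure_compl (μ := P.restrict B) hloω
      rw [Measure.restrict_apply_univ] at hsum
      have := ENNReal.add_lt_add hlt' (not_le.1 hlt2)
      rw [ENNReal.add_halves] at this
      exact this.ne hsum
    refine hω'.not_ge ?_
    calc e * (P B / 2) ≤ e * P.restrict B {θ | l θ ω < e}ᶜ := by gcongr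
      _ ≤ e * P {θ | e ≤ l θ ω} := by
          refine mul_le_mul_right ((Measure.restrict_apply_le _ _).trans
            (measure_mono fun θ hθ => ?_)) _
          exact not_lt.1 (show ¬ l θ ω < e from hθ)
      _ ≤ ∫⁻ θ, l θ ω ∂P := mul_meas_ge_le_lintegral (hl.comp measurable_prodMk_right) e
  calc Q {ω | ∫⁻ θ, l θ ω ∂P < e * (P B / 2)} ≤ Q {ω | P B / 2 ≤ V ω} := measure_mono hsub
    _ ≤ (∫⁻ ω, V ω ∂Q) / (P B / 2) := meas_ge_le_lintegral_div hVm.aemeasurable hPB' hPBt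
    _ ≤ η * P B / (P B / 2) := by gcongr
    _ = 2 * η := by
        have : η * P B = 2 * η * (P B / 2) := by
          rw [mul_comm 2 η, mul_assoc, two_mul, ENNReal.add_halves]
        rw [this, ENNReal.mul_div_cancel_right hPB' hPBt]

end Evidence

/-! ### Likelihood ratios of histories and the posterior. -/

section HistoryRatio

variable {Θ S A : Type*} [MeasurableSpace Θ] [MeasurableSpace S] [MeasurableSpace A]
  {m : Measure S}

/-- The likelihood ratio of a history. -/
noncomputable def historyLR (M : TransitionModel Θ S A m) (D : Set S) (N r : ℕ) (θ₀ θ : Θ)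
    (ω : ℕ → Path S A) : ℝ :=
  (∏ i ∈ Finset.range N, episodeLR M D θ₀ θ (ω i)) * stoppedLR M D θ₀ θ r (ω N)

theorem measurable_historyLR (M : TransitionModel Θ S A m) {D : Set S} (hD : MeasurableSet D)
    (N r : ℕ) (θ₀ : Θ) :
    Measurable fun p : Θ × (ℕ → Path S A) => historyLR M D N r θ₀ p.1 p.2 :=
  (Finset.measurable_prod _ fun i _ => measurable_episodeLR_comp M hD θ₀ measurable_fst
    ((measurable_pi_apply i).comp measurable_snd)).mul
    (measurable_stoppedLR_comp M hD θ₀ r measurable_fst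
      ((measurable_pi_apply N).comp measurable_snd))

variable {M : TransitionModel Θ S A m} {θ₀ : Θ} {c d : ℝ}

theorem ComparableWith.historyLR_pos (hM : ComparableWith M θ₀ c d) (D : Set S) (N r : ℕ) (θ : Θ)
    (ω : ℕ → Path S A) : 0 < historyLR M D N r θ₀ θ ω :=
  mul_pos (Finset.prod_pos fun _ _ => hM.episodeLR_pos _ _ _) (hM.stoppedLR_pos _ _ _ _)

theorem ComparableWith.transitionProd_eq (hM : ComparableWith M θ₀ c d) (θ : Θ) (x : Path S A)
    (k : ℕ) :
    transitionProd M θ x k = transitionProd M θ₀ x k * ENNReal.ofReal (pathLR M θ₀ θ k x) := by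
  rw [transitionProd, transitionProd, pathLR,
    ENNReal.ofReal_prod_of_nonneg fun _ _ => (hM.lr_pos _ _ _).le, ← Finset.prod_mul_distrib]
  refine Finset.prod_congr rfl fun t _ => ?_
  rw [← ENNReal.ofReal_mul (M.nonneg _ _ _ _), hM.mul_lr]

theorem ComparableWith.likelihood_eq (hM : ComparableWith M θ₀ c d) (D : Set S) (N r : ℕ) (θ : Θ)
    (ω : ℕ → Path S A) :
    likelihood M D N r θ ω =
      likelihood M D N r θ₀ ω * ENNReal.ofReal (historyLR M D N r θ₀ θ ω) := by
  rw [likelihood, likelihood, historyLR,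
    ENNReal.ofReal_mul (Finset.prod_nonneg fun _ _ => (hM.episodeLR_pos _ _ _).le),
    ENNReal.ofReal_prod_of_nonneg fun _ _ => (hM.episodeLR_pos _ _ _).le,
    mul_mul_mul_comm, ← Finset.prod_mul_distrib, hM.transitionProd_eq θ (ω N)]
  congr 1
  exact Finset.prod_congr rfl fun i _ => hM.transitionProd_eq θ _ _

theorem likelihood_ne_top (M : TransitionModel Θ S A m) (D : Set S) (N r : ℕ) (θ : Θ)
    (ω : ℕ → Path S A) : likelihood M D N r θ ω ≠ ∞ := by
  unfold likelihood transitionProd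
  exact ENNReal.mul_ne_top (ENNReal.prod_ne_top fun _ _ => ENNReal.prod_ne_top fun _ _ =>
    ENNReal.ofReal_ne_top) (ENNReal.prod_ne_top fun _ _ => ENNReal.ofReal_ne_top)

/-- If the posterior probability of `B` is at least `η`, then so is the ratio of the integrals of
the likelihood ratio. -/
theorem ComparableWith.mul_evidence_le (hM : ComparableWith M θ₀ c d) {D : Set S}
    (hD : MeasurableSet D) (P : Measure Θ) (N r : ℕ) (ω : ℕ → Path S A) {B : Set Θ} {η : ℝ≥0∞}
    (hη0 : η ≠ 0) (h : η ≤ posteriorProb M D P N r ω B) :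
    ∫⁻ θ in B, ENNReal.ofReal (historyLR M D N r θ₀ θ ω) ∂P ≠ 0 ∧
      η * ∫⁻ θ, ENNReal.ofReal (historyLR M D N r θ₀ θ ω) ∂P ≤
        ∫⁻ θ in B, ENNReal.ofReal (historyLR M D N r θ₀ θ ω) ∂P := by
  have hm : Measurable fun θ => ENNReal.ofReal (historyLR M D N r θ₀ θ ω) :=
    ((measurable_historyLR M hD N r θ₀).comp measurable_prodMk_right).ennreal_ofReal
  have heq : ∀ ν : Measure Θ, ∫⁻ θ, likelihood M D N r θ ω ∂ν = likelihood M D N r θ₀ ω *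
      ∫⁻ θ, ENNReal.ofReal (historyLR M D N r θ₀ θ ω) ∂ν := fun ν => by
    rw [← lintegral_const_mul _ hm]
    exact lintegral_congr fun θ => hM.likelihood_eq D N r θ ω
  rw [posteriorProb, heq, heq] at h
  set l := likelihood M D N r θ₀ ω with hl
  have hlt : l ≠ ∞ := likelihood_ne_top M D N r θ₀ ω
  -- If the likelihood of θ₀ vanishes, so do all the others; the posterior quotient is then 0/0 = 0,
  -- which is below η.
  rcases eq_or_ne l 0 with h0 | h0
  · simp only [h0, zero_mul, ENNReal.zero_div, nonpos_iff_eq_zero] at h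
    exact absurd h hη0
  · refine ⟨fun hX => ?_, ?_⟩
    · rw [hX, mul_zero, ENNReal.zero_div] at h
      exact hη0 (le_antisymm h zero_le)
    have := ENNReal.mul_le_of_le_div h
    rw [mul_left_comm] at this
    exact (ENNReal.mul_le_mul_iff_right h0 hlt).1 this

theorem ComparableWith.log_historyLR (hM : ComparableWith M θ₀ c d) (D : Set S) (N r : ℕ)
    (θ : Θ) (ω : ℕ → Path S A) :
    -Real.log (historyLR M D N r θ₀ θ ω) = ∑ i ∈ Finset.range N, logRatio M D θ₀ θ (ω i) +
      -Real.log (stoppedLR M D θ₀ θ r (ω N)) := by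
  rw [historyLR, Real.log_mul (Finset.prod_pos fun _ _ => hM.episodeLR_pos _ _ _).ne'
    (hM.stoppedLR_pos _ _ _ _).ne', Real.log_prod fun _ _ => (hM.episodeLR_pos _ _ _).ne',
    neg_add, ← Finset.sum_neg_distrib]
  congr 1
  exact Finset.sum_congr rfl fun i _ => (hM.logRatio_eq D θ _).symm

end HistoryRatio

/-! ### Means of history likelihood ratios and of their logarithms. -/

section HistoryMean

variable {Θ S A : Type*} [MeasurableSpace Θ] [MeasurableSpace S] [MeasurableSpace A]
  {m : Measure S} [SigmaFinite m] {M : TransitionModel Θ S A m} {θ₀ : Θ} {c d : ℝ}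

/-- Change of measure for products of functions of the complete episodes of a history. -/
theorem ComparableWith.lintegral_prod_mul_historyLR_le (hM : ComparableWith M θ₀ c d) {D : Set S}
    (hD : MeasurableSet D) (ρ : Measure S) [IsProbabilityMeasure ρ] (π : Policy S A)
    (hT : ∀ᵐ x ∂(pathLaw M ρ π θ₀), Terminates D x) (N r : ℕ) (θ : Θ) {F : Path S A → ℝ≥0∞}
    (hF : Measurable F) (hinv : ∀ x y, SameEpisode D x y → F x = F y) :
    ∫⁻ ω, (∏ i ∈ Finset.range N, F (ω i)) * ENNReal.ofReal (historyLR M D N r θ₀ θ ω)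
        ∂(episodesLaw M ρ π θ₀) ≤
      (∫⁻ x, F x ∂(pathLaw M ρ π θ)) ^ N := by
  -- The factors below index N belong to complete episodes, the one at N to the unfinished episode,
  -- whose ratio has mean one. Larger indices do not occur in the product.
  set f : ℕ → Path S A → ℝ≥0∞ := fun i => if i < N then
    fun x => F x * ENNReal.ofReal (episodeLR M D θ₀ θ x) else
    fun x => ENNReal.ofReal (stoppedLR M D θ₀ θ r x) with hf
  have hf1 : ∀ i < N, f i = fun x => F x * ENNReal.ofReal (episodeLR M D θ₀ θ x) :=
    fun i hi => if_pos hi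
  have hf2 : f N = fun x => ENNReal.ofReal (stoppedLR M D θ₀ θ r x) := if_neg (lt_irrefl N)
  have hfm : ∀ i, Measurable (f i) := by
    intro i
    simp only [hf]
    split_ifs
    · exact hF.mul (measurable_episodeLR_comp M hD θ₀ measurable_const
        measurable_id).ennreal_ofReal
    · exact (measurable_stoppedLR_comp M hD θ₀ r measurable_const measurable_id).ennreal_ofReal
  have heq : ∀ ω : ℕ → Path S A, (∏ i ∈ Finset.range N, F (ω i)) *
      ENNReal.ofReal (historyLR M D N r θ₀ θ ω) = ∏ i ∈ Finset.range (N + 1), f i (ω i) := by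
    intro ω
    rw [Finset.prod_range_succ, hf2, historyLR,
      ENNReal.ofReal_mul (Finset.prod_nonneg fun _ _ => (hM.episodeLR_pos _ _ _).le),
      ENNReal.ofReal_prod_of_nonneg fun _ _ => (hM.episodeLR_pos _ _ _).le, ← mul_assoc,
      ← Finset.prod_mul_distrib]
    congr 1
    refine Finset.prod_congr rfl fun i hi => ?_
    rw [hf1 i (Finset.mem_range.1 hi)]
  rw [lintegral_congr heq, lintegral_episodesLaw_prod M ρ π θ₀ _ hfm, Finset.prod_range_succ, hf2,
    hM.lintegral_stoppedLR hD ρ π hT, mul_one]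
  calc ∏ i ∈ Finset.range N, ∫⁻ x, f i x ∂(pathLaw M ρ π θ₀)
      ≤ ∏ _i ∈ Finset.range N, ∫⁻ x, F x ∂(pathLaw M ρ π θ) := by
        refine Finset.prod_le_prod' fun i hi => ?_
        rw [hf1 i (Finset.mem_range.1 hi)]
        exact hM.lintegral_mul_episodeLR_le hD ρ π hT θ hF hinv
    _ = _ := by rw [Finset.prod_const, Finset.card_range]

theorem ComparableWith.lintegral_historyLR_le (hM : ComparableWith M θ₀ c d) {D : Set S}
    (hD : MeasurableSet D) (ρ : Measure S) [IsProbabilityMeasure ρ] (π : Policy S A)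
    (hT : ∀ᵐ x ∂(pathLaw M ρ π θ₀), Terminates D x) (N r : ℕ) (θ : Θ) :
    ∫⁻ ω, ENNReal.ofReal (historyLR M D N r θ₀ θ ω) ∂(episodesLaw M ρ π θ₀) ≤ 1 := by
  have := hM.lintegral_prod_mul_historyLR_le hD ρ π hT N r θ (F := fun _ => 1) measurable_const
    fun _ _ _ => rfl
  simpa using this

/-- The second error in the form needed for the numerator of the posterior: data from θ₀, weighted
by the likelihood ratio of the whole history. Bounding the indicator by a product of exponentials
makes the integral factor over episodes. -/
theorem ComparableWith.lintegral_rejection_compl_mul_historyLR_le (hM : ComparableWith M θ₀ c d)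
    {D : Set S} (hD : MeasurableSet D) (ρ : Measure S) [IsProbabilityMeasure ρ] (π : Policy S A)
    (hT : ∀ᵐ x ∂(pathLaw M ρ π θ₀), Terminates D x)
    (lam : Measure (S × A)) [IsFiniteMeasure lam] (hlam : ∀ t, occupancy M D ρ π θ₀ t ≪ lam)
    (θ θ₁ : Θ) (hθ : discountedDist M D ρ π θ₀ lam (testDiscount d * d) θ θ₁ ≤
      2 * testRadius d * discountedDist M D ρ π θ₀ lam (testDiscount d * c) θ₀ θ₁) (N r : ℕ) :
    ∫⁻ ω, (rejection M D θ₀ θ₁ d N)ᶜ.indicator (fun _ => (1 : ℝ≥0∞)) ω *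
        ENNReal.ofReal (historyLR M D N r θ₀ θ ω) ∂(episodesLaw M ρ π θ₀) ≤
      ENNReal.ofReal (Real.exp (-(testRate d * N *
        discountedDist M D ρ π θ₀ lam (testDiscount d * c) θ₀ θ₁ ^ 2))) := by
  refine (lintegral_mono fun ω => mul_le_mul_left
    (rejection_compl_indicator_le hM.one_le D θ₁ N ω) _).trans ?_
  refine (hM.lintegral_prod_mul_historyLR_le hD ρ π hT N r θ (F := fun x =>
    ENNReal.ofReal (Real.exp (-(testScale d * testStat M D θ₀ θ₁ d x))))
    ((measurable_testStat M hD θ₀ θ₁ d).const_mul _).neg.exp.ennreal_ofReal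
    fun x y h => by simp only [testStat, runSum_congr h]).trans ?_
  rw [← ofReal_exp_neg_pow]
  exact pow_le_pow_left' (hM.lintegral_exp_testStat_alternative_le hD ρ π lam hlam θ θ₁ hθ) N

theorem integrable_comp_eval (M : TransitionModel Θ S A m) (ρ : Measure S)
    [IsProbabilityMeasure ρ] (π : Policy S A) (θ : Θ) {f : Path S A → ℝ}
    (hf : Integrable f (pathLaw M ρ π θ)) (i : ℕ) :
    Integrable (fun ω : ℕ → Path S A => f (ω i)) (episodesLaw M ρ π θ) :=
  (measurePreserving_eval_infinitePi (fun _ : ℕ => pathLaw M ρ π θ) i).integrable_comp_of_integrable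
    hf

theorem integral_comp_eval (M : TransitionModel Θ S A m) (ρ : Measure S)
    [IsProbabilityMeasure ρ] (π : Policy S A) (θ : Θ) {f : Path S A → ℝ}
    (hf : Integrable f (pathLaw M ρ π θ)) (i : ℕ) :
    ∫ ω, f (ω i) ∂(episodesLaw M ρ π θ) = ∫ x, f x ∂(pathLaw M ρ π θ) := by
  have h := Measure.infinitePi_map_eval (fun _ : ℕ => pathLaw M ρ π θ) i
  have h2 : AEStronglyMeasurable f (Measure.map (fun ω : ℕ → Path S A => ω i)
      (Measure.infinitePi fun _ : ℕ => pathLaw M ρ π θ)) := by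
    rw [h]
    exact hf.1
  rw [← h, integral_map (measurable_pi_apply i).aemeasurable h2]
  rfl

theorem ComparableWith.integrable_historyLR (hM : ComparableWith M θ₀ c d) {D : Set S}
    (hD : MeasurableSet D) (ρ : Measure S) [IsProbabilityMeasure ρ] (π : Policy S A)
    (hT : ∀ᵐ x ∂(pathLaw M ρ π θ₀), Terminates D x) (N r : ℕ) (θ : Θ) :
    Integrable (historyLR M D N r θ₀ θ) (episodesLaw M ρ π θ₀) ∧
      ∫ ω, historyLR M D N r θ₀ θ ω ∂(episodesLaw M ρ π θ₀) ≤ 1 := by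
  have hpos : ∀ᵐ ω ∂(episodesLaw M ρ π θ₀), 0 ≤ historyLR M D N r θ₀ θ ω :=
    ae_of_all _ fun ω => (hM.historyLR_pos D N r θ ω).le
  have hm : AEStronglyMeasurable (historyLR M D N r θ₀ θ) (episodesLaw M ρ π θ₀) :=
    ((measurable_historyLR M hD N r θ₀).comp measurable_prodMk_left).aestronglyMeasurable
  have hle := hM.lintegral_historyLR_le hD ρ π hT N r θ
  refine ⟨⟨hm, ?_⟩, ?_⟩
  · rw [hasFiniteIntegral_iff_ofReal hpos]
    exact hle.trans_lt ENNReal.one_lt_top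
  · rw [integral_eq_lintegral_of_nonneg_ae hpos hm]
    exact ENNReal.toReal_le_of_le_ofReal zero_le_one (by simpa using hle)

/-- The factor N + 1 counts the unfinished episode as a complete one, by
`integral_log_stoppedLR_le`. -/
theorem ComparableWith.integral_log_historyLR_le (hM : ComparableWith M θ₀ c d) {D : Set S}
    (hD : MeasurableSet D) (ρ : Measure S) [IsProbabilityMeasure ρ] (π : Policy S A)
    (hT : ∀ᵐ x ∂(pathLaw M ρ π θ₀), Terminates D x) (N r : ℕ) {θ : Θ} {ε : ℝ}
    (hint : Integrable (logRatio M D θ₀ θ) (pathLaw M ρ π θ₀))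
    (hmean : ∫ x, logRatio M D θ₀ θ x ∂(pathLaw M ρ π θ₀) ≤ ε ^ 2) :
    Integrable (fun ω => -Real.log (historyLR M D N r θ₀ θ ω)) (episodesLaw M ρ π θ₀) ∧
      ∫ ω, -Real.log (historyLR M D N r θ₀ θ ω) ∂(episodesLaw M ρ π θ₀) ≤ (N + 1) * ε ^ 2 := by
  have hs := hM.integrable_log_stoppedLR hD ρ π θ r
  have hi : ∀ i ∈ Finset.range N, Integrable (fun ω : ℕ → Path S A => logRatio M D θ₀ θ (ω i))
      (episodesLaw M ρ π θ₀) := fun i _ => integrable_comp_eval M ρ π θ₀ hint i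
  have hi1 := integrable_finsetSum _ hi
  have hi2 := integrable_comp_eval M ρ π θ₀ hs N
  simp only [hM.log_historyLR]
  refine ⟨hi1.add hi2, ?_⟩
  rw [integral_add hi1 hi2, integral_finsetSum _ hi, integral_comp_eval M ρ π θ₀ hs N]
  simp only [integral_comp_eval M ρ π θ₀ hint, Finset.sum_const, Finset.card_range, nsmul_eq_mul]
  have h1 := hM.integral_log_stoppedLR_le hD ρ π hT θ r hint
  have h2 := mul_le_mul_of_nonneg_left hmean (Nat.cast_nonneg (α := ℝ) N)
  linarith

/-- If `-log W` and `W > 0` are integrable, then `W` is unlikely to be small. -/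
theorem measure_lt_exp_neg_le {Ω : Type*} [MeasurableSpace Ω] (Q : Measure Ω)
    [IsProbabilityMeasure Q] {W : Ω → ℝ} (hpos : ∀ ω, 0 < W ω) (hW : Integrable W Q)
    (hlog : Integrable (fun ω => -Real.log (W ω)) Q) {a b : ℝ} (ha : 0 < a)
    (hb : ∫ ω, -Real.log (W ω) ∂Q + ∫ ω, W ω ∂Q ≤ b) :
    Q {ω | ENNReal.ofReal (W ω) < ENNReal.ofReal (Real.exp (-a))} ≤ ENNReal.ofReal (b / a) := by
  -- Since -log W can be negative, Markov's inequality is applied to -log W + W, which is at least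
  -- 1. The price is the mean of W.
  have hnn : ∀ ω, 0 ≤ -Real.log (W ω) + W ω := fun ω => by
    have := Real.log_le_sub_one_of_pos (hpos ω)
    linarith
  have hmarkov := mul_meas_ge_le_integral_of_nonneg (μ := Q) (f := fun ω => -Real.log (W ω) + W ω)
    (ae_of_all _ hnn) (hlog.add hW) a
  rw [integral_add hlog hW] at hmarkov
  have hsub : {ω | ENNReal.ofReal (W ω) < ENNReal.ofReal (Real.exp (-a))} ⊆
      {ω | a ≤ -Real.log (W ω) + W ω} := by
    intro ω hω
    have h1 : W ω < Real.exp (-a) := (ENNReal.ofReal_lt_ofReal_iff (Real.exp_pos _)).1 hω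
    have h2 := (Real.log_lt_iff_lt_exp (hpos ω)).2 h1
    have h3 := (hpos ω).le
    change a ≤ -Real.log (W ω) + W ω
    linarith
  refine (measure_mono hsub).trans ?_
  rw [← ofReal_measureReal]
  refine ENNReal.ofReal_le_ofReal ?_
  rw [le_div_iff₀ ha, mul_comm]
  exact hmarkov.trans hb

/-- A lower deviation bound for the likelihood ratio at a parameter near the truth. -/
theorem ComparableWith.measure_historyLR_lt_le (hM : ComparableWith M θ₀ c d) {D : Set S}
    (hD : MeasurableSet D) (ρ : Measure S) [IsProbabilityMeasure ρ] (π : Policy S A)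
    (hT : ∀ᵐ x ∂(pathLaw M ρ π θ₀), Terminates D x) (N r : ℕ) {θ : Θ} {ε n : ℝ}
    (hθ : θ ∈ starBall M D ρ π θ₀ ε n) {a : ℝ} (ha : 0 < a) :
    episodesLaw M ρ π θ₀ {ω | ENNReal.ofReal (historyLR M D N r θ₀ θ ω) <
        ENNReal.ofReal (Real.exp (-a))} ≤
      ENNReal.ofReal (((N + 1) * ε ^ 2 + 1) / a) := by
  have h1 := hM.integrable_historyLR hD ρ π hT N r θ
  have h2 := hM.integral_log_historyLR_le hD ρ π hT N r hθ.1 hθ.2.1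
  exact measure_lt_exp_neg_le _ (hM.historyLR_pos D N r θ) h1.1 h2.1 ha (add_le_add h2.2 h1.2)

theorem measurableSet_starBall (M : TransitionModel Θ S A m) {D : Set S} (hD : MeasurableSet D)
    (hM : ComparableWith M θ₀ c d) (ρ : Measure S) [IsProbabilityMeasure ρ] (π : Policy S A)
    (ε n : ℝ) : MeasurableSet (starBall M D ρ π θ₀ ε n) := by
  have hm : Measurable fun p : Θ × Path S A => logRatio M D θ₀ p.1 p.2 := by
    simp only [hM.logRatio_eq]
    exact (measurable_episodeLR_comp M hD θ₀ measurable_fst measurable_snd).log.neg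
  have h1 : MeasurableSet {θ | Integrable (logRatio M D θ₀ θ) (pathLaw M ρ π θ₀)} :=
    measurableSet_integrable (f := logRatio M D θ₀) hm.stronglyMeasurable
  have h2 : MeasurableSet {θ | ∫ x, logRatio M D θ₀ θ x ∂(pathLaw M ρ π θ₀) ≤ ε ^ 2} :=
    measurableSet_le hm.stronglyMeasurable.integral_prod_right'.measurable measurable_const
  have h3 : MeasurableSet {θ | ∫⁻ x, ENNReal.ofReal (|logRatio M D θ₀ θ x| ^ n)
      ∂(pathLaw M ρ π θ₀) ≤ ENNReal.ofReal (ε ^ n)} :=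
    measurableSet_le (Measurable.lintegral_prod_right' (f := fun p : Θ × Path S A =>
      ENNReal.ofReal (|logRatio M D θ₀ p.1 p.2| ^ n))
      ((measurable_abs.comp hm).pow_const n).ennreal_ofReal) measurable_const
  exact h1.inter (h2.inter h3)

end HistoryMean

/-! ### Shells around the true parameter. -/

/-- The parameters at distance between `j * ε` and `(j + 1) * ε` of `θ₀`. -/
def shell {Θ : Type*} (δ : Θ → Θ → ℝ) (θ₀ : Θ) (ε : ℝ) (j : ℕ) : Set Θ :=
  {θ | j * ε < δ θ θ₀ ∧ δ θ θ₀ ≤ (j + 1) * ε}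

/-- Shells are open below and closed above, so a point at distance xε lies in shell ⌈x⌉ - 1. The
value x = J + 1 still falls in shell J, whence the condition J + 1 ≤ L. -/
theorem subset_iUnion_shell {Θ : Type*} (δ : Θ → Θ → ℝ) (θ₀ : Θ) {ε L : ℝ} (hε : 0 < ε) {J : ℕ}
    (hJ : (J : ℝ) + 1 ≤ L) : {θ | L * ε ≤ δ θ θ₀} ⊆ ⋃ i : ℕ, shell δ θ₀ ε (J + i) := by
  intro θ hθ
  have hθ' : L ≤ δ θ θ₀ / ε := (le_div_iff₀ hε).2 hθ
  set x := δ θ θ₀ / ε with hx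
  have hx1 : (J : ℝ) + 1 ≤ x := hJ.trans hθ'
  have hJc : J + 1 ≤ ⌈x⌉₊ := by
    have : ((J + 1 : ℕ) : ℝ) ≤ ⌈x⌉₊ := by
      push_cast
      exact hx1.trans (Nat.le_ceil x)
    exact_mod_cast this
  have hxp : 0 < ⌈x⌉₊ := by omega
  have hxm : (δ θ θ₀) = x * ε := (div_mul_cancel₀ _ hε.ne').symm
  refine Set.mem_iUnion.2 ⟨⌈x⌉₊ - 1 - J, ?_⟩
  have hidx : J + (⌈x⌉₊ - 1 - J) = ⌈x⌉₊ - 1 := by omega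
  have hcast : ((⌈x⌉₊ - 1 : ℕ) : ℝ) = (⌈x⌉₊ : ℝ) - 1 := by
    rw [Nat.cast_sub hxp, Nat.cast_one]
  have hlt : (⌈x⌉₊ : ℝ) < x + 1 := Nat.ceil_lt_add_one (by
    have : (0 : ℝ) ≤ J := Nat.cast_nonneg J
    linarith)
  rw [hidx]
  change ((⌈x⌉₊ - 1 : ℕ) : ℝ) * ε < δ θ θ₀ ∧ δ θ θ₀ ≤ (((⌈x⌉₊ - 1 : ℕ) : ℝ) + 1) * ε
  rw [hcast, hxm]
  constructor
  · exact mul_lt_mul_of_pos_right (by linarith) hε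
  · exact mul_le_mul_of_nonneg_right (by linarith [Nat.le_ceil x]) hε.le

/-! ### From tests and evidence to posterior mass. -/

section BayesRisk

variable {Ω Θ : Type*} [MeasurableSpace Ω] [MeasurableSpace Θ] {Q : Measure Ω} {P : Measure Θ}

/-- The integral of the likelihood ratio over a union of sets, off the rejection regions. -/
theorem lintegral_compl_mul_setLIntegral_le [SFinite Q] [SFinite P] {l : Θ → Ω → ℝ≥0∞}
    (hl : Measurable (Function.uncurry l)) {B : Set Θ} {V : ℕ → Set Θ}
    (hV : ∀ i, MeasurableSet (V i)) (hBV : B ⊆ ⋃ i, V i) {R : ℕ → Set Ω}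
    (hR : ∀ i, MeasurableSet (R i)) {β : ℕ → ℝ≥0∞}
    (hβ : ∀ i, ∀ θ ∈ V i,
      ∫⁻ ω, (R i)ᶜ.indicator (fun _ => (1 : ℝ≥0∞)) ω * l θ ω ∂Q ≤ β i) :
    ∫⁻ ω, (⋃ i, R i)ᶜ.indicator (fun _ => (1 : ℝ≥0∞)) ω * ∫⁻ θ in B, l θ ω ∂P ∂Q ≤
      ∑' i, β i * P (V i) := by
  have hgm : ∀ i, Measurable fun p : Ω × Θ =>
      (R i)ᶜ.indicator (fun _ => (1 : ℝ≥0∞)) p.1 * l p.2 p.1 := fun i =>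
    ((measurable_const.indicator (hR i).compl).comp measurable_fst).mul (hl.comp measurable_swap)
  calc ∫⁻ ω, (⋃ i, R i)ᶜ.indicator (fun _ => (1 : ℝ≥0∞)) ω * ∫⁻ θ in B, l θ ω ∂P ∂Q
      ≤ ∫⁻ ω, ∑' i, ∫⁻ θ in V i, (R i)ᶜ.indicator (fun _ => (1 : ℝ≥0∞)) ω * l θ ω ∂P ∂Q := by
        refine lintegral_mono fun ω => ?_
        by_cases h1 : ω ∈ ⋃ i, R i
        · rw [Set.indicator_of_notMem (Set.notMem_compl_iff.2 h1), zero_mul]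
          exact zero_le
        · have h2 : ∀ i, ω ∉ R i := fun i hi => h1 (Set.mem_iUnion.2 ⟨i, hi⟩)
          rw [Set.indicator_of_mem (show ω ∈ (⋃ i, R i)ᶜ from h1), one_mul]
          refine (lintegral_mono_set hBV).trans ((lintegral_iUnion_le V _).trans
            (ENNReal.tsum_le_tsum fun i => ?_))
          rw [Set.indicator_of_mem (show ω ∈ (R i)ᶜ from h2 i)]
          simp only [one_mul, le_refl]
    _ = ∑' i, ∫⁻ ω, ∫⁻ θ in V i, (R i)ᶜ.indicator (fun _ => (1 : ℝ≥0∞)) ω * l θ ω ∂P ∂Q :=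
        lintegral_tsum fun i => (hgm i).lintegral_prod_right'.aemeasurable
    _ = ∑' i, ∫⁻ θ in V i, ∫⁻ ω, (R i)ᶜ.indicator (fun _ => (1 : ℝ≥0∞)) ω * l θ ω ∂Q ∂P :=
        tsum_congr fun i => lintegral_lintegral_swap (hgm i).aemeasurable
    _ ≤ ∑' i, β i * P (V i) := by
        refine ENNReal.tsum_le_tsum fun i => ?_
        calc _ ≤ ∫⁻ _ in V i, β i ∂P := setLIntegral_mono' (hV i) (hβ i)
          _ = β i * P (V i) := setLIntegral_const _ _

/-- A bound for the probability that the integral of the likelihood ratio over `B` exceeds a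
fraction `η` of the evidence. -/
theorem measure_mul_lintegral_le_le (Q : Measure Ω) [SFinite Q] (P : Measure Θ)
    [IsFiniteMeasure P] {l : Θ → Ω → ℝ≥0∞} (hl : Measurable (Function.uncurry l)) {G : Set Θ}
    (hG : MeasurableSet G) {a : ℝ} {τ : ℝ≥0∞}
    (hτ : ∀ θ ∈ G, Q {ω | l θ ω < ENNReal.ofReal (Real.exp (-a))} ≤ τ) {B : Set Θ}
    {V : ℕ → Set Θ} (hV : ∀ i, MeasurableSet (V i)) (hBV : B ⊆ ⋃ i, V i) {R : ℕ → Set Ω}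
    (hR : ∀ i, MeasurableSet (R i)) {α β γ : ℕ → ℝ≥0∞} (hα : ∀ i, Q (R i) ≤ α i)
    (hβ : ∀ i, ∀ θ ∈ V i,
      ∫⁻ ω, (R i)ᶜ.indicator (fun _ => (1 : ℝ≥0∞)) ω * l θ ω ∂Q ≤ β i)
    (hγ : ∀ i, P (V i) ≤ γ i * P G) {η : ℝ} (hη : 0 < η) :
    Q {ω | ∫⁻ θ in B, l θ ω ∂P ≠ 0 ∧
        ENNReal.ofReal η * ∫⁻ θ, l θ ω ∂P ≤ ∫⁻ θ in B, l θ ω ∂P} ≤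
      ∑' i, α i + 2 * τ + ENNReal.ofReal (2 * Real.exp a / η) * ∑' i, β i * γ i := by
  have hη' : ENNReal.ofReal η ≠ 0 := (ENNReal.ofReal_pos.2 hη).ne'
  -- If G has prior mass zero the evidence bound says nothing, but then every V i, hence B, is null.
  -- The requirement of a nonzero numerator makes the event empty.
  rcases eq_or_ne (P G) 0 with h0 | h0
  · have hB0 : P B = 0 := by
      refine measure_mono_null hBV (measure_iUnion_null fun i => ?_)
      have := hγ i
      rw [h0, mul_zero] at this
      exact le_antisymm this zero_le
    have hempty : {ω | ∫⁻ θ in B, l θ ω ∂P ≠ 0 ∧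
        ENNReal.ofReal η * ∫⁻ θ, l θ ω ∂P ≤ ∫⁻ θ in B, l θ ω ∂P} = ∅ :=
      Set.eq_empty_of_forall_notMem fun ω hω => hω.1 (setLIntegral_measure_zero _ _ hB0)
    rw [hempty, measure_empty]
    exact zero_le
  set e := ENNReal.ofReal (Real.exp (-a)) with he
  set p := P G / 2 with hp
  have hp0 : p ≠ 0 := (ENNReal.half_pos h0).ne'
  have hpt : p ≠ ∞ := (ENNReal.div_lt_top (measure_ne_top P G) two_ne_zero).ne
  have hpG : P G = 2 * p := by rw [two_mul, ENNReal.add_halves]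
  have he0 : e ≠ 0 := (ENNReal.ofReal_pos.2 (Real.exp_pos _)).ne'
  set num : Ω → ℝ≥0∞ := fun ω => (⋃ i, R i)ᶜ.indicator (fun _ => (1 : ℝ≥0∞)) ω *
    ∫⁻ θ in B, l θ ω ∂P with hnum
  -- Three ways to be bad: some test rejects, the evidence is low, or no test rejects and the
  -- numerator is large all the same.
  have hsub : {ω | ∫⁻ θ in B, l θ ω ∂P ≠ 0 ∧
      ENNReal.ofReal η * ∫⁻ θ, l θ ω ∂P ≤ ∫⁻ θ in B, l θ ω ∂P} ⊆
      (⋃ i, R i) ∪ {ω | ∫⁻ θ, l θ ω ∂P < e * p} ∪ {ω | ENNReal.ofReal η * (e * p) ≤ num ω} := by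
    intro ω hω
    by_cases h1 : ω ∈ ⋃ i, R i
    · exact Or.inl (Or.inl h1)
    by_cases h2 : ∫⁻ θ, l θ ω ∂P < e * p
    · exact Or.inl (Or.inr h2)
    refine Or.inr ?_
    change _ ≤ num ω
    simp only [hnum]
    rw [Set.indicator_of_mem (show ω ∈ (⋃ i, R i)ᶜ from h1), one_mul]
    exact (mul_le_mul_right (not_lt.1 h2) _).trans hω.2
  have hnumm : Measurable num :=
    (measurable_const.indicator (MeasurableSet.iUnion hR).compl).mul
      (Measurable.lintegral_prod_left' (μ := P.restrict B) hl)
  have hnum_le : ∫⁻ ω, num ω ∂Q ≤ (∑' i, β i * γ i) * P G := by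
    refine (lintegral_compl_mul_setLIntegral_le hl hV hBV hR hβ).trans ?_
    rw [← ENNReal.tsum_mul_right]
    refine ENNReal.tsum_le_tsum fun i => ?_
    rw [mul_assoc]
    exact mul_le_mul_right (hγ i) _
  have hden0 : ENNReal.ofReal η * (e * p) ≠ 0 := mul_ne_zero hη' (mul_ne_zero he0 hp0)
  have hdent : ENNReal.ofReal η * (e * p) ≠ ∞ :=
    ENNReal.mul_ne_top ENNReal.ofReal_ne_top (ENNReal.mul_ne_top ENNReal.ofReal_ne_top hpt)
  have hlast : Q {ω | ENNReal.ofReal η * (e * p) ≤ num ω} ≤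
      ENNReal.ofReal (2 * Real.exp a / η) * ∑' i, β i * γ i := by
    refine (meas_ge_le_lintegral_div hnumm.aemeasurable hden0 hdent).trans ?_
    rw [ENNReal.div_le_iff hden0 hdent]
    refine hnum_le.trans (le_of_eq ?_)
    have hc : ENNReal.ofReal (2 * Real.exp a / η) * (ENNReal.ofReal η * e) = 2 := by
      rw [he, ← ENNReal.ofReal_mul hη.le, ← ENNReal.ofReal_mul (by positivity), Real.exp_neg]
      have : 2 * Real.exp a / η * (η * (Real.exp a)⁻¹) = 2 := by field_simp
      rw [this]
      simp
    rw [hpG, ← mul_assoc, mul_comm _ 2, ← hc]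
    ring
  calc _ ≤ Q ((⋃ i, R i) ∪ {ω | ∫⁻ θ, l θ ω ∂P < e * p}) +
          Q {ω | ENNReal.ofReal η * (e * p) ≤ num ω} :=
        (measure_mono hsub).trans (measure_union_le _ _)
    _ ≤ (Q (⋃ i, R i) + Q {ω | ∫⁻ θ, l θ ω ∂P < e * p}) +
          Q {ω | ENNReal.ofReal η * (e * p) ≤ num ω} := by
        gcongr
        exact measure_union_le _ _
    _ ≤ _ := by
        refine add_le_add (add_le_add ?_ (measure_lintegral_lt_le Q P hl hG hτ)) hlast
        exact (measure_iUnion_le R).trans (ENNReal.tsum_le_tsum hα)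

end BayesRisk

/-! ### Testing a whole shell and bounding the posterior at one time. -/

section Shell

variable {Θ S A : Type*} [MeasurableSpace Θ] [MeasurableSpace S] [MeasurableSpace A]
  {m : Measure S} [SigmaFinite m] {M : TransitionModel Θ S A m} {θ₀ : Θ} {c d : ℝ}

theorem measurableSet_shell (M : TransitionModel Θ S A m) (lam : Measure (S × A))
    [SFinite lam] {w : S × A → ℝ≥0∞} (hw : Measurable w) (ε : ℝ) (j : ℕ) :
    MeasurableSet (shell (semiDist M lam w) θ₀ ε j) := by
  have h := measurable_semiDist_left M lam hw θ₀
  exact (measurableSet_lt measurable_const h).inter (measurableSet_le h measurable_const)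

/-- A test of `θ₀` against a whole shell. -/
theorem ComparableWith.exists_shell_test (hM : ComparableWith M θ₀ c d)
    {D : Set S} (hD : MeasurableSet D) (ρ : Measure S) [IsProbabilityMeasure ρ] (π : Policy S A)
    (hT : ∀ᵐ x ∂(pathLaw M ρ π θ₀), Terminates D x)
    (lam : Measure (S × A)) [IsFiniteMeasure lam] (hlam : ∀ t, occupancy M D ρ π θ₀ t ≪ lam)
    (N r : ℕ) {ε b : ℝ} (hε : 0 < ε) {j : ℕ} (hj : 2 ≤ j)
    (hcov : ∃ C : Finset Θ, (C.card : ℝ≥0∞) ≤ ENNReal.ofReal (Real.exp b) ∧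
      ∀ θ, discountedDist M D ρ π θ₀ lam (testDiscount d * c) θ θ₀ < 2 * (j * ε) →
        ∃ q ∈ C, discountedDist M D ρ π θ₀ lam (testDiscount d * d) θ q ≤
          testRadius d * (j * ε)) :
    ∃ R : Set (ℕ → Path S A), MeasurableSet R ∧
      episodesLaw M ρ π θ₀ R ≤
        ENNReal.ofReal (Real.exp (b - testRate d * N * (j * ε) ^ 2)) ∧
      ∀ θ ∈ shell (discountedDist M D ρ π θ₀ lam (testDiscount d * c)) θ₀ ε j,
        ∫⁻ ω, Rᶜ.indicator (fun _ => (1 : ℝ≥0∞)) ω *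
          ENNReal.ofReal (historyLR M D N r θ₀ θ ω) ∂(episodesLaw M ρ π θ₀) ≤
        ENNReal.ofReal (Real.exp (-(testRate d * N * (j * ε) ^ 2))) := by
  classical
  obtain ⟨C, hcard, hC⟩ := hcov
  set dμ := discountedDist M D ρ π θ₀ lam (testDiscount d * c) with hdμ
  set dν := discountedDist M D ρ π θ₀ lam (testDiscount d * d) with hdν
  have hd := hM.one_le
  have hδd := testDiscount_mul_self hd
  have hr : 0 ≤ testRadius d := by
    unfold testRadius
    positivity
  have hK : 0 ≤ testRate d := by
    unfold testRate
    positivity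
  have hjε : 0 ≤ j * ε := by positivity
  have hexp : ∀ θ₁ ∈ shell dμ θ₀ ε j, Real.exp (-(testRate d * N * dμ θ₀ θ₁ ^ 2)) ≤
      Real.exp (-(testRate d * N * (j * ε) ^ 2)) := by
    intro θ₁ h₁
    have h2 : j * ε ≤ dμ θ₀ θ₁ := by
      rw [hdμ, discountedDist, semiDist_comm]
      exact h₁.1.le
    gcongr
  -- A covering centre need not lie in the shell and may be close to θ₀. It is replaced by a shell
  -- point of its ball, and centres without such a point are discarded.
  set good : Θ → Prop := fun q => ∃ θ₁ ∈ shell dμ θ₀ ε j, dν θ₁ q ≤ testRadius d * (j * ε)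
    with hgood
  set R : Θ → Set (ℕ → Path S A) := fun q =>
    if h : good q then rejection M D θ₀ h.choose d N else ∅ with hR
  have hRm : ∀ q, MeasurableSet (R q) := by
    intro q
    simp only [hR]
    split_ifs with h
    · exact measurableSet_rejection M hD _ _ _ _
    · exact MeasurableSet.empty
  refine ⟨⋃ q ∈ C, R q, C.measurableSet_biUnion fun q _ => hRm q, ?_, fun θ hθ => ?_⟩
  · have hq : ∀ q, episodesLaw M ρ π θ₀ (R q) ≤
        ENNReal.ofReal (Real.exp (-(testRate d * N * (j * ε) ^ 2))) := by
      intro q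
      simp only [hR]
      split_ifs with h
      · exact (hM.rejection_null_le hD ρ π lam hlam _ N).trans
          (ENNReal.ofReal_le_ofReal (hexp _ h.choose_spec.1))
      · simp
    calc episodesLaw M ρ π θ₀ (⋃ q ∈ C, R q)
        ≤ ∑ q ∈ C, episodesLaw M ρ π θ₀ (R q) := measure_biUnion_finset_le C R
      _ ≤ ∑ _q ∈ C, ENNReal.ofReal (Real.exp (-(testRate d * N * (j * ε) ^ 2))) :=
          Finset.sum_le_sum fun q _ => hq q
      _ = C.card * ENNReal.ofReal (Real.exp (-(testRate d * N * (j * ε) ^ 2))) := by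
          rw [Finset.sum_const, nsmul_eq_mul]
      _ ≤ ENNReal.ofReal (Real.exp b) *
          ENNReal.ofReal (Real.exp (-(testRate d * N * (j * ε) ^ 2))) := by gcongr
      _ = _ := by
          rw [← ENNReal.ofReal_mul (Real.exp_nonneg _), ← Real.exp_add]
          rfl
  · have hj2 : (2 : ℝ) ≤ j := by exact_mod_cast hj
    -- For j ≥ 2 one has (j + 1)ε < 2jε, so the shell is inside the covered ball.
    obtain ⟨q, hqC, hq⟩ := hC θ (by nlinarith [hθ.2])
    have hg : good q := ⟨θ, hθ, hq⟩
    have h₁ := hg.choose_spec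
    have hRq : R q = rejection M D θ₀ hg.choose d N := dif_pos hg
    set θ₁ := hg.choose with hθ₁
    -- Both legs, through the centre q, are at most ξjε, and the shell point θ₁ satisfies jε ≤
    -- d_μ(θ₀, θ₁).
    have hdist : dν θ θ₁ ≤ 2 * testRadius d * dμ θ₀ θ₁ := by
      have htri := semiDist_sq_triangle M D ρ π θ₀ lam hlam (δ := testDiscount d * d)
        (by rw [hδd]; norm_num) (by rw [hδd]; norm_num) θ q θ₁
      have h2 : dν θ q ^ 2 ≤ (testRadius d * (j * ε)) ^ 2 :=
        pow_le_pow_left₀ (semiDist_nonneg _ _ _ _ _) hq 2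
      have h3 : dν q θ₁ ^ 2 ≤ (testRadius d * (j * ε)) ^ 2 := by
        refine pow_le_pow_left₀ (semiDist_nonneg _ _ _ _ _) ?_ 2
        exact (semiDist_comm _ _ _ _ _).trans_le h₁.2
      have h4 : dν θ θ₁ ^ 2 ≤ (2 * testRadius d * (j * ε)) ^ 2 := by
        calc dν θ θ₁ ^ 2 ≤ 2 * dν θ q ^ 2 + 2 * dν q θ₁ ^ 2 := htri
          _ ≤ 2 * (testRadius d * (j * ε)) ^ 2 + 2 * (testRadius d * (j * ε)) ^ 2 := by gcongr
          _ = _ := by ring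
      have h5 : dν θ θ₁ ≤ 2 * testRadius d * (j * ε) :=
        le_of_sq_le_sq h4 (by positivity)
      have h6 : j * ε ≤ dμ θ₀ θ₁ := by
        rw [hdμ, discountedDist, semiDist_comm]
        exact h₁.1.1.le
      exact h5.trans (by gcongr)
    refine le_trans (lintegral_mono fun ω => mul_le_mul_left ?_ _)
      ((hM.lintegral_rejection_compl_mul_historyLR_le hD ρ π hT lam hlam θ θ₁ hdist N r).trans
        (ENNReal.ofReal_le_ofReal (hexp _ h₁.1)))
    refine Set.indicator_le_indicator_of_subset (Set.compl_subset_compl.2 ?_)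
      (fun _ => zero_le) ω
    rw [← hRq]
    exact Set.subset_biUnion_of_mem (u := R) (Finset.mem_coe.2 hqC)

/-- A bound for the posterior mass away from the truth at one time. -/
theorem ComparableWith.measure_le_posteriorProb_le (hM : ComparableWith M θ₀ c d)
    {D : Set S} (hD : MeasurableSet D) (ρ : Measure S) [IsProbabilityMeasure ρ] (π : Policy S A)
    (hT : ∀ᵐ x ∂(pathLaw M ρ π θ₀), Terminates D x)
    (N r : ℕ) (P : Measure Θ) [IsProbabilityMeasure P] {ε n a : ℝ} (ha : 0 < a)
    {B : Set Θ} {V : ℕ → Set Θ} (hV : ∀ i, MeasurableSet (V i)) (hBV : B ⊆ ⋃ i, V i)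
    {R : ℕ → Set (ℕ → Path S A)} (hR : ∀ i, MeasurableSet (R i)) {α β γ : ℕ → ℝ≥0∞}
    (hα : ∀ i, episodesLaw M ρ π θ₀ (R i) ≤ α i)
    (hβ : ∀ i, ∀ θ ∈ V i, ∫⁻ ω, (R i)ᶜ.indicator (fun _ => (1 : ℝ≥0∞)) ω *
          ENNReal.ofReal (historyLR M D N r θ₀ θ ω) ∂(episodesLaw M ρ π θ₀) ≤ β i)
    (hγ : ∀ i, P (V i) ≤ γ i * P (starBall M D ρ π θ₀ ε n)) {η : ℝ} (hη : 0 < η) :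
    episodesLaw M ρ π θ₀ {ω | ENNReal.ofReal η ≤ posteriorProb M D P N r ω B} ≤
      ∑' i, α i + 2 * ENNReal.ofReal (((N + 1) * ε ^ 2 + 1) / a) +
        ENNReal.ofReal (2 * Real.exp a / η) * ∑' i, β i * γ i := by
  have hη' : ENNReal.ofReal η ≠ 0 := (ENNReal.ofReal_pos.2 hη).ne'
  refine (measure_mono fun ω hω => hM.mul_evidence_le hD P N r ω hη' hω).trans ?_
  exact measure_mul_lintegral_le_le _ P (measurable_historyLR M hD N r θ₀).ennreal_ofReal
    (measurableSet_starBall M hD hM ρ π ε n)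
    (fun θ hθ => hM.measure_historyLR_lt_le hD ρ π hT N r hθ ha) hV hBV hR hα hβ hγ hη

end Shell

theorem tsum_le_ofReal_geometric {q : ℝ} (hq0 : 0 ≤ q) (hq1 : q < 1) {J : ℕ} {f : ℕ → ℝ≥0∞}
    (hf : ∀ i, f i ≤ ENNReal.ofReal (q ^ (J + i))) :
    ∑' i, f i ≤ ENNReal.ofReal (q ^ J / (1 - q)) := by
  have hs : HasSum (fun i : ℕ => q ^ (J + i)) (q ^ J / (1 - q)) := by
    simpa only [pow_add, div_eq_mul_inv] using
      (hasSum_geometric_of_lt_one hq0 hq1).mul_left (q ^ J)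
  refine (ENNReal.tsum_le_tsum hf).trans_eq ?_
  rw [← ENNReal.ofReal_tsum_of_nonneg (fun i => pow_nonneg hq0 _) hs.summable, hs.tsum_eq]

/-- From j ≤ j², Gaussian decay in j is weakened to geometric decay with a ratio that no longer
depends on x = Nε². -/
theorem exp_le_exp_pow {K x c₀ y : ℝ} {j : ℕ} (hj : 1 ≤ j) (hK : 0 < K) (hc₀ : 0 < c₀)
    (hx : c₀ ≤ x) (hy : y ≤ -(K * x * j ^ 2 / 4)) :
    Real.exp y ≤ Real.exp (-(K * c₀ / 4)) ^ j := by
  rw [← Real.exp_nat_mul, Real.exp_le_exp]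
  have hj' : (1 : ℝ) ≤ j := by exact_mod_cast hj
  have h1 : (j : ℝ) ≤ j ^ 2 := by nlinarith
  have hx0 : 0 < x := hc₀.trans_le hx
  have h2 : K * c₀ * j ≤ K * x * j ^ 2 := by gcongr
  linarith

/-! ### Explicit contraction bound. -/

section Contraction

variable {Θ S A : Type*} [MeasurableSpace Θ] [MeasurableSpace S] [MeasurableSpace A]
  {m : Measure S} [SigmaFinite m] {M : TransitionModel Θ S A m} {θ₀ : Θ} {c d : ℝ}

theorem testRate_pos {d : ℝ} (hd : 1 ≤ d) : 0 < testRate d := by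
  unfold testRate
  positivity

theorem testRadius_pos {d : ℝ} (hd : 1 ≤ d) : 0 < testRadius d := by
  unfold testRadius
  positivity

theorem testRadius_lt_one {d : ℝ} (hd : 1 ≤ d) : testRadius d < 1 := by
  unfold testRadius
  rw [div_lt_one (by linarith)]
  linarith

/-- An explicit bound for the probability that the posterior puts mass at least `η` at distance
more than `(J + 1) * ε` from the truth. -/
theorem ComparableWith.measure_le_posteriorProb_le_geometric (hM : ComparableWith M θ₀ c d)
    {D : Set S} (hD : MeasurableSet D) (ρ : Measure S) [IsProbabilityMeasure ρ] (π : Policy S A)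
    (hT : ∀ᵐ x ∂(pathLaw M ρ π θ₀), Terminates D x)
    (lam : Measure (S × A)) [IsFiniteMeasure lam] (hlam : ∀ t, occupancy M D ρ π θ₀ t ≪ lam)
    {N : ℕ} (hN : 0 < N) (r : ℕ) (P : Measure Θ) [IsProbabilityMeasure P] {ε n c₀ : ℝ}
    (hε : 0 < ε) (hc₀ : 0 < c₀) (hx : c₀ ≤ N * ε ^ 2) {J : ℕ} (hJ2 : 2 ≤ J)
    (hKJ : 2 ≤ testRate d * J ^ 2)
    (hcov : ∀ j : ℕ, J ≤ j → ∃ C : Finset Θ,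
      (C.card : ℝ≥0∞) ≤ ENNReal.ofReal (Real.exp (N * ε ^ 2)) ∧
      ∀ θ, discountedDist M D ρ π θ₀ lam (testDiscount d * c) θ θ₀ < 2 * (j * ε) →
        ∃ q ∈ C, discountedDist M D ρ π θ₀ lam (testDiscount d * d) θ q ≤
          testRadius d * (j * ε))
    (hprior : ∀ j : ℕ, J ≤ j →
      P (shell (discountedDist M D ρ π θ₀ lam (testDiscount d * c)) θ₀ ε j) ≤
        ENNReal.ofReal (Real.exp (testRate d * N * ε ^ 2 * j ^ 2 / 2)) *
          P (starBall M D ρ π θ₀ ε n))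
    {L : ℝ} (hL : (J : ℝ) + 1 ≤ L) {η : ℝ} (hη : 0 < η) :
    episodesLaw M ρ π θ₀ {ω | ENNReal.ofReal η ≤ posteriorProb M D P N r ω
        {θ | L * ε ≤ discountedDist M D ρ π θ₀ lam (testDiscount d * c) θ θ₀}} ≤
      ENNReal.ofReal ((1 + 2 / η) * (Real.exp (-(testRate d * c₀ / 4)) ^ J /
        (1 - Real.exp (-(testRate d * c₀ / 4)))) +
          2 * ((8 + 4 / c₀) / (testRate d * J ^ 2))) := by
  have hK := testRate_pos hM.one_le
  set K := testRate d with hKdef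
  set x := (N : ℝ) * ε ^ 2 with hxdef
  have hx0 : 0 < x := hc₀.trans_le hx
  set q := Real.exp (-(K * c₀ / 4)) with hq
  have hq0 : 0 ≤ q := Real.exp_nonneg _
  have hq1 : q < 1 := Real.exp_lt_one_iff.2 (by
    have := mul_pos hK hc₀
    linarith)
  have hJ0 : (0 : ℝ) < J := by exact_mod_cast (by omega : 0 < J)
  -- Large compared with x, so that low evidence has probability of order 1/J²; small compared with
  -- the surplus Kxj²/2 that the tests leave over the prior ratio for j ≥ J.
  set a := K * J ^ 2 * x / 4 with ha
  have ha0 : 0 < a := by positivity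
  choose R hRm hRα hRβ using fun i : ℕ =>
    hM.exists_shell_test hD ρ π hT lam hlam N r (b := x) hε (j := J + i) (by omega)
      (hcov (J + i) (by omega))
  have hw := measurable_discountedDensity M D ρ π θ₀ lam (testDiscount d * c)
  have hmain := hM.measure_le_posteriorProb_le hD ρ π hT N r P (n := n) ha0
    (fun i => measurableSet_shell M lam hw ε (J + i))
    (subset_iUnion_shell _ θ₀ hε hL) hRm hRα hRβ (fun i => hprior (J + i) (by omega)) hη
  have hJj : ∀ i : ℕ, (J : ℝ) ^ 2 ≤ ((J + i : ℕ) : ℝ) ^ 2 := fun i => by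
    have : (J : ℝ) ≤ ((J + i : ℕ) : ℝ) := by exact_mod_cast Nat.le_add_right J i
    gcongr
  have h1 : ∑' i : ℕ, ENNReal.ofReal (Real.exp (x - K * N * (((J + i : ℕ) : ℝ) * ε) ^ 2)) ≤
      ENNReal.ofReal (q ^ J / (1 - q)) := by
    refine tsum_le_ofReal_geometric hq0 hq1 fun i => ENNReal.ofReal_le_ofReal ?_
    refine exp_le_exp_pow (by omega) hK hc₀ hx ?_
    have e : K * N * (((J + i : ℕ) : ℝ) * ε) ^ 2 = K * ((J + i : ℕ) : ℝ) ^ 2 * x := by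
      rw [hxdef]; ring
    -- The entropy x is then at most half of the exponent Kj²x of the test.
    have h2 : 2 ≤ K * ((J + i : ℕ) : ℝ) ^ 2 :=
      hKJ.trans (mul_le_mul_of_nonneg_left (hJj i) hK.le)
    rw [e]
    nlinarith
  have h3 : ENNReal.ofReal (2 * Real.exp a / η) *
      ∑' i : ℕ, ENNReal.ofReal (Real.exp (-(K * N * (((J + i : ℕ) : ℝ) * ε) ^ 2))) *
        ENNReal.ofReal (Real.exp (K * N * ε ^ 2 * ((J + i : ℕ) : ℝ) ^ 2 / 2)) ≤
      ENNReal.ofReal (2 / η * (q ^ J / (1 - q))) := by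
    rw [ENNReal.ofReal_mul (by positivity), mul_div_right_comm,
      ENNReal.ofReal_mul (by positivity), mul_assoc, ← ENNReal.tsum_mul_left]
    gcongr
    refine tsum_le_ofReal_geometric hq0 hq1 fun i => ?_
    rw [← ENNReal.ofReal_mul (Real.exp_nonneg _), ← ENNReal.ofReal_mul (Real.exp_nonneg _),
      ← Real.exp_add, ← Real.exp_add]
    refine ENNReal.ofReal_le_ofReal (exp_le_exp_pow (by omega) hK hc₀ hx ?_)
    have e : a + (-(K * N * (((J + i : ℕ) : ℝ) * ε) ^ 2) +
        K * N * ε ^ 2 * ((J + i : ℕ) : ℝ) ^ 2 / 2) =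
        K * x * (J : ℝ) ^ 2 / 4 - K * x * ((J + i : ℕ) : ℝ) ^ 2 / 2 := by
      rw [ha, hxdef]; ring
    have h4 : K * x * (J : ℝ) ^ 2 ≤ K * x * ((J + i : ℕ) : ℝ) ^ 2 :=
      mul_le_mul_of_nonneg_left (hJj i) (by positivity)
    rw [e]
    linarith
  have h5 : ((N + 1) * ε ^ 2 + 1) / a ≤ (8 + 4 / c₀) / (K * J ^ 2) := by
    have hN1 : (1 : ℝ) ≤ N := by exact_mod_cast hN
    have h6 : ((N : ℝ) + 1) * ε ^ 2 + 1 ≤ 2 * x + x / c₀ := by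
      have h7 : ε ^ 2 ≤ x := le_mul_of_one_le_left (sq_nonneg ε) hN1
      have h8 : 1 ≤ x / c₀ := (one_le_div hc₀).2 hx
      rw [add_mul, one_mul]
      linarith
    calc ((N + 1) * ε ^ 2 + 1) / a ≤ (2 * x + x / c₀) / a := by gcongr
      _ = (8 + 4 / c₀) / (K * J ^ 2) := by
        rw [ha]
        field_simp
        ring
  have hq2 : 0 ≤ q ^ J / (1 - q) := div_nonneg (pow_nonneg hq0 _) (by linarith)
  refine hmain.trans ((add_le_add (add_le_add h1
    (mul_le_mul_right (ENNReal.ofReal_le_ofReal h5) 2)) h3).trans_eq ?_)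
  rw [show (2 : ℝ≥0∞) = ENNReal.ofReal 2 by simp, ← ENNReal.ofReal_mul (by norm_num),
    ← ENNReal.ofReal_add hq2 (by positivity), ← ENNReal.ofReal_add (by positivity) (by positivity)]
  congr 1
  ring

end Contraction

theorem tendsto_contraction_bound {q : ℝ} (hq0 : 0 ≤ q) (hq1 : q < 1) (u v K : ℝ) {J : ℕ → ℕ}
    (hJ : Tendsto J atTop atTop) :
    Tendsto (fun t => ENNReal.ofReal (u * (q ^ J t / (1 - q)) +
      2 * (v / (K * (J t : ℝ) ^ 2)))) atTop (𝓝 0) := by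
  have h1 : Tendsto (fun t => q ^ J t) atTop (𝓝 0) :=
    (tendsto_pow_atTop_nhds_zero_of_lt_one hq0 hq1).comp hJ
  have h2 : Tendsto (fun t => ((J t : ℝ) ^ 2)⁻¹) atTop (𝓝 0) :=
    tendsto_inv_atTop_zero.comp ((tendsto_pow_atTop two_ne_zero).comp
      (tendsto_natCast_atTop_atTop.comp hJ))
  have h3 := ((h1.div_const (1 - q)).const_mul u).add ((h2.const_mul (v / K)).const_mul 2)
  have h4 : Tendsto (fun t => u * (q ^ J t / (1 - q)) + 2 * (v / (K * (J t : ℝ) ^ 2))) atTop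
      (𝓝 0) := by
    convert h3 using 2
    · rw [← div_div, div_eq_mul_inv (v / K)]
    · simp
  simpa using ENNReal.tendsto_ofReal h4

end EpisodicMDP

theorem mainTheorem2 {Θ S A : Type*} [MeasurableSpace Θ] [MeasurableSpace S] [MeasurableSpace A]
    (m : Measure S) [SigmaFinite m] (M : EpisodicMDP.TransitionModel Θ S A m) (θ₀ : Θ)
    (hA5 : EpisodicMDP.UniformlyComparable M θ₀) (D : Set S) (hD : MeasurableSet D) :
    ∃ K ξ δμ δν : ℝ, 0 < K ∧ 0 < ξ ∧ ξ < 1 ∧ 0 < δμ ∧ δμ < 1 ∧ 0 < δν ∧ δν < 1 ∧ δμ ≠ δν ∧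
      ∀ (ρ : Measure S) [IsProbabilityMeasure ρ] (π : EpisodicMDP.Policy S A)
        (lam : Measure (S × A)) [IsFiniteMeasure lam],
        (∀ t, EpisodicMDP.occupancy M D ρ π θ₀ t ≪ lam) →
        (∀ᵐ x ∂(EpisodicMDP.pathLaw M ρ π θ₀), EpisodicMDP.Terminates D x) →
        ∀ dμ dν : Θ → Θ → ℝ,
        dμ = EpisodicMDP.semiDist M lam
          (EpisodicMDP.discountedDensity M D ρ π θ₀ lam δμ) →
        dν = EpisodicMDP.semiDist M lam
          (EpisodicMDP.discountedDensity M D ρ π θ₀ lam δν) →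
        -- `K, ξ, μ, ν` are those of the testing lemma:
        (∀ (N : ℕ) (θ₁ : Θ), ∃ φ : (ℕ → EpisodicMDP.Path S A) → ℝ,
          Measurable φ ∧ (∀ ω, 0 ≤ φ ω ∧ φ ω ≤ 1) ∧
          (∀ ω ω', (∀ i < N, EpisodicMDP.SameEpisode D (ω i) (ω' i)) → φ ω = φ ω') ∧
          ∫ ω, φ ω ∂(EpisodicMDP.episodesLaw M ρ π θ₀) ≤ Real.exp (-(K * N * dμ θ₀ θ₁ ^ 2)) ∧
          ∀ θ, dν θ θ₁ ≤ ξ * dμ θ₀ θ₁ →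
            ∫ ω, (1 - φ ω) ∂(EpisodicMDP.episodesLaw M ρ π θ)
              ≤ Real.exp (-(K * N * dμ θ₀ θ₁ ^ 2))) ∧
        -- posterior contraction:
        ∀ (n : ℝ) (N r : ℕ → ℕ) (P : ℕ → Measure Θ) (ε : ℕ → ℝ),
          0 < n →
          (∀ t, IsProbabilityMeasure (P t)) →
          (∀ᶠ t in atTop, 0 < N t) →
          (∀ t, 0 < ε t) →
          Tendsto ε atTop (𝓝 0) →
          (fun t => 1 / ((N t : ℝ) * ε t ^ 2)) =O[atTop] (fun _ => (1 : ℝ)) →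
          (∀ᶠ t in atTop,
            (⨆ (ε' : ℝ) (_ : ε t < ε'),
              ENNReal.log ((EpisodicMDP.coveringNumber dν (1 / 2 * ξ * ε')
                {θ | dμ θ θ₀ < ε'} : ℕ∞) : ℝ≥0∞)) ≤ (((N t : ℝ) * ε t ^ 2 : ℝ) : EReal)) →
          (∃ j₀ : ℕ, ∀ᶠ t in atTop, ∀ j : ℕ, j₀ ≤ j →
            P t {θ | j * ε t < dμ θ θ₀ ∧ dμ θ θ₀ ≤ (j + 1) * ε t} /
                P t (EpisodicMDP.starBall M D ρ π θ₀ (ε t) n)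
              ≤ ENNReal.ofReal (Real.exp (K * N t * ε t ^ 2 * j ^ 2 / 2))) →
          ∀ L : ℕ → ℝ, Tendsto L atTop atTop →
            TendstoInMeasure (EpisodicMDP.episodesLaw M ρ π θ₀)
              (fun t ω => (EpisodicMDP.posteriorProb M D (P t) (N t) (r t) ω
                {θ | L t * ε t ≤ dμ θ θ₀}).toReal)
              atTop (fun _ => (0 : ℝ)) := by
  obtain ⟨c, d, hM, hcd⟩ := hA5.exists_comparableWith
  have hd := hM.one_le
  have hd0 : 0 < d := zero_lt_one.trans_le hd
  have hK := EpisodicMDP.testRate_pos hd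
  have hδ0 : 0 < EpisodicMDP.testDiscount d := by
    unfold EpisodicMDP.testDiscount
    positivity
  have hδd := EpisodicMDP.testDiscount_mul_self hd
  -- Strictness of c < d is what makes the two discount factors different; the larger one is 1/2.
  have hδcd : EpisodicMDP.testDiscount d * c < EpisodicMDP.testDiscount d * d :=
    mul_lt_mul_of_pos_left hcd hδ0
  refine ⟨EpisodicMDP.testRate d, EpisodicMDP.testRadius d, EpisodicMDP.testDiscount d * c,
    EpisodicMDP.testDiscount d * d, hK, EpisodicMDP.testRadius_pos hd,
    EpisodicMDP.testRadius_lt_one hd, mul_pos hδ0 hM.pos, by linarith, by linarith, by linarith,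
    hδcd.ne, ?_⟩
  intro ρ _ π lam _ hlam hT dμ dν hμ hν
  subst hμ hν
  refine ⟨fun N θ₁ => hM.exists_test hD ρ π lam hlam N θ₁, ?_⟩
  intro n N r P ε _ hP hN hε _ hO hcov hprior L hL
  obtain ⟨j₀, hprior⟩ := hprior
  obtain ⟨C₀, hC₀, hO⟩ := hO.exists_pos
  have hO := hO.bound
  set K := EpisodicMDP.testRate d with hKdef
  -- The largest starting shell compatible with J + 1 ≤ L once L ≥ 1; it tends to infinity with L.
  set J : ℕ → ℕ := fun t => ⌊L t⌋₊ - 1 with hJdef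
  have hJ : Tendsto J atTop atTop :=
    (tendsto_sub_atTop_nat 1).comp (tendsto_nat_floor_atTop.comp hL)
  rw [tendstoInMeasure_iff_dist]
  intro η hη
  set q := Real.exp (-(K * (1 / C₀) / 4)) with hq
  have hq1 : q < 1 := Real.exp_lt_one_iff.2 (by
    have : 0 < K * (1 / C₀) := by positivity
    linarith)
  have hKJ : Tendsto (fun t => K * (J t : ℝ) ^ 2) atTop atTop :=
    ((tendsto_pow_atTop two_ne_zero).comp
      (tendsto_natCast_atTop_atTop.comp hJ)).const_mul_atTop hK
  refine tendsto_of_tendsto_of_tendsto_of_le_of_le' tendsto_const_nhds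
    (EpisodicMDP.tendsto_contraction_bound (Real.exp_nonneg _) hq1 (1 + 2 / η)
      (8 + 4 / (1 / C₀)) K hJ) (Eventually.of_forall fun _ => zero_le) ?_
  filter_upwards [hN, hO, hcov, hprior, hJ.eventually_ge_atTop (max 2 j₀),
    hKJ.eventually_ge_atTop 2, hL.eventually_ge_atTop 1] with t hNt hOt hct hpt hJt hKt hLt
  have hNt' : (0 : ℝ) < N t := by exact_mod_cast hNt
  have hx0 : 0 < (N t : ℝ) * ε t ^ 2 := mul_pos hNt' (pow_pos (hε t) 2)
  have hx : 1 / C₀ ≤ N t * ε t ^ 2 := by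
    rw [norm_one, mul_one, Real.norm_of_nonneg (by positivity), div_le_iff₀ hx0] at hOt
    rw [div_le_iff₀ hC₀]
    linarith
  have hJ2 : 2 ≤ J t := (le_max_left _ _).trans hJt
  have hJL : (J t : ℝ) + 1 ≤ L t := by
    have h1 : J t + 1 = ⌊L t⌋₊ := by
      have h2 : 1 ≤ ⌊L t⌋₊ := (Nat.one_le_floor_iff _).2 hLt
      simp only [hJdef]
      omega
    have h3 : ((J t + 1 : ℕ) : ℝ) ≤ L t := by
      rw [h1]
      exact Nat.floor_le (by linarith)
    simpa using h3
  have := hP t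
  refine (measure_mono fun ω hω => ?_).trans
    (hM.measure_le_posteriorProb_le_geometric hD ρ π hT lam hlam hNt (r t) (P t) (n := n)
      (hε t) (one_div_pos.2 hC₀) hx hJ2 hKt (fun j hj => ?_) (fun j hj => ?_) hJL hη)
  · change η ≤ dist _ _ at hω
    rw [Real.dist_eq, sub_zero, abs_of_nonneg ENNReal.toReal_nonneg] at hω
    exact ENNReal.ofReal_le_of_le_toReal hω
  · have hj2 : (2 : ℝ) ≤ j := by exact_mod_cast hJ2.trans hj
    -- The covering hypothesis is used at ε' = 2jε, for which the radius ξε'/2 is ξjε.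
    have hlt : ε t < 2 * (j * ε t) := by nlinarith [hε t]
    have h1 := (le_iSup₂ (f := fun (ε' : ℝ) (_ : ε t < ε') =>
      ENNReal.log ((EpisodicMDP.coveringNumber (EpisodicMDP.semiDist M lam
        (EpisodicMDP.discountedDensity M D ρ π θ₀ lam (EpisodicMDP.testDiscount d * d)))
        (1 / 2 * EpisodicMDP.testRadius d * ε')
        {θ | EpisodicMDP.semiDist M lam (EpisodicMDP.discountedDensity M D ρ π θ₀ lam
          (EpisodicMDP.testDiscount d * c)) θ θ₀ < ε'} : ℕ∞) : ℝ≥0∞)) _ hlt).trans hct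
    obtain ⟨C, hcard, hC⟩ := EpisodicMDP.exists_finset_of_log_coveringNumber_le h1
    refine ⟨C, hcard, fun θ hθ => ?_⟩
    obtain ⟨p, hp, hpθ⟩ := hC θ hθ
    exact ⟨p, hp, hpθ.trans_eq (by ring)⟩
  · have h1 := hpt j ((le_max_right _ _).trans (hJt.trans hj))
    -- The right-hand side is finite and nonzero, so the division can be cleared even if the prior
    -- mass of B* is zero.
    refine (ENNReal.div_le_iff_le_mul (Or.inr ENNReal.ofReal_ne_top) (Or.inr ?_)).1 h1
    exact (ENNReal.ofReal_pos.2 (Real.exp_pos _)).ne'
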